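/- **Theorem (Contraction for the Euler--Maruyama scheme).** *Setting.* Let $\gamma,\kappa>0$, $R\ge 0$, and let $U:\mathbb{R}^d\to\mathbb{R}$ be differentiable with $|\nabla U(x)-\nabla U(y)|\le L|x-y|$ for all $x,y$ and $(\nabla U(x)-\nabla U(y))\cdot(x-y)\ge\kappa|x-y|^2$ whenever $|x-y|>R$. Write $U(x)=\frac12x^TKx+G(x)$, where $K$ is symmetric positive definite with smallest eigenvalue $\kappa$, $L_K$ is the Lipschitz constant of $x\mapsto Kx$, $(\nabla G(x)-\nabla G(y))\cdot(x-y)\ge0$ whenever $|x-y|>R$, and $\nabla G$ is $L_G$-Lipschitz. Assume $\gamma\ge 4L_G/\sqrt\kappa$. *Distance.* Put $\tau=\min(\frac18,\frac{\gamma^{-2}\kappa}4)$, $\alpha=2L\gamma^{-2}$, $\epsilon=\frac12\min\big(1,\frac{2\alpha}{3\sqrt{L_K}\gamma^{-1}},\alpha\big)$, $\mathcal{E}=\min\big(\frac{\sqrt\kappa\gamma^{-1}}{\sqrt8\alpha},\frac12\big)$, $\mathcal{R}=\tau^{-1}L_GR^2\gamma^{-2}$. For $a=(x,v)$, $a'=(x',v')$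 in $\mathbb{R}^{2d}$, $z=x-x'$, $w=v-v'$, let $$r_l(a,a')^2=\gamma^{-2}z^TKz+\tfrac12|(1-2\tau)z+\gamma^{-1}w|^2+\tfrac12\gamma^{-2}|w|^2,\qquad r_s(a,a')=\alpha|z|+|z+\gamma^{-1}w|,$$ $\Delta=r_s-\epsilon r_l$, $D_{\mathcal K}=\sup\{\Delta(a,a'):a-a'\in\mathcal{K}\}$ with $\mathcal{K}=\{(z,w):\kappa\gamma^{-2}|z|^2+\frac12|z+\gamma^{-1}w|^2+\frac12|\gamma^{-1}w|^2\le\mathcal{R}\}$, and $R_1=\sup\{r_s(a,a'):\Delta(a,a')\le D_{\mathcal K}\}$. Let $f(r)=\int_0^r\phi\psi\,ds$ with $$\phi(s)=e^{-128\alpha\gamma^2(s\wedge R_1)^2/2},\quad \Phi(s)=\int_0^s\phi\,dx,\quad \psi(s)=1-\frac{\hat c\gamma}2\int_0^{s\wedge R_1}\frac{\Phi}{\phi}\,dx,\quad \hat c=\Big(\gamma\int_0^{R_1}\frac{\Phi}{\phi}\,ds\Big)^{-1}$$ (if $R_1=0$, then $\hat c=+\infty$ and $\psi\equiv1$), and define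 $$\rho(a,a')=f\big(\Delta(a,a')\wedge D_{\mathcal K}+\epsilon\, r_l(a,a')\big).$$ Let $$c=\min\Big(f'(R_1)\tfrac{\epsilon\kappa\gamma^{-1}}8\mathcal{E},\ f'(R_1)\tfrac{\epsilon\gamma}{16}\mathcal{E},\ f'(R_1)\tfrac\gamma8,\ f'(R_1)\tfrac{\gamma\alpha}2,\ \tfrac{9\hat c}{640},\ \tfrac{\hat c}{32(4\alpha+1)}\Big).$$ *Coupling.* Let $h>0$, $\varphi_{0,1}$ the standard normal density and $\beta=(2\gamma^{-1}h)^{-1/2}$. Let $\xi_k\sim\mathcal N(0,I_d)$ and $\mathcal U_k$ uniform on $[0,1]$, all independent. From arbitrary $(\mathbf X_0,\mathbf V_0)=(x,v)$, $(\mathbf X_0',\mathbf V_0')=(x',v')$ iterate $$\mathbf X_{k+1}=\mathbf X_k+h\mathbf V_k,\qquad \mathbf V_{k+1}=\mathbf V_k-h\nabla U(\mathbf X_k)-h\gamma\mathbf V_k+\sqrt{2\gamma h}\,\xi_{k+1},$$ and the same recursion for $(\mathbf X_k',\mathbf V_k')$ with $\xi_{k+1}'$ in place of $\xi_{k+1}$.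 Here, with $q_k=\mathbf X_k-\mathbf X_k'+\gamma^{-1}(\mathbf V_k-\mathbf V_k')$ and $e_k=q_k/|q_k|$ ($e_k=0$ if $q_k=0$), and $r_l,r_s$ evaluated at the current pair of states: $\xi'_{k+1}=\xi_{k+1}$ if $D_{\mathcal K}+\epsilon r_l\le r_s$; otherwise $\xi_{k+1}'=\xi_{k+1}+\beta q_k$ if $\mathcal U_{k+1}\le\varphi_{0,1}(e_k\cdot\xi_{k+1}+\beta|q_k|)/\varphi_{0,1}(e_k\cdot\xi_{k+1})$, and $\xi_{k+1}'=\xi_{k+1}-2(e_k\cdot\xi_{k+1})e_k$ if not. *Conclusion.* 1. The constant $R_1$ depends only on $(\gamma,\kappa,L,L_G,L_K,R)$, not on $d$ or $h$ (hence so do $f$, $\hat c$ and $c$), and $c>0$. 2. $\rho$ is a metric on $\mathbb{R}^{2d}$, and $|a-a'|\le\mathbf N\rho(a,a')\le\mathbf M|a-a'|$ for all $a,a'$, where $\mathbf M=f'(R_1)^{-1}\frac{2\max(\gamma(1+\alpha),1)}{\epsilon\min(\sqrt{2\kappa},1)}$ and $\mathbf N=f'(R_1)^{-1}\frac{\gamma}{\epsilon\min(\sqrt\kappa,\sqrt{1/2})}$.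 3. Suppose that $$L\gamma^{-1}h\le\min\Big(\frac1{8LR_1^2},\ \frac1{256\cdot75(2L\gamma^{-2}+1)},\ \frac{L\gamma^{-2}}8,\ \frac L{32L_K}\Big)$$ (the first term being $+\infty$ if $R_1=0$). Then the $\xi_k'$, $k\ge1$, are independent and $\mathcal N(0,I_d)$-distributed, so both chains are Euler--Maruyama chains, and for all $k\in\mathbb N$ the following expectation is finite and $$\mathbb E\big[\rho\big((\mathbf X_k,\mathbf V_k),(\mathbf X_k',\mathbf V_k')\big)\big]\le(1-ch)^k\rho\big((x,v),(x',v')\big).$$ -/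

import Mathlib

open MeasureTheory ProbabilityTheory
open scoped Gradient

noncomputable section

namespace KineticLangevin

/-- Position (or velocity) space `ℝ^d` with its Euclidean norm. -/
abbrev Pos (d : ℕ) : Type := EuclideanSpace ℝ (Fin d)

/-- Phase space `ℝ^{2d}`: pairs (position, velocity). The sup norm of this product type is never
used; the Euclidean distance of `ℝ^{2d}` is `euclDist` below. -/
abbrev Phase (d : ℕ) : Type := Pos d × Pos d

/-- The Euclidean distance of `ℝ^{2d}`. -/
def euclDist {d : ℕ} (a b : Phase d) : ℝ :=
  Real.sqrt (‖a.1 - b.1‖ ^ 2 + ‖a.2 - b.2‖ ^ 2)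

/-- The scalar parameters: friction `γ`, convexity constant `κ`, the Lipschitz constants `L` of
`∇U`, `LG` of `∇G` and `LK` of `x ↦ K x`, and the radius `R`. -/
structure Params where
  γ : ℝ
  κ : ℝ
  L : ℝ
  LG : ℝ
  LK : ℝ
  R : ℝ

/-! ### The potential -/

/-- `U` is `κ`-strongly convex outside a ball of radius `R`, with `L`-Lipschitz gradient. -/
structure PotentialAssumption {d : ℕ} (p : Params) (U : Pos d → ℝ) : Prop where
  κ_pos : 0 < p.κ
  R_nonneg : 0 ≤ p.R
  differentiable : Differentiable ℝ U
  strongly_convex_outside : ∀ x y : Pos d, p.R < ‖x - y‖ →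
    p.κ * ‖x - y‖ ^ 2 ≤ inner ℝ (∇ U x - ∇ U y) (x - y)
  lipschitz : ∀ x y : Pos d, ‖∇ U x - ∇ U y‖ ≤ p.L * ‖x - y‖

/-- The linear map `x ↦ K x` of `ℝ^d`. -/
abbrev act {d : ℕ} (K : Matrix (Fin d) (Fin d) ℝ) : Pos d →L[ℝ] Pos d :=
  Matrix.toEuclideanCLM (𝕜 := ℝ) K

/-- A splitting `U(x) = xᵀ K x / 2 + G(x)`: `K` is symmetric positive definite with smallest
eigenvalue `κ`, the Lipschitz constant of `x ↦ K x` (its operator norm) is `LK`, the gradient of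
`G` is `LG`-Lipschitz, and `G` is convex outside a ball of radius `R`. -/
structure Splitting {d : ℕ} (p : Params) (U : Pos d → ℝ)
    (K : Matrix (Fin d) (Fin d) ℝ) (G : Pos d → ℝ) : Prop where
  posDef : K.PosDef
  smallest_eigenvalue : IsLeast {μ : ℝ | Module.End.HasEigenvalue (Matrix.toLin' K) μ} p.κ
  norm_eq : ‖act K‖ = p.LK
  split : ∀ x, U x = 1 / 2 * inner ℝ x (act K x) + G x
  convex_outside : ∀ x y : Pos d, p.R < ‖x - y‖ → 0 ≤ inner ℝ (∇ G x - ∇ G y) (x - y)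
  lipschitz : ∀ x y : Pos d, ‖∇ G x - ∇ G y‖ ≤ p.LG * ‖x - y‖

/-! ### Scalar constants -/

def tau (p : Params) : ℝ := min (1 / 8) (p.γ⁻¹ ^ 2 * p.κ / 4)

def alpha (p : Params) : ℝ := 2 * p.L * p.γ⁻¹ ^ 2

def eps (p : Params) : ℝ :=
  1 / 2 * min 1 (min (2 * alpha p / (3 * Real.sqrt p.LK * p.γ⁻¹)) (alpha p))

/-- The constant `ℰ`. -/
def calE (p : Params) : ℝ := min (Real.sqrt p.κ * p.γ⁻¹ / (Real.sqrt 8 * alpha p)) (1 / 2)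

/-- The constant `ℛ`. -/
def calR (p : Params) : ℝ := (tau p)⁻¹ * p.LG * p.R ^ 2 * p.γ⁻¹ ^ 2

/-! ### The two metrics and the constants `D_𝒦` and `R₁` -/

section metrics

variable {d : ℕ}

def rl (p : Params) (K : Matrix (Fin d) (Fin d) ℝ) (a b : Phase d) : ℝ :=
  Real.sqrt (p.γ⁻¹ ^ 2 * inner ℝ (a.1 - b.1) (act K (a.1 - b.1))
    + 1 / 2 * ‖(1 - 2 * tau p) • (a.1 - b.1) + p.γ⁻¹ • (a.2 - b.2)‖ ^ 2
    + 1 / 2 * p.γ⁻¹ ^ 2 * ‖a.2 - b.2‖ ^ 2)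

def rs (p : Params) (a b : Phase d) : ℝ :=
  alpha p * ‖a.1 - b.1‖ + ‖(a.1 - b.1) + p.γ⁻¹ • (a.2 - b.2)‖

/-- `Δ = r_s - ε r_l`. -/
def Del (p : Params) (K : Matrix (Fin d) (Fin d) ℝ) (a b : Phase d) : ℝ :=
  rs p a b - eps p * rl p K a b

/-- The compact set `𝒦 ⊆ ℝ^{2d}`. -/
def setK (p : Params) (d : ℕ) : Set (Phase d) :=
  {a | p.κ * p.γ⁻¹ ^ 2 * ‖a.1‖ ^ 2 + 1 / 2 * ‖a.1 + p.γ⁻¹ • a.2‖ ^ 2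
    + 1 / 2 * ‖p.γ⁻¹ • a.2‖ ^ 2 ≤ calR p}

/-- `D_𝒦`, the supremum of `Δ` over all pairs of states whose difference lies in `𝒦`. -/
def DK (p : Params) (K : Matrix (Fin d) (Fin d) ℝ) : ℝ :=
  sSup {t : ℝ | ∃ a b : Phase d, a - b ∈ setK p d ∧ t = Del p K a b}

/-- `R₁`, the supremum of `r_s` over all pairs of states with `Δ ≤ D_𝒦`. -/
def radius (p : Params) (K : Matrix (Fin d) (Fin d) ℝ) : ℝ :=
  sSup {t : ℝ | ∃ a b : Phase d, Del p K a b ≤ DK p K ∧ t = rs p a b}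

end metrics

/-! ### The concave function `f`, as a function of the scalar parameters and of `R₁` -/

def phi (p : Params) (R₁ s : ℝ) : ℝ :=
  Real.exp (-(128 * alpha p * p.γ ^ 2 * ((min s R₁) ^ 2 / 2)))

/-- `Φ(s) = ∫₀ˢ φ`. -/
def Phi (p : Params) (R₁ s : ℝ) : ℝ := ∫ x in (0 : ℝ)..s, phi p R₁ x

/-- The constant `ĉ`. For `R₁ = 0` it is `+∞` on paper; here it has the value `0`, which makes
`ψ = 1` (the convention `∞ · 0 = 0` in `ψ`); see `rate` for the convention in the rate. -/
def chat (p : Params) (R₁ : ℝ) : ℝ :=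
  1 / (p.γ * ∫ s in (0 : ℝ)..R₁, Phi p R₁ s * (phi p R₁ s)⁻¹)

def psi (p : Params) (R₁ s : ℝ) : ℝ :=
  1 - chat p R₁ / 2 * p.γ * ∫ x in (0 : ℝ)..(min s R₁), Phi p R₁ x * (phi p R₁ x)⁻¹

def f (p : Params) (R₁ r : ℝ) : ℝ := ∫ s in (0 : ℝ)..r, phi p R₁ s * psi p R₁ s

/-- `f'(R₁)`. -/
def fPrime (p : Params) (R₁ : ℝ) : ℝ := deriv (f p R₁) R₁

/-- The part of the contraction rate that does not involve `ĉ`. -/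
def rateBase (p : Params) (R₁ : ℝ) : ℝ :=
  min (fPrime p R₁ * (eps p * p.κ * p.γ⁻¹ / 8) * calE p)
    (min (fPrime p R₁ * (eps p * p.γ / 16) * calE p)
      (min (fPrime p R₁ * (p.γ / 8)) (fPrime p R₁ * (p.γ * alpha p / 2))))

/-- The contraction rate `c`. If `R₁ = 0`, then `ĉ = +∞` and the two terms with `ĉ` drop out of
the minimum. -/
def rate (p : Params) (R₁ : ℝ) : ℝ :=
  if R₁ = 0 then rateBase p R₁
  else min (rateBase p R₁)
    (min (9 * chat p R₁ / 640) (chat p R₁ / (32 * (4 * alpha p + 1))))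

/-- The constant `𝐌` of the equivalence with the Euclidean distance. -/
def constM (p : Params) (R₁ : ℝ) : ℝ :=
  (fPrime p R₁)⁻¹ * (2 * max (p.γ * (1 + alpha p)) 1 / (eps p * min (Real.sqrt (2 * p.κ)) 1))

/-- The constant `𝐍` of the equivalence with the Euclidean distance. -/
def constN (p : Params) (R₁ : ℝ) : ℝ :=
  (fPrime p R₁)⁻¹ * (p.γ / (eps p * min (Real.sqrt p.κ) (Real.sqrt (1 / 2))))

/-- The step size condition; the bound by `1 / (8 L R₁²)` is void (`+∞`) if `R₁ = 0`. -/
def StepCondition (p : Params) (R₁ h : ℝ) : Prop :=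
  (R₁ ≠ 0 → p.L * p.γ⁻¹ * h ≤ 1 / (8 * p.L * R₁ ^ 2)) ∧
  p.L * p.γ⁻¹ * h ≤ 1 / (256 * 75 * (2 * p.L * p.γ⁻¹ ^ 2 + 1)) ∧
  p.L * p.γ⁻¹ * h ≤ p.L * p.γ⁻¹ ^ 2 / 8 ∧
  p.L * p.γ⁻¹ * h ≤ p.L / (32 * p.LK)

section coupling

variable {d : ℕ}

/-- The distance `ρ = f (min Δ D_𝒦 + ε r_l)`. -/
def rho (p : Params) (K : Matrix (Fin d) (Fin d) ℝ) (a b : Phase d) : ℝ :=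
  f p (radius p K) (min (Del p K a b) (DK p K) + eps p * rl p K a b)

/-- One Euler-Maruyama step with step size `h` and Gaussian increment `ξ`. -/
def emStep (γ h : ℝ) (U : Pos d → ℝ) (a : Phase d) (ξ : Pos d) : Phase d :=
  (a.1 + h • a.2, a.2 - h • ∇ U a.1 - (h * γ) • a.2 + Real.sqrt (2 * γ * h) • ξ)

open scoped Classical in
/-- The increment `ξ'` of the second copy, given the current states `a`, `b` of the two copies,
the increment `ξ` of the first copy and the uniform variable `u`: the synchronous coupling if the
states are far apart, and the contractive coupling otherwise. For `q = 0` we have `e = 0`, and both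
cases of the contractive coupling give `ξ`. -/
def coupledNoise (p : Params) (K : Matrix (Fin d) (Fin d) ℝ) (h : ℝ) (a b : Phase d)
    (ξ : Pos d) (u : ℝ) : Pos d :=
  let q : Pos d := (a.1 - b.1) + p.γ⁻¹ • (a.2 - b.2)
  let e : Pos d := ‖q‖⁻¹ • q
  let β : ℝ := 1 / Real.sqrt (2 * p.γ⁻¹ * h)
  if DK p K + eps p * rl p K a b ≤ rs p a b then ξ
  else if u ≤ gaussianPDFReal 0 1 (inner ℝ e ξ + β * ‖q‖) / gaussianPDFReal 0 1 (inner ℝ e ξ)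
    then ξ + β • q
    else ξ - (2 * inner ℝ e ξ) • e

/-- The coupled Euler-Maruyama chains `((X_k, V_k), (X'_k, V'_k))` started at `(a, b)` and driven
by the Gaussian increments `ξ 1, ξ 2, …` and the uniform variables `u 1, u 2, …`. -/
def chain (p : Params) (K : Matrix (Fin d) (Fin d) ℝ) (U : Pos d → ℝ) (h : ℝ) (a b : Phase d)
    (ξ : ℕ → Pos d) (u : ℕ → ℝ) : ℕ → Phase d × Phase d
  | 0 => (a, b)
  | k + 1 =>
    let s := chain p K U h a b ξ u k
    (emStep p.γ h U s.1 (ξ (k + 1)),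
      emStep p.γ h U s.2 (coupledNoise p K h s.1 s.2 (ξ (k + 1)) (u (k + 1))))

/-- The increment `ξ'_{k+1}` that drives the second copy in its step from `k` to `k + 1`. -/
def secondNoise (p : Params) (K : Matrix (Fin d) (Fin d) ℝ) (U : Pos d → ℝ) (h : ℝ)
    (a b : Phase d) (ξ : ℕ → Pos d) (u : ℕ → ℝ) (k : ℕ) : Pos d :=
  coupledNoise p K h (chain p K U h a b ξ u k).1 (chain p K U h a b ξ u k).2
    (ξ (k + 1)) (u (k + 1))

/-- The inputs of the coupling: `ξ k` standard normal on `ℝ^d` and `u k` uniform on `[0, 1]`, all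
of them independent. -/
structure IsDrivingNoise {Ω : Type*} [MeasurableSpace Ω] (P : Measure Ω)
    (ξ : ℕ → Ω → Pos d) (u : ℕ → Ω → ℝ) : Prop where
  measurable_ξ : ∀ k, Measurable (ξ k)
  measurable_u : ∀ k, Measurable (u k)
  law_ξ : ∀ k, P.map (ξ k) = stdGaussian (Pos d)
  law_u : ∀ k, P.map (u k) = volume.restrict (Set.Icc (0 : ℝ) 1)
  indep_pair : ∀ k, IndepFun (ξ k) (u k) P
  indep : iIndepFun (fun k ω => (ξ k ω, u k ω)) P

/-- `r` is a metric on `α`. -/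
structure IsMetric {α : Type*} (r : α → α → ℝ) : Prop where
  nonneg : ∀ a b, 0 ≤ r a b
  eq_zero_iff : ∀ a b, r a b = 0 ↔ a = b
  symm : ∀ a b, r a b = r b a
  triangle : ∀ a b c, r a c ≤ r a b + r b c

end coupling

end KineticLangevin

end

open KineticLangevin

noncomputable section

namespace KineticLangevin

section

/-! ### Calculus of the concave function `f` -/

/-! Write `z`, `w` for the differences of positions and velocities, `q = z + γ⁻¹ w`, `A = |z|`, `B =
|q|`, `σ = √(2γ⁻¹h)` and `η = hγα`. By `rho_eq`, `ρ = f(min(r_s, D_𝒦 + ε r_l))`. As `f` is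
increasing, the distance after a step may be bounded through either entry of the minimum. It
suffices to treat that entry which attains the minimum before the step, and this is exactly how the
coupling chooses its noise.

Far apart, `ρ = f(D_𝒦 + ε r_l)` and the noises cancel. The only obstruction to contraction of `r_l`
is the non-convexity of `G`, which costs at most `L_G R²`. If `Δ ≥ D_𝒦` and the states differ, then
homogeneity of `Δ` forces the form defining `𝒦` to be at least `ℛ` (`calR_le_setForm`). With the
choice of `ℛ` the cost is then absorbed by half of the contraction, and `r_l` shrinks pathwise by `1
- τγh/2` (`rl_emStep_le`). Since `f' ≥ f'(R₁)`, `f(r) ≤ r` and `ℰ r_s ≤ r_l`, this contracts `ρ`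
(`rho_pairStep_far`).

Close together, `ρ = f(r)` with `r = αA + B ≤ R₁`, and the next `r_s` is at most `α(1 - hγ/2)A + ηB
+ Y` with `Y = |q + σ(ξ - ξ')|` (`rs_emStep_le`). The variable `Y` has mean `B`, vanishes with high
probability if `B` is small, and is often well below `B` if not (`reflectedVar_residual`). Only
these facts enter `StepData.contraction`. If `A ≥ 4B`, the drift contracts and a tangent line
suffices. Otherwise the drift costs `ηB`, and strict concavity of `f` has to gain `2ηB` times the
slope. For `B ≥ σ/3` the gain comes from downward moves of `Y`, where the Gaussian factor `φ` bends
`f`. For `B ≤ σ/3`, `Y` is either `0` or, rarely, far to the right, where the slope of `f` has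
dropped because of `φ` or, near `R₁`, because of `ψ`. If `r` is too close to `R₁` for such a drop,
the bending of `f` to the left of `r` takes over. The terms of `c` with `ĉ` are not needed for the
contraction.

For fixed states the second increment is again standard normal (`map_coupledNoise`): this is a
one-dimensional statement along `q`, as a Gaussian vector has independent orthogonal components. As
its law does not depend on the states, it is independent of the past
(`indepFun_and_map_of_forall_map_eq`), and the one-step estimate iterates by Tonelli.

The constants are free of the dimension because `r_s` depends on `A`, `B` only, and for given `A`,
`B` the extreme values of `r_l` occur with `z`, `q` on a line through an eigenvector for `κ` or a
unit vector with `e · Ke = L_K`. So both suprema reduce to two real variables (`DK_eq`,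
`radius_eq`). -/

lemma setIntegral_bounds_of_antitoneOn {g : ℝ → ℝ} (hg : Continuous g)
    (hanti : AntitoneOn g (Set.Ici 0)) {x y : ℝ} (hx : 0 ≤ x) (hxy : x ≤ y) :
    g y * (y - x) ≤ ∫ s in x..y, g s ∧ ∫ s in x..y, g s ≤ g x * (y - x) := by
  have hi : IntervalIntegrable g volume x y := hg.intervalIntegrable _ _
  constructor
  · have h := intervalIntegral.integral_mono_on hxy (intervalIntegrable_const (c := g y)) hi
      (fun s hs => hanti (hx.trans hs.1) (hx.trans hxy) hs.2)
    simpa [mul_comm] using h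
  · have h := intervalIntegral.integral_mono_on hxy hi (intervalIntegrable_const (c := g x))
      (fun s hs => hanti hx (hx.trans hs.1) hs.1)
    simpa [mul_comm] using h

variable {p : Params} {R₁ : ℝ}

lemma continuous_phi (p : Params) (R₁ : ℝ) : Continuous (phi p R₁) := by
  unfold phi; fun_prop

lemma phi_pos (p : Params) (R₁ s : ℝ) : 0 < phi p R₁ s := Real.exp_pos _

lemma phi_antitoneOn (hα : 0 ≤ alpha p) (hR : 0 ≤ R₁) : AntitoneOn (phi p R₁) (Set.Ici 0) := by
  intro s hs t ht hst
  unfold phi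
  apply Real.exp_le_exp.2
  have h1 : 0 ≤ min s R₁ := le_min hs hR
  have h2 : min s R₁ ≤ min t R₁ := min_le_min_right _ hst
  have h3 : 0 ≤ 128 * alpha p * p.γ ^ 2 := by positivity
  have h4 : (min s R₁) ^ 2 ≤ (min t R₁) ^ 2 := by gcongr
  have := mul_le_mul_of_nonneg_left h4 h3
  linarith

lemma phi_zero (p : Params) (hR : 0 ≤ R₁) : phi p R₁ 0 = 1 := by
  simp [phi, hR]

lemma continuous_Phi (p : Params) (R₁ : ℝ) : Continuous (Phi p R₁) :=
  intervalIntegral.continuous_primitive (fun _ _ => (continuous_phi p R₁).intervalIntegrable _ _) 0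

lemma Phi_sub (p : Params) (R₁ s t : ℝ) : Phi p R₁ t - Phi p R₁ s = ∫ x in s..t, phi p R₁ x :=
  intervalIntegral.integral_interval_sub_left ((continuous_phi p R₁).intervalIntegrable _ _)
    ((continuous_phi p R₁).intervalIntegrable _ _)

lemma Phi_strictMono (p : Params) (R₁ : ℝ) : StrictMono (Phi p R₁) := by
  intro s t hst
  have h := intervalIntegral.intervalIntegral_pos_of_pos
    ((continuous_phi p R₁).intervalIntegrable s t) (phi_pos p R₁) hst
  rw [← Phi_sub] at h
  linarith

lemma Phi_zero (p : Params) (R₁ : ℝ) : Phi p R₁ 0 = 0 := by simp [Phi]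

/-- The integrand `Φ / φ`. -/
def quot (p : Params) (R₁ s : ℝ) : ℝ := Phi p R₁ s * (phi p R₁ s)⁻¹

lemma continuous_quot (p : Params) (R₁ : ℝ) : Continuous (quot p R₁) :=
  (continuous_Phi p R₁).mul ((continuous_phi p R₁).inv₀ fun s => (phi_pos p R₁ s).ne')

lemma quot_zero (p : Params) (R₁ : ℝ) : quot p R₁ 0 = 0 := by simp [quot, Phi_zero]

lemma quot_pos {s : ℝ} (hs : 0 < s) : 0 < quot p R₁ s := by
  have h := Phi_strictMono p R₁ hs
  rw [Phi_zero] at h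
  exact mul_pos h (inv_pos.2 (phi_pos p R₁ s))

lemma quot_monotoneOn (hα : 0 ≤ alpha p) (hR : 0 ≤ R₁) : MonotoneOn (quot p R₁) (Set.Ici 0) := by
  intro s hs t ht hst
  have h1 : 0 ≤ Phi p R₁ s := by
    have := (Phi_strictMono p R₁).monotone hs
    rwa [Phi_zero] at this
  have h2 := (Phi_strictMono p R₁).monotone hst
  have h3 : (phi p R₁ s)⁻¹ ≤ (phi p R₁ t)⁻¹ :=
    inv_anti₀ (phi_pos p R₁ t) (phi_antitoneOn hα hR hs ht hst)
  exact mul_le_mul h2 h3 (inv_pos.2 (phi_pos p R₁ s)).le (h1.trans h2)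

/-- The integral `∫₀^{R₁} Φ / φ`. -/
def quotInt (p : Params) (R₁ : ℝ) : ℝ := ∫ s in (0 : ℝ)..R₁, quot p R₁ s

lemma quot_intervalIntegrable (p : Params) (R₁ s t : ℝ) :
    IntervalIntegrable (quot p R₁) volume s t := (continuous_quot p R₁).intervalIntegrable _ _

lemma quotInt_pos (hR : 0 < R₁) : 0 < quotInt p R₁ :=
  intervalIntegral.intervalIntegral_pos_of_pos_on (quot_intervalIntegrable p R₁ 0 R₁)
    (fun _ hs => quot_pos hs.1) hR

lemma chat_eq (p : Params) (R₁ : ℝ) : chat p R₁ = 1 / (p.γ * quotInt p R₁) := rfl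

lemma chat_pos (hγ : 0 < p.γ) (hR : 0 < R₁) : 0 < chat p R₁ := by
  rw [chat_eq]
  have := quotInt_pos (p := p) hR
  positivity

/-- The constant `ĉ` is normalised so that `ψ` falls from `1` at the origin to `1/2` at `R₁`. This
form exhibits the part still to be lost before `R₁`. -/
lemma psi_of_pos (hγ : 0 < p.γ) (hR : 0 < R₁) {s : ℝ} (hs : s ≤ R₁) :
    psi p R₁ s = 1 / 2 + (∫ x in s..R₁, quot p R₁ x) / (2 * quotInt p R₁) := by
  have hI := quotInt_pos (p := p) hR
  have h1 : (∫ x in (0 : ℝ)..s, quot p R₁ x) + ∫ x in s..R₁, quot p R₁ x = quotInt p R₁ :=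
    intervalIntegral.integral_add_adjacent_intervals (quot_intervalIntegrable _ _ _ _)
      (quot_intervalIntegrable _ _ _ _)
  have h2 : psi p R₁ s = 1 - chat p R₁ / 2 * p.γ * ∫ x in (0 : ℝ)..s, quot p R₁ x := by
    simp only [psi, min_eq_left hs, quot]
  rw [h2, chat_eq]
  field_simp
  linarith

lemma psi_min (p : Params) (R₁ s : ℝ) : psi p R₁ s = psi p R₁ (min s R₁) := by
  simp [psi]

lemma psi_zero_radius (p : Params) (s : ℝ) : psi p 0 s = 1 := by
  simp [psi, chat]

lemma continuous_psi (p : Params) (R₁ : ℝ) : Continuous (psi p R₁) := by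
  have h : Continuous fun s => ∫ x in (0 : ℝ)..s, quot p R₁ x :=
    intervalIntegral.continuous_primitive (fun _ _ => quot_intervalIntegrable _ _ _ _) 0
  exact continuous_const.sub (continuous_const.mul (h.comp (continuous_id.min continuous_const)))

lemma quot_integral_nonneg {s t : ℝ} (hs : 0 ≤ s) (hst : s ≤ t) :
    0 ≤ ∫ x in s..t, quot p R₁ x := by
  apply intervalIntegral.integral_nonneg hst
  intro x hx
  rcases (hs.trans hx.1).eq_or_lt with h | h
  · rw [← h, quot_zero]
  · exact (quot_pos h).le

lemma half_le_psi (hγ : 0 < p.γ) (hR : 0 ≤ R₁) {s : ℝ} (hs : 0 ≤ s) : 1 / 2 ≤ psi p R₁ s := by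
  rcases hR.eq_or_lt with rfl | hR
  · rw [psi_zero_radius]; norm_num
  · rw [psi_min, psi_of_pos hγ hR (min_le_right _ _)]
    have := quotInt_pos (p := p) hR
    have := quot_integral_nonneg (p := p) (R₁ := R₁) (le_min hs hR.le) (min_le_right s R₁)
    have : 0 ≤ (∫ x in min s R₁..R₁, quot p R₁ x) / (2 * quotInt p R₁) := by positivity
    linarith

lemma psi_antitoneOn (hγ : 0 < p.γ) (hR : 0 ≤ R₁) : AntitoneOn (psi p R₁) (Set.Ici 0) := by
  rcases hR.eq_or_lt with rfl | hR
  · intro s _ t _ _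
    simp [psi_zero_radius]
  intro s hs t ht hst
  rw [psi_min p R₁ s, psi_min p R₁ t, psi_of_pos hγ hR (min_le_right _ _),
    psi_of_pos hγ hR (min_le_right _ _)]
  have h1 : (∫ x in (min s R₁)..(min t R₁), quot p R₁ x) + ∫ x in (min t R₁)..R₁, quot p R₁ x
      = ∫ x in (min s R₁)..R₁, quot p R₁ x :=
    intervalIntegral.integral_add_adjacent_intervals (quot_intervalIntegrable _ _ _ _)
      (quot_intervalIntegrable _ _ _ _)
  have h2 := quot_integral_nonneg (p := p) (R₁ := R₁) (le_min hs hR.le) (min_le_min_right R₁ hst)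
  have := quotInt_pos (p := p) hR
  gcongr
  linarith

/-- As `Φ/φ` is increasing, its average over `[s, R₁]` is at least its average over `[0, R₁]`. So
`ψ` lies above the chord joining its values `1` at the origin and `1/2` at `R₁`. -/
lemma psi_lower (hγ : 0 < p.γ) (hα : 0 ≤ alpha p) (hR : 0 < R₁) {s : ℝ} (hs : 0 ≤ s)
    (hsR : s ≤ R₁) : 1 / 2 + (R₁ - s) / (2 * R₁) ≤ psi p R₁ s := by
  rw [psi_of_pos hγ hR hsR]
  have hI := quotInt_pos (p := p) hR
  have hmono := quot_monotoneOn hα hR.le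
  have h1 : quot p R₁ s * (R₁ - s) ≤ ∫ x in s..R₁, quot p R₁ x := by
    have h := intervalIntegral.integral_mono_on hsR (intervalIntegrable_const (c := quot p R₁ s))
      (quot_intervalIntegrable p R₁ s R₁) (fun x hx => hmono hs (hs.trans hx.1) hx.1)
    simpa [mul_comm] using h
  have h2 : ∫ x in (0 : ℝ)..s, quot p R₁ x ≤ quot p R₁ s * s := by
    have h := intervalIntegral.integral_mono_on hs (quot_intervalIntegrable p R₁ 0 s)
      (intervalIntegrable_const (c := quot p R₁ s)) (fun x hx => hmono hx.1 hs hx.2)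
    simpa [mul_comm] using h
  have h3 : (∫ x in (0 : ℝ)..s, quot p R₁ x) + ∫ x in s..R₁, quot p R₁ x = quotInt p R₁ :=
    intervalIntegral.integral_add_adjacent_intervals (quot_intervalIntegrable _ _ _ _)
      (quot_intervalIntegrable _ _ _ _)
  have h4 : (R₁ - s) * quotInt p R₁ ≤ R₁ * ∫ x in s..R₁, quot p R₁ x := by
    rw [← h3]
    nlinarith [mul_le_mul_of_nonneg_left h2 (sub_nonneg.2 hsR), mul_le_mul_of_nonneg_left h1 hs]
  have : (R₁ - s) / (2 * R₁) ≤ (∫ x in s..R₁, quot p R₁ x) / (2 * quotInt p R₁) := by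
    rw [div_le_div_iff₀ (by positivity) (by positivity)]
    nlinarith
  linarith

/-- The derivative `φ ψ` of `f`. -/
def slope (p : Params) (R₁ s : ℝ) : ℝ := phi p R₁ s * psi p R₁ s

lemma continuous_slope (p : Params) (R₁ : ℝ) : Continuous (slope p R₁) :=
  (continuous_phi p R₁).mul (continuous_psi p R₁)

lemma slope_pos (hγ : 0 < p.γ) (hR : 0 ≤ R₁) {s : ℝ} (hs : 0 ≤ s) : 0 < slope p R₁ s :=
  mul_pos (phi_pos p R₁ s) (lt_of_lt_of_le (by norm_num) (half_le_psi hγ hR hs))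

lemma slope_antitoneOn (hγ : 0 < p.γ) (hα : 0 ≤ alpha p) (hR : 0 ≤ R₁) :
    AntitoneOn (slope p R₁) (Set.Ici 0) := by
  intro s hs t ht hst
  exact mul_le_mul (phi_antitoneOn hα hR hs ht hst) (psi_antitoneOn hγ hR hs ht hst)
    ((by norm_num : (0 : ℝ) ≤ 1 / 2).trans (half_le_psi hγ hR ht)) (phi_pos p R₁ s).le

lemma slope_min (p : Params) (R₁ s : ℝ) : slope p R₁ s = slope p R₁ (min s R₁) := by
  unfold slope
  rw [psi_min]
  simp [phi]

lemma slope_zero (p : Params) (hR : 0 ≤ R₁) : slope p R₁ 0 = 1 := by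
  simp [slope, phi_zero p hR, psi, hR]

lemma slope_le_one (hγ : 0 < p.γ) (hα : 0 ≤ alpha p) (hR : 0 ≤ R₁) {s : ℝ} (hs : 0 ≤ s) :
    slope p R₁ s ≤ 1 := by
  rw [← slope_zero p hR]
  exact slope_antitoneOn hγ hα hR Set.self_mem_Ici hs hs

/-- Beyond `R₁` the slope is constant, so `f'(R₁)` is its minimum on the whole half-line. -/
lemma slope_radius_le (hγ : 0 < p.γ) (hα : 0 ≤ alpha p) (hR : 0 ≤ R₁) {s : ℝ} (hs : 0 ≤ s) :
    slope p R₁ R₁ ≤ slope p R₁ s := by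
  rw [slope_min p R₁ s]
  exact slope_antitoneOn hγ hα hR (le_min hs hR) hR (min_le_right _ _)

lemma fPrime_eq_slope (p : Params) (R₁ : ℝ) : fPrime p R₁ = slope p R₁ R₁ :=
  (intervalIntegral.integral_hasDerivAt_right ((continuous_slope p R₁).intervalIntegrable _ _)
    (continuous_slope p R₁).aestronglyMeasurable.stronglyMeasurableAtFilter
    (continuous_slope p R₁).continuousAt).deriv

lemma slope_radius (hγ : 0 < p.γ) (hR : 0 < R₁) : slope p R₁ R₁ = phi p R₁ R₁ / 2 := by
  rw [slope, psi_of_pos hγ hR le_rfl]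
  simp
  ring

/-- This is the decay of the slope due to `ψ`. It does not degenerate as `R₁ → 0` and is used near
`R₁`, where the Gaussian factor has no room to act. -/
lemma slope_lower (hγ : 0 < p.γ) (hα : 0 ≤ alpha p) (hR : 0 < R₁) {s : ℝ} (hs : 0 ≤ s)
    (hsR : s ≤ R₁) : slope p R₁ R₁ * (1 + (R₁ - s) / R₁) ≤ slope p R₁ s := by
  rw [slope_radius hγ hR]
  have h1 := phi_antitoneOn hα hR.le hs hR.le hsR
  have h2 := psi_lower hγ hα hR hs hsR
  have h3 : 0 ≤ (R₁ - s) / R₁ := div_nonneg (sub_nonneg.2 hsR) hR.le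
  have h4 : (R₁ - s) / (2 * R₁) = (R₁ - s) / R₁ / 2 := by field_simp
  calc phi p R₁ R₁ / 2 * (1 + (R₁ - s) / R₁) = phi p R₁ R₁ * (1 / 2 + (R₁ - s) / (2 * R₁)) := by
        rw [h4]; ring
    _ ≤ _ := mul_le_mul h1 h2 (by rw [h4]; positivity) (phi_pos _ _ _).le

/-- Decay of the slope due to the Gaussian factor. -/
lemma slope_mul_exp_le (hγ : 0 < p.γ) (hR : 0 ≤ R₁) {s t : ℝ} (hs : 0 ≤ s) (hst : s ≤ t)
    (ht : t ≤ R₁) :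
    slope p R₁ t * Real.exp (64 * alpha p * p.γ ^ 2 * (t ^ 2 - s ^ 2)) ≤ slope p R₁ s := by
  have h1 : phi p R₁ t * Real.exp (64 * alpha p * p.γ ^ 2 * (t ^ 2 - s ^ 2)) = phi p R₁ s := by
    rw [phi, phi, min_eq_left ht, min_eq_left (hst.trans ht), ← Real.exp_add]
    congr 1; ring
  have h2 := psi_antitoneOn hγ hR hs (hs.trans hst) hst
  calc _ = phi p R₁ s * psi p R₁ t := by rw [slope, ← h1]; ring
    _ ≤ _ := mul_le_mul_of_nonneg_left h2 (phi_pos _ _ _).le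

lemma continuous_f (p : Params) (R₁ : ℝ) : Continuous (f p R₁) :=
  intervalIntegral.continuous_primitive (fun _ _ => (continuous_slope p R₁).intervalIntegrable _ _) 0

lemma f_zero (p : Params) (R₁ : ℝ) : f p R₁ 0 = 0 := by simp [f]

lemma f_sub (p : Params) (R₁ x y : ℝ) : f p R₁ y - f p R₁ x = ∫ s in x..y, slope p R₁ s :=
  intervalIntegral.integral_interval_sub_left ((continuous_slope p R₁).intervalIntegrable _ _)
    ((continuous_slope p R₁).intervalIntegrable _ _)

/-- Regularity conditions on the parameters under which `f` is increasing and concave. -/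
structure Admissible (p : Params) (R₁ : ℝ) : Prop where
  γ_pos : 0 < p.γ
  α_pos : 0 < alpha p
  R_nonneg : 0 ≤ R₁

namespace Admissible

variable (H : Admissible p R₁)
include H

lemma anti : AntitoneOn (slope p R₁) (Set.Ici 0) := slope_antitoneOn H.γ_pos H.α_pos.le H.R_nonneg

lemma slopePos {s : ℝ} (hs : 0 ≤ s) : 0 < slope p R₁ s := slope_pos H.γ_pos H.R_nonneg hs

lemma slopeRadius_le {s : ℝ} (hs : 0 ≤ s) : slope p R₁ R₁ ≤ slope p R₁ s :=
  slope_radius_le H.γ_pos H.α_pos.le H.R_nonneg hs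

lemma slope_le_one {s : ℝ} (hs : 0 ≤ s) : slope p R₁ s ≤ 1 :=
  KineticLangevin.slope_le_one H.γ_pos H.α_pos.le H.R_nonneg hs

lemma f_bounds {x y : ℝ} (hx : 0 ≤ x) (hxy : x ≤ y) :
    slope p R₁ y * (y - x) ≤ f p R₁ y - f p R₁ x ∧
      f p R₁ y - f p R₁ x ≤ slope p R₁ x * (y - x) := by
  rw [f_sub]
  exact setIntegral_bounds_of_antitoneOn (continuous_slope p R₁) H.anti hx hxy

lemma f_mono {x y : ℝ} (hx : 0 ≤ x) (hxy : x ≤ y) : f p R₁ x ≤ f p R₁ y := by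
  have h := (H.f_bounds hx hxy).1
  have := mul_nonneg (H.slopePos (hx.trans hxy)).le (sub_nonneg.2 hxy)
  linarith

lemma f_sub_ge {x y : ℝ} (hx : 0 ≤ x) (hxy : x ≤ y) :
    slope p R₁ R₁ * (y - x) ≤ f p R₁ y - f p R₁ x :=
  (mul_le_mul_of_nonneg_right (H.slopeRadius_le (hx.trans hxy)) (sub_nonneg.2 hxy)).trans
    (H.f_bounds hx hxy).1

lemma f_le {x : ℝ} (hx : 0 ≤ x) : f p R₁ x ≤ x := by
  have h := (H.f_bounds le_rfl hx).2
  rw [f_zero, slope_zero p H.R_nonneg] at h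
  linarith

lemma le_f {x : ℝ} (hx : 0 ≤ x) : slope p R₁ R₁ * x ≤ f p R₁ x := by
  have h := H.f_sub_ge le_rfl hx
  rw [f_zero] at h
  linarith

lemma f_nonneg {x : ℝ} (hx : 0 ≤ x) : 0 ≤ f p R₁ x :=
  (mul_nonneg (H.slopePos H.R_nonneg).le hx).trans (H.le_f hx)

lemma f_tangent {x y : ℝ} (hx : 0 ≤ x) (hy : 0 ≤ y) :
    f p R₁ y ≤ f p R₁ x + slope p R₁ x * (y - x) := by
  rcases le_total x y with h | h
  · have := (H.f_bounds hx h).2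
    linarith
  · have := (H.f_bounds hy h).1
    nlinarith

/-- The slope is decreasing, so `f` grows less over `[x, x + y]` than over `[0, y]`. This gives the
triangle inequality for `ρ`. -/
lemma f_subadditive {x y : ℝ} (hx : 0 ≤ x) (hy : 0 ≤ y) : f p R₁ (x + y) ≤ f p R₁ x + f p R₁ y := by
  have h1 : f p R₁ (x + y) - f p R₁ x = ∫ s in (0 : ℝ)..y, slope p R₁ (x + s) := by
    rw [f_sub, intervalIntegral.integral_comp_add_left (slope p R₁) x]; simp
  have h2 : ∫ s in (0 : ℝ)..y, slope p R₁ (x + s) ≤ ∫ s in (0 : ℝ)..y, slope p R₁ s := by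
    apply intervalIntegral.integral_mono_on hy
    · exact ((continuous_slope p R₁).comp (continuous_const.add continuous_id)).intervalIntegrable _ _
    · exact (continuous_slope p R₁).intervalIntegrable _ _
    · intro s hs
      exact H.anti hs.1 (add_nonneg hx hs.1) (by linarith)
  have h3 : f p R₁ y = ∫ s in (0 : ℝ)..y, slope p R₁ s := rfl
  linarith

/-- To the right of `x + ℓ` the graph of `f` lies below a line of smaller slope. -/
lemma f_tangent_right {x ℓ y : ℝ} (hx : 0 ≤ x) (hℓ : 0 ≤ ℓ) (hy : 0 ≤ y) :
    f p R₁ y ≤ f p R₁ x + slope p R₁ x * (y - x)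
      - (slope p R₁ x - slope p R₁ (x + ℓ)) * max (y - x - ℓ) 0 := by
  rcases le_total (y - x - ℓ) 0 with h | h
  · rw [max_eq_right h]
    simpa using H.f_tangent hx hy
  · rw [max_eq_left h]
    have h1 := H.f_tangent hx (add_nonneg hx hℓ)
    have h2 := H.f_tangent (add_nonneg hx hℓ) hy
    nlinarith

/-- To the left of `x - ℓ` the graph of `f` lies strictly below its tangent line at `x`. -/
lemma f_tangent_left {x ℓ y : ℝ} (hxR : x ≤ R₁) (hℓ : 0 ≤ ℓ) (hℓx : ℓ ≤ x) (hy : 0 ≤ y)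
    (hyx : y ≤ x - ℓ) :
    f p R₁ y ≤ f p R₁ x + slope p R₁ x * (y - x)
      - slope p R₁ x * (128 * alpha p * p.γ ^ 2 / 3 * (x * ℓ ^ 2)) := by
  have hx : 0 ≤ x := hℓ.trans hℓx
  have hc : 0 < 64 * alpha p * p.γ ^ 2 := by have := H.γ_pos; have := H.α_pos; positivity
  set c := 64 * alpha p * p.γ ^ 2 with hcdef
  -- The Gaussian factor makes the slope at `s < x` exceed that at `x` by `exp(c(x² - s²)) ≥ 1 +
  -- c(x² - s²)`; integration turns this into the gain below the tangent line.
  have h1 : ∫ s in (x - ℓ)..x, slope p R₁ x * (1 + c * (x ^ 2 - s ^ 2))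
      ≤ ∫ s in (x - ℓ)..x, slope p R₁ s := by
    apply intervalIntegral.integral_mono_on (by linarith)
    · exact Continuous.intervalIntegrable (by fun_prop) _ _
    · exact (continuous_slope p R₁).intervalIntegrable _ _
    · intro s hs
      have hs0 : 0 ≤ s := by linarith [hs.1]
      have h2 := slope_mul_exp_le H.γ_pos H.R_nonneg hs0 hs.2 hxR
      refine le_trans (mul_le_mul_of_nonneg_left ?_ (H.slopePos hx).le) h2
      have := Real.add_one_le_exp (64 * alpha p * p.γ ^ 2 * (x ^ 2 - s ^ 2))
      linarith
  have h2 : ∫ s in (x - ℓ)..x, slope p R₁ x * (1 + c * (x ^ 2 - s ^ 2))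
      = slope p R₁ x * (ℓ + c * (x * ℓ ^ 2 - ℓ ^ 3 / 3)) := by
    rw [intervalIntegral.integral_const_mul, intervalIntegral.integral_add
      (by simp) (Continuous.intervalIntegrable (by fun_prop) _ _),
      intervalIntegral.integral_const_mul, intervalIntegral.integral_sub
      (by simp) (Continuous.intervalIntegrable (by fun_prop) _ _)]
    simp only [intervalIntegral.integral_const, integral_pow, smul_eq_mul]
    push_cast
    ring
  rw [← f_sub, h2] at h1
  have h3 := (H.f_bounds hy hyx).1
  have h4 := H.anti (show (0:ℝ) ≤ x - ℓ by linarith) hx (by linarith)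
  have h5 : slope p R₁ x * (x - ℓ - y) ≤ f p R₁ (x - ℓ) - f p R₁ y :=
    (mul_le_mul_of_nonneg_right h4 (by linarith)).trans h3
  -- From `ℓ ≤ x` the cubic term takes away at most a third of `c x ℓ²`, and `2c/3` is the constant
  -- claimed.
  have h6 : 128 * alpha p * p.γ ^ 2 / 3 * (x * ℓ ^ 2) ≤ c * (x * ℓ ^ 2 - ℓ ^ 3 / 3) := by
    have : ℓ ^ 3 ≤ x * ℓ ^ 2 := by nlinarith [sq_nonneg ℓ]
    have := mul_le_mul_of_nonneg_left this hc.le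
    rw [hcdef] at this ⊢
    linarith
  have h7 := mul_le_mul_of_nonneg_left h6 (H.slopePos hx).le
  nlinarith

end Admissible

end

section

/-! ### One-step contraction for a concave function of a reflected increment -/

/-- Scalar data of one contractive step: the noise scale `σ`, the step `h`, the sizes `A` of the
position difference and `B` of `q`, and the candidate rate `c`. -/
structure StepData (p : Params) (R₁ σ h A B c : ℝ) : Prop where
  adm : Admissible p R₁
  σ_pos : 0 < σ
  h_pos : 0 < h
  σ_sq : σ ^ 2 * p.γ = 2 * h
  drift_small : 9600 * (alpha p + 1) * (h * p.γ * alpha p) ≤ 1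
  radius_small : alpha p * p.γ ^ 2 * R₁ * σ ≤ 1
  damping_small : p.γ * h ≤ 1 / 8
  A_nonneg : 0 ≤ A
  B_nonneg : 0 ≤ B
  le_radius : alpha p * A + B ≤ R₁
  c_nonneg : 0 ≤ c
  c_le₁ : c ≤ slope p R₁ R₁ * (p.γ / 8)
  c_le₂ : c ≤ slope p R₁ R₁ * (p.γ * alpha p / 2)

/-- A random variable with the properties of `|q + σ (ξ - ξ')|` under the reflection-maximal
coupling. -/
structure ReflectedVar {Ω : Type*} [MeasurableSpace Ω] (P : Measure Ω) (σ B : ℝ) (Y : Ω → ℝ) :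
    Prop where
  meas : Measurable Y
  nonneg : ∀ ω, 0 ≤ Y ω
  integrable : Integrable Y P
  mean : ∫ ω, Y ω ∂P = B
  fail : P.real {ω | Y ω ≠ 0} ≤ 2 / 5 * B / σ
  low : ∀ x, 0 ≤ x → x ≤ B → 1 / 2 - x / (5 * σ) ≤ P.real {ω | Y ω ≤ B - x}

section

variable {p : Params} {R₁ σ h A B c : ℝ} {Ω : Type*} [MeasurableSpace Ω] {P : Measure Ω}
  [IsProbabilityMeasure P] {Y : Ω → ℝ}

omit [IsProbabilityMeasure P] in
lemma Admissible.integrable_f_comp (H : Admissible p R₁) {X : Ω → ℝ} (hm : Measurable X)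
    (h0 : ∀ ω, 0 ≤ X ω) (hX : Integrable X P) : Integrable (fun ω => f p R₁ (X ω)) P := by
  refine hX.mono' ((continuous_f p R₁).measurable.comp hm).aestronglyMeasurable ?_
  filter_upwards with ω
  rw [Real.norm_of_nonneg (H.f_nonneg (h0 ω))]
  exact H.f_le (h0 ω)

/-- All close-range estimates majorise `f` by an affine function of `Y - B` with a correction on an
event. Since `Y` has mean `B`, only the constant and the probability of the event survive. -/
lemma ReflectedVar.integral_le (hY : ReflectedVar P σ B Y) {g : Ω → ℝ} (hg : Integrable g P)
    {S : Set Ω} (hS : MeasurableSet S) {a s k : ℝ}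
    (hle : ∀ ω, g ω ≤ a + s * (Y ω - B) - k * S.indicator (fun _ => 1) ω) :
    ∫ ω, g ω ∂P ≤ a - k * P.real S := by
  have hi : Integrable (S.indicator (fun _ => (1 : ℝ))) P := (integrable_const 1).indicator hS
  have h0 : Integrable (fun ω => Y ω - B) P := hY.integrable.sub (integrable_const B)
  have h1 : Integrable (fun ω => a + s * (Y ω - B)) P :=
    (integrable_const a).add (h0.const_mul s)
  have h2 := integral_mono hg (h1.sub (hi.const_mul k)) hle
  refine h2.trans_eq ?_
  simp only [Pi.sub_apply]
  rw [integral_sub h1 (hi.const_mul k), integral_add (integrable_const a)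
    (h0.const_mul s), integral_const_mul, integral_const_mul,
    integral_sub hY.integrable (integrable_const B), hY.mean, integral_indicator_const _ hS]
  simp

namespace StepData

variable (D : StepData p R₁ σ h A B c)
include D

lemma drift_pos : 0 < h * p.γ * alpha p := by
  have := D.h_pos; have := D.adm.γ_pos; have := D.adm.α_pos; positivity

lemma drift_le : h * p.γ * alpha p ≤ 1 / 9600 := by
  have h1 := D.drift_pos
  have h2 := D.drift_small
  nlinarith [mul_pos D.adm.α_pos h1]

/-- `128 α γ² σ² = 256 h γ α`. -/
lemma strength : 128 * alpha p * p.γ ^ 2 * σ ^ 2 = 256 * (h * p.γ * alpha p) := by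
  have := D.σ_sq
  linear_combination (128 * alpha p * p.γ) * this

lemma drift_radius : h * p.γ * alpha p * R₁ ≤ σ / 2 := by
  have h1 := D.radius_small
  have h2 := D.σ_sq
  have h3 := mul_le_mul_of_nonneg_right h1 D.σ_pos.le
  have : alpha p * p.γ ^ 2 * R₁ * σ * σ = 2 * (h * p.γ * alpha p * R₁) := by
    linear_combination (alpha p * p.γ * R₁) * h2
  linarith

/-- The term `αA` uses `c ≤ f'(R₁)γ/8` together with `A ≤ 4B`, the term `B` uses `c ≤ f'(R₁)γα/2`;
each contributes half of the right-hand side. -/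
lemma rate_le (hAB : A ≤ 4 * B) :
    c * h * (alpha p * A + B) ≤ slope p R₁ R₁ * (h * p.γ * alpha p * B) := by
  have h1 := mul_le_mul_of_nonneg_right D.c_le₁ (mul_nonneg D.adm.α_pos.le D.A_nonneg)
  have h2 := mul_le_mul_of_nonneg_right D.c_le₂ D.B_nonneg
  have h3 : 0 < slope p R₁ R₁ * (p.γ * alpha p) :=
    mul_pos (D.adm.slopePos D.adm.R_nonneg) (mul_pos D.adm.γ_pos D.adm.α_pos)
  have h4 := mul_le_mul_of_nonneg_left hAB h3.le
  have h5 : c * (alpha p * A + B) ≤ slope p R₁ R₁ * (p.γ * alpha p) * B := by nlinarith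
  nlinarith [mul_le_mul_of_nonneg_left h5 D.h_pos.le]

lemma r_nonneg : 0 ≤ alpha p * A + B :=
  add_nonneg (mul_nonneg D.adm.α_pos.le D.A_nonneg) D.B_nonneg

/-- A gain of twice the drift cost is enough: one half cancels the drift, and the other half
dominates `c h r ≥ c h f(r)`. -/
lemma finish {s E : ℝ} (hs : slope p R₁ R₁ ≤ s) (hAB : A ≤ 4 * B)
    (hE : E ≤ f p R₁ (alpha p * A + B) + s * (h * p.γ * alpha p * B)
      - 2 * (s * (h * p.γ * alpha p * B))) :
    E ≤ (1 - c * h) * f p R₁ (alpha p * A + B) := by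
  have h1 := D.rate_le hAB
  have h2 := D.adm.f_le D.r_nonneg
  have h3 := mul_le_mul_of_nonneg_left h2 (mul_nonneg D.c_nonneg D.h_pos.le)
  have h4 := mul_le_mul_of_nonneg_right hs (mul_nonneg D.drift_pos.le D.B_nonneg)
  linarith

lemma pos_arg (y : ℝ) (hy : 0 ≤ y) : 0 ≤ alpha p * A + h * p.γ * alpha p * B + y := by
  have := mul_nonneg D.adm.α_pos.le D.A_nonneg
  have := mul_nonneg D.drift_pos.le D.B_nonneg
  linarith

lemma integrable_arg (hY : ReflectedVar P σ B Y) :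
    Integrable (fun ω => f p R₁ (alpha p * A + h * p.γ * alpha p * B + Y ω)) P :=
  D.adm.integrable_f_comp (measurable_const.add hY.meas) (fun ω => D.pos_arg _ (hY.nonneg ω))
    ((integrable_const _).add hY.integrable)

/-- With probability at least `1/5` the noise moves `Y` down by a distance comparable to `min(B,
σ)`, where `f` lies strictly below its tangent at `r`. The gain is of order `αγ² r ℓ²`, hence of
order `ηB`, because `128αγ²σ² = 256η`. -/
lemma contraction_large (hY : ReflectedVar P σ B Y) (hAB : A ≤ 4 * B) (hB : σ / 3 ≤ B) :
    ∫ ω, f p R₁ (alpha p * A + h * p.γ * alpha p * B + Y ω) ∂P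
      ≤ (1 - c * h) * f p R₁ (alpha p * A + B) := by
  set η := h * p.γ * alpha p with hη
  set r := alpha p * A + B with hr
  have hη0 : 0 < η := D.drift_pos
  have hη1 : η ≤ 1 / 9600 := D.drift_le
  have hσ := D.σ_pos
  have hB0 : 0 < B := by linarith
  have hBr : B ≤ r := by
    have := mul_nonneg D.adm.α_pos.le D.A_nonneg
    linarith
  have hηB : η * B ≤ σ / 2 :=
    (mul_le_mul_of_nonneg_left (hBr.trans D.le_radius) hη0.le).trans D.drift_radius
  -- Here `ℓ` is `9/10` of `min(B, σ)`. The missing tenth of `B` leaves room for the drift: `ℓ + ηB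
  -- ≤ B` is needed to apply `low`.
  obtain ⟨ℓ, hℓB, hℓσ, hℓ⟩ : ∃ ℓ : ℝ, ℓ ≤ 9 / 10 * B ∧ ℓ ≤ 9 / 10 * σ ∧
      (ℓ = 9 / 10 * B ∧ B ≤ σ ∨ ℓ = 9 / 10 * σ ∧ σ ≤ B) := by
    rcases le_total B σ with h | h
    · exact ⟨9 / 10 * B, le_rfl, by linarith, Or.inl ⟨rfl, h⟩⟩
    · exact ⟨9 / 10 * σ, by linarith, le_rfl, Or.inr ⟨rfl, h⟩⟩
  have hℓ0 : 3 / 10 * σ ≤ ℓ := by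
    rcases hℓ with ⟨h, _⟩ | ⟨h, _⟩ <;> rw [h] <;> linarith
  have hℓp : 0 ≤ ℓ := by linarith
  have hx : ℓ + η * B ≤ B := by nlinarith
  have hlow := hY.low (ℓ + η * B) (by positivity) hx
  have hr0 : 0 ≤ r := D.r_nonneg
  set S := {ω | Y ω ≤ B - (ℓ + η * B)} with hS
  set k := 128 * alpha p * p.γ ^ 2 / 3 * (r * ℓ ^ 2) with hk
  have hs : 0 < slope p R₁ r := D.adm.slopePos hr0
  have key := hY.integral_le (D.integrable_arg hY) (S := S) (measurableSet_le hY.meas measurable_const)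
    (a := f p R₁ r + slope p R₁ r * (η * B)) (s := slope p R₁ r) (k := slope p R₁ r * k) (by
      intro ω
      by_cases hω : ω ∈ S
      · have h1 := D.adm.f_tangent_left D.le_radius (by linarith : 0 ≤ ℓ) (by linarith : ℓ ≤ r)
          (D.pos_arg _ (hY.nonneg ω)) (by
            have : Y ω ≤ B - (ℓ + η * B) := hω
            linarith)
        rw [Set.indicator_of_mem hω]
        refine h1.trans_eq ?_
        ring
      · rw [Set.indicator_of_notMem hω]
        refine (D.adm.f_tangent hr0 (D.pos_arg _ (hY.nonneg ω))).trans_eq ?_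
        ring)
  refine D.finish (D.adm.slopeRadius_le hr0) hAB (key.trans ?_)
  have hkB : 2 * (η * B) ≤ k * P.real S := by
    have h1 : 128 * alpha p * p.γ ^ 2 * σ ^ 2 = 256 * η := D.strength
    have hlam : 0 < 128 * alpha p * p.γ ^ 2 := by
      have := D.adm.α_pos; have := D.adm.γ_pos; positivity
    have hk2 : 128 * alpha p * p.γ ^ 2 / 3 * (B * ℓ ^ 2) ≤ k := by rw [hk]; gcongr
    have h2 : (0:ℝ) ≤ 128 * alpha p * p.γ ^ 2 / 3 * (B * ℓ ^ 2) := by positivity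
    -- For `B ≤ σ` the event has probability at least `1/2 - 1/5`, and `ℓ ≥ 3σ/10` gives a gain of
    -- about `2.3 ηB`; this fixes the threshold `σ/3`. For `B ≥ σ`, `ηB ≤ σ/2` leaves probability at
    -- least `1/5`, and the gain is about `13.8 ηB`.
    rcases hℓ with ⟨h, hBσ⟩ | ⟨h, hBσ⟩
    · have h3 : (3 : ℝ) / 10 ≤ P.real S := by
        refine le_trans ?_ hlow
        have : (ℓ + η * B) / (5 * σ) ≤ 1 / 5 := by
          rw [div_le_iff₀ (by positivity)]; linarith
        linarith
      have h4 : 128 * alpha p * p.γ ^ 2 * ((3 / 10 * σ) ^ 2) ≤ 128 * alpha p * p.γ ^ 2 * ℓ ^ 2 := by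
        gcongr
      have h5 : 128 * alpha p * p.γ ^ 2 / 3 * (B * ℓ ^ 2) * (3 / 10) ≤ k * P.real S :=
        mul_le_mul hk2 h3 (by norm_num) (h2.trans hk2)
      have h6 : 23 * η ≤ 128 * alpha p * p.γ ^ 2 * ℓ ^ 2 := by nlinarith
      have h7 := mul_le_mul_of_nonneg_right h6 hB0.le
      nlinarith
    · have h3 : (1 : ℝ) / 5 ≤ P.real S := by
        refine le_trans ?_ hlow
        have : (ℓ + η * B) / (5 * σ) ≤ 3 / 10 := by
          rw [div_le_iff₀ (by positivity)]; linarith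
        linarith
      have h4 : 128 * alpha p * p.γ ^ 2 * ℓ ^ 2 = 256 * η * (81 / 100) := by
        rw [h, ← h1]; ring
      have h5 : 128 * alpha p * p.γ ^ 2 / 3 * (B * ℓ ^ 2) * (1 / 5) ≤ k * P.real S :=
        mul_le_mul hk2 h3 (by norm_num) (h2.trans hk2)
      have h7 : 128 * alpha p * p.γ ^ 2 / 3 * (B * ℓ ^ 2) * (1 / 5)
          = 256 * η * (81 / 100) * B / 15 := by rw [← h4]; ring
      have := mul_pos hη0 hB0
      nlinarith
  have := mul_le_mul_of_nonneg_left hkB hs.le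
  linarith

/-- Since `Y` has mean `B` but is rarely nonzero, most of its mean is carried by values beyond `B +
ℓ`. There the graph of `f` has smaller slope, so the tangent at `r` overestimates by about `B` times
the drop of the slope. -/
lemma contraction_right (hY : ReflectedVar P σ B Y) (hAB : A ≤ 4 * B) (hB : B ≤ σ / 3) {ℓ : ℝ}
    (hℓ : 0 ≤ ℓ) (hℓσ : ℓ ≤ σ / 4)
    (hdrop : 3 * (h * p.γ * alpha p) * slope p R₁ (alpha p * A + B)
      ≤ slope p R₁ (alpha p * A + B) - slope p R₁ (alpha p * A + B + ℓ)) :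
    ∫ ω, f p R₁ (alpha p * A + h * p.γ * alpha p * B + Y ω) ∂P
      ≤ (1 - c * h) * f p R₁ (alpha p * A + B) := by
  set η := h * p.γ * alpha p with hη
  set r := alpha p * A + B with hr
  have hη0 : 0 < η := D.drift_pos
  have hσ := D.σ_pos
  have hB0 := D.B_nonneg
  have hr0 : 0 ≤ r := D.r_nonneg
  have hs : 0 < slope p R₁ r := D.adm.slopePos hr0
  set k := slope p R₁ r - slope p R₁ (r + ℓ) with hk
  have hk0 : 0 ≤ k := le_trans (by positivity) hdrop
  set S := {ω | Y ω ≠ 0} with hS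
  have hSm : MeasurableSet S := (measurableSet_eq_fun hY.meas measurable_const).compl
  -- The majorant is the tangent line at `Y = 0` and the line with slope reduced by `k`, bent at `B
  -- + ℓ`, otherwise. It is rewritten as one affine function of `Y - B` plus a multiple of the
  -- indicator of failure.
  have key := hY.integral_le (D.integrable_arg hY) hSm
    (a := f p R₁ r + slope p R₁ r * (η * B) - k * B) (s := slope p R₁ r - k) (k := -(k * (B + ℓ)))
    (by
      intro ω
      have h1 := D.adm.f_tangent_right hr0 hℓ (D.pos_arg _ (hY.nonneg ω))
      have hηB : 0 ≤ η * B := by positivity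
      by_cases hω : ω ∈ S
      · have h2 : Y ω - B - ℓ ≤ max (alpha p * A + η * B + Y ω - r - ℓ) 0 := by
          refine le_trans ?_ (le_max_left _ _)
          linarith
        have h3 := mul_le_mul_of_nonneg_left h2 hk0
        rw [Set.indicator_of_mem hω]
        linarith
      · have h2 : (0 : ℝ) ≤ max (alpha p * A + η * B + Y ω - r - ℓ) 0 := le_max_right _ _
        have h3 := mul_nonneg hk0 h2
        have h4 : Y ω = 0 := not_not.1 hω
        rw [Set.indicator_of_notMem hω]
        rw [h4] at h1 h3 ⊢
        linarith)
  refine D.finish (D.adm.slopeRadius_le hr0) hAB (key.trans ?_)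
  -- `B + ℓ ≤ (1/3 + 1/4)σ` and the failure probability is at most `2B/(5σ)`. So the share `23/30`
  -- of `kB` remains, and `3 · 23/30 ≥ 2` explains the factor `3` in the required drop.
  have h1 : (B + ℓ) * P.real S ≤ 7 / 30 * B := by
    calc (B + ℓ) * P.real S ≤ (7 / 12 * σ) * (2 / 5 * B / σ) :=
          mul_le_mul (by linarith) hY.fail measureReal_nonneg (by positivity)
      _ = _ := by field_simp; ring
  have h2 := mul_le_mul_of_nonneg_left h1 hk0
  have h3 := mul_le_mul_of_nonneg_right hdrop hB0
  nlinarith [mul_nonneg (mul_nonneg hη0.le hs.le) hB0]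

/-- Just below `R₁` the slope cannot drop noticeably to the right, so the line of slope `f'(R₁)`
through the point of the graph at `R₁` is used there. On success the process lands at `r₀ = αA +
ηB`, far enough to the left of `r` for the concavity due to `ψ` to gain `E₀` over that slope. The
loss `E₁` from `r` to `R₁` occurs only with the small failure probability. -/
lemma contraction_boundary (hY : ReflectedVar P σ B Y) (hAB : A ≤ 4 * B) (hB0 : 0 < B)
    (hB : B ≤ σ / 3) (h1 : R₁ ≤ alpha p * A + B + σ / 4) (h2 : R₁ ≤ 2 * (alpha p * A + B)) :
    ∫ ω, f p R₁ (alpha p * A + h * p.γ * alpha p * B + Y ω) ∂P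
      ≤ (1 - c * h) * f p R₁ (alpha p * A + B) := by
  set η := h * p.γ * alpha p with hη
  set r := alpha p * A + B with hr
  have hη0 : 0 < η := D.drift_pos
  have hη1 : η ≤ 1 / 9600 := D.drift_le
  have hσ := D.σ_pos
  have hα := D.adm.α_pos
  have hαA := mul_nonneg hα.le D.A_nonneg
  have hr0 : 0 < r := by linarith
  have hrR : r ≤ R₁ := D.le_radius
  have hR0 : 0 < R₁ := by linarith
  set s₁ := slope p R₁ R₁ with hs₁
  have hs₁0 : 0 < s₁ := D.adm.slopePos hR0.le
  set r₀ := alpha p * A + η * B with hr₀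
  have hr₀0 : 0 ≤ r₀ := by positivity
  have hr₀r : r₀ ≤ r - 9 / 10 * B := by nlinarith
  set E₀ := f p R₁ r - f p R₁ r₀ - s₁ * (r - r₀) with hE₀
  set E₁ := f p R₁ R₁ - f p R₁ r - s₁ * (R₁ - r) with hE₁
  set S := {ω | Y ω ≠ 0} with hS
  have hSm : MeasurableSet S := (measurableSet_eq_fun hY.meas measurable_const).compl
  have key := hY.integral_le (D.integrable_arg hY) hSm
    (a := f p R₁ r + s₁ * (η * B) - E₀) (s := s₁) (k := -(E₁ + E₀))
    (by
      intro ω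
      by_cases hω : ω ∈ S
      · have h2 := D.adm.f_tangent hR0.le (D.pos_arg _ (hY.nonneg ω))
        rw [Set.indicator_of_mem hω]
        linarith
      · have h4 : Y ω = 0 := not_not.1 hω
        rw [Set.indicator_of_notMem hω]
        rw [h4, add_zero]
        linarith)
  refine D.finish le_rfl hAB (key.trans ?_)
  have hF : P.real S ≤ 2 / 15 := by
    refine hY.fail.trans ?_
    rw [div_le_iff₀ hσ]; linarith
  set g := slope p R₁ r - s₁ with hg
  have hg0 : 0 ≤ g := sub_nonneg.2 (D.adm.slopeRadius_le hr0.le)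
  have hE₁g : E₁ ≤ σ / 4 * g := by
    have := (D.adm.f_bounds hr0.le hrR).2
    have : E₁ ≤ (R₁ - r) * g := by linarith
    exact this.trans (mul_le_mul_of_nonneg_right (by linarith) hg0)
  have hE₁F : E₁ * P.real S ≤ B * g / 10 := by
    calc E₁ * P.real S ≤ (σ / 4 * g) * P.real S :=
          mul_le_mul_of_nonneg_right hE₁g measureReal_nonneg
      _ ≤ (σ / 4 * g) * (2 / 5 * B / σ) := mul_le_mul_of_nonneg_left hY.fail (by positivity)
      _ = _ := by field_simp; ring
  have hE₀g : 9 / 10 * B * g ≤ E₀ := by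
    have := (D.adm.f_bounds hr₀0 (by linarith : r₀ ≤ r)).1
    have h3 : (r - r₀) * g ≤ E₀ := by linarith
    exact le_trans (mul_le_mul_of_nonneg_right (by linarith) hg0) h3
  have hE₀0 : 0 ≤ E₀ := le_trans (by positivity) hE₀g
  -- The slope has decayed least near `r`, so only the left half of `[r₀, r]` is used, where
  -- `slope_lower` gives an excess proportional to the distance from `R₁`.
  have hE₀low : 1 / 5 * s₁ * B ^ 2 ≤ E₀ * R₁ := by
    set m := (r₀ + r) / 2 with hm
    have hm1 := (D.adm.f_bounds hr₀0 (by linarith : r₀ ≤ m)).1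
    have hm2 := D.adm.f_sub_ge (by linarith : 0 ≤ m) (by linarith : m ≤ r)
    have hm3 := slope_lower D.adm.γ_pos hα.le hR0 (by linarith : 0 ≤ m) (by linarith : m ≤ R₁)
    have hm4 : s₁ * ((R₁ - m) / R₁) * (m - r₀) ≤ E₀ := by
      have := mul_le_mul_of_nonneg_right hm3 (by linarith : 0 ≤ m - r₀)
      nlinarith
    have hm5 : s₁ * ((R₁ - m) * (m - r₀)) ≤ E₀ * R₁ := by
      have := mul_le_mul_of_nonneg_right hm4 hR0.le
      have h6 : s₁ * ((R₁ - m) / R₁) * (m - r₀) * R₁ = s₁ * ((R₁ - m) * (m - r₀)) := by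
        field_simp
      linarith
    have hm6 : 9 / 20 * B * (9 / 20 * B) ≤ (R₁ - m) * (m - r₀) :=
      mul_le_mul (by linarith) (by linarith) (by positivity) (by linarith)
    have h7 := mul_le_mul_of_nonneg_left hm6 hs₁0.le
    have h8 : s₁ * (9 / 20 * B * (9 / 20 * B)) = 81 / 400 * (s₁ * B ^ 2) := by ring
    have h9 : 0 ≤ s₁ * B ^ 2 := by positivity
    linarith
  have hRB : R₁ ≤ 8 * (alpha p + 1) * B := by
    have := mul_le_mul_of_nonneg_left hAB hα.le
    linarith
  have hE₀B : s₁ * B ≤ 40 * (alpha p + 1) * E₀ := by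
    have h3 := mul_le_mul_of_nonneg_left hRB hE₀0
    have h4 : (s₁ * B) * B ≤ (40 * (alpha p + 1) * E₀) * B := by linarith
    exact le_of_mul_le_mul_right h4 hB0
  -- `R₁ ≤ 2r` and `A ≤ 4B` bound `R₁` by a multiple of `(α + 1)B`. This is why the step size
  -- condition contains the factor `α + 1`.
  have hηE : 2 * (s₁ * (η * B)) ≤ E₀ / 100 := by
    have h3 := mul_le_mul_of_nonneg_left hE₀B hη0.le
    have h4 := mul_le_mul_of_nonneg_right D.drift_small hE₀0
    rw [← hη] at h4
    linarith
  have h5 := mul_le_mul_of_nonneg_left hF hE₀0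
  linarith

/-- The mean of `f` over one contractive step decreases by the factor `1 - c h`. -/
theorem contraction (hY : ReflectedVar P σ B Y) :
    ∫ ω, f p R₁ (alpha p * (1 - h * p.γ / 2) * A + h * p.γ * alpha p * B + Y ω) ∂P
      ≤ (1 - c * h) * f p R₁ (alpha p * A + B) := by
  have hα := D.adm.α_pos
  have hγ := D.adm.γ_pos
  have hA := D.A_nonneg
  have hB := D.B_nonneg
  have hh := D.h_pos
  have hη0 := D.drift_pos
  have hr0 := D.r_nonneg
  have hσ := D.σ_pos
  have hs1 : 0 < slope p R₁ R₁ := D.adm.slopePos D.adm.R_nonneg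
  have hdamp := D.damping_small
  have harg : ∀ ω, 0 ≤ alpha p * (1 - h * p.γ / 2) * A + h * p.γ * alpha p * B + Y ω := by
    intro ω
    have h1 : 0 ≤ 1 - h * p.γ / 2 := by nlinarith
    have := mul_nonneg (mul_nonneg hα.le h1) hA
    have := mul_nonneg hη0.le hB
    have := hY.nonneg ω
    linarith
  have hint : Integrable (fun ω => f p R₁ (alpha p * (1 - h * p.γ / 2) * A
      + h * p.γ * alpha p * B + Y ω)) P :=
    D.adm.integrable_f_comp (measurable_const.add hY.meas) harg
      ((integrable_const _).add hY.integrable)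
  rcases le_or_gt (4 * B) A with hAB' | hAB'
  · have hAB := hAB'
    set r := alpha p * A + B with hr
    have key := hY.integral_le hint MeasurableSet.empty
      (a := f p R₁ r + slope p R₁ r * (h * p.γ * alpha p * (B - A / 2))) (s := slope p R₁ r)
      (k := 0) (by
        intro ω
        refine (D.adm.f_tangent hr0 (harg ω)).trans_eq ?_
        rw [hr]; ring)
    refine key.trans ?_
    have h1 := mul_le_mul_of_nonneg_right D.c_le₁ (mul_nonneg hα.le hA)
    have h2 := mul_le_mul_of_nonneg_right D.c_le₂ hB
    -- After the bounds on `c` the remainder is `3A/8 - 3B/2`, which is nonnegative exactly for `A ≥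
    -- 4B`.
    have h3 : c * r ≤ slope p R₁ R₁ * (p.γ * alpha p * (A / 2 - B)) := by
      have h5 : 0 < slope p R₁ R₁ * (p.γ * alpha p) := by positivity
      have h6 := mul_le_mul_of_nonneg_left hAB h5.le
      rw [hr]
      nlinarith
    have h4 := D.adm.slopeRadius_le hr0
    have h5 : slope p R₁ R₁ * (h * p.γ * alpha p * (A / 2 - B))
        ≤ slope p R₁ r * (h * p.γ * alpha p * (A / 2 - B)) :=
      mul_le_mul_of_nonneg_right h4 (mul_nonneg hη0.le (by linarith))
    have h6 := D.adm.f_le hr0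
    have h7 := mul_le_mul_of_nonneg_left h6 (mul_nonneg D.c_nonneg hh.le)
    have h8 := mul_le_mul_of_nonneg_left h3 hh.le
    rw [zero_mul, sub_zero]
    nlinarith
  · have hAB : A ≤ 4 * B := hAB'.le
    have hmono : ∫ ω, f p R₁ (alpha p * (1 - h * p.γ / 2) * A + h * p.γ * alpha p * B + Y ω) ∂P
        ≤ ∫ ω, f p R₁ (alpha p * A + h * p.γ * alpha p * B + Y ω) ∂P := by
      refine integral_mono hint (D.integrable_arg hY) fun ω => D.adm.f_mono (harg ω) ?_
      have : 0 ≤ alpha p * (h * p.γ / 2) * A := by positivity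
      nlinarith
    refine hmono.trans ?_
    rcases le_total (σ / 3) B with hBσ | hBσ
    · exact D.contraction_large hY hAB hBσ
    have hB0 : 0 < B := by linarith
    have hr : 0 < alpha p * A + B := by have := mul_nonneg hα.le hA; linarith
    have hs := D.adm.slopePos hr0
    have hη1 := D.drift_le
    rcases le_total (alpha p * A + B + σ / 4) R₁ with hR | hR
    · refine D.contraction_right hY hAB hBσ (by positivity) le_rfl ?_
      have h1 := slope_mul_exp_le hγ D.adm.R_nonneg hr0
        (by linarith : alpha p * A + B ≤ alpha p * A + B + σ / 4) hR
      -- Expanding the square leaves at least `64αγ²(σ/4)² = 8η`, so the slope falls by the factor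
      -- `1 + 8η` over a distance `σ/4`; a drop of `3η` relative to the slope at `r` is needed.
      have h2 : 8 * (h * p.γ * alpha p)
          ≤ 64 * alpha p * p.γ ^ 2 * ((alpha p * A + B + σ / 4) ^ 2 - (alpha p * A + B) ^ 2) := by
        have h3 := D.strength
        have h4 : 0 ≤ alpha p * p.γ ^ 2 * (σ * (alpha p * A + B)) := by positivity
        nlinarith
      have h3 := Real.add_one_le_exp
        (64 * alpha p * p.γ ^ 2 * ((alpha p * A + B + σ / 4) ^ 2 - (alpha p * A + B) ^ 2))
      have h4 : 0 < slope p R₁ (alpha p * A + B + σ / 4) := D.adm.slopePos (by linarith)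
      have h5 := mul_le_mul_of_nonneg_left
        (show 1 + 8 * (h * p.γ * alpha p) ≤ _ by linarith) h4.le
      nlinarith [mul_pos hη0 hs, mul_pos hη0 (mul_pos hη0 hs)]
    · rcases le_total (2 * (alpha p * A + B)) R₁ with hR2 | hR2
      · refine D.contraction_right hY hAB hBσ (ℓ := R₁ - (alpha p * A + B)) (by linarith)
          (by linarith) ?_
        -- For `r ≤ R₁/2` the factor `ψ` makes the slope at `r` at least `3/2` of that at `R₁`, a
        -- relative drop of a third, far more than `3η`.
        have h1 := slope_lower hγ hα.le (by linarith : 0 < R₁) hr0 D.le_radius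
        rw [add_sub_cancel]
        have h2 : 1 / 2 ≤ (R₁ - (alpha p * A + B)) / R₁ := by
          rw [div_le_div_iff₀ (by norm_num) (by linarith)]; linarith
        have h3 := mul_le_mul_of_nonneg_left h2 hs1.le
        nlinarith
      · exact D.contraction_boundary hY hAB hB0 hBσ hR hR2

end StepData

end

end

section

/-! ### The one-dimensional reflection-maximal coupling -/

/-- The uniform distribution on `[0, 1]`. -/
def unif : Measure ℝ := volume.restrict (Set.Icc (0 : ℝ) 1)

instance : IsProbabilityMeasure unif := ⟨by simp [unif]⟩

lemma ae_unif_le_one : ∀ᵐ u ∂unif, u ≤ 1 := by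
  filter_upwards [ae_restrict_mem measurableSet_Icc] with u hu using hu.2

/-- The standard normal density. -/
abbrev npdf (t : ℝ) : ℝ := gaussianPDFReal 0 1 t

lemma npdf_pos (t : ℝ) : 0 < npdf t := gaussianPDFReal_pos 0 1 t one_ne_zero

lemma npdf_eq (t : ℝ) : npdf t = (Real.sqrt (2 * Real.pi))⁻¹ * Real.exp (-t ^ 2 / 2) := by
  simp [npdf, gaussianPDFReal]

lemma npdf_neg (t : ℝ) : npdf (-t) = npdf t := by simp [npdf_eq]

lemma npdf_le (t : ℝ) : npdf t ≤ 2 / 5 := by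
  rw [npdf_eq]
  have h1 : (5 / 2 : ℝ) ≤ Real.sqrt (2 * Real.pi) := by
    apply Real.le_sqrt_of_sq_le
    have := Real.pi_gt_d2
    norm_num at this ⊢
    linarith
  have h2 : (Real.sqrt (2 * Real.pi))⁻¹ ≤ 2 / 5 := by
    rw [inv_le_comm₀ (by linarith) (by norm_num)]
    norm_num at h1 ⊢
    exact h1
  have h3 : Real.exp (-t ^ 2 / 2) ≤ 1 := Real.exp_le_one_iff.2 (by nlinarith [sq_nonneg t])
  calc _ ≤ 2 / 5 * (1 : ℝ) := mul_le_mul h2 h3 (Real.exp_pos _).le (by norm_num)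
    _ = _ := by ring

lemma measurable_npdf : Measurable npdf := measurable_gaussianPDFReal 0 1

lemma npdf_lt {t s : ℝ} (h : npdf (t + s) < npdf t) : 0 < s * (2 * t + s) := by
  rw [npdf_eq, npdf_eq] at h
  have h1 := lt_of_mul_lt_mul_left h (by positivity)
  have h2 := Real.exp_lt_exp.1 h1
  nlinarith

open scoped Classical in
/-- The second coordinate of the reflection-maximal coupling of `N(0, 1)` and its translate. -/
def reflected (s t u : ℝ) : ℝ := if u ≤ npdf (t + s) / npdf t then t + s else -t

lemma measurableSet_accept (s : ℝ) :
    MeasurableSet {x : ℝ × ℝ | x.2 ≤ npdf (x.1 + s) / npdf x.1} :=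
  measurableSet_le measurable_snd
    ((measurable_npdf.comp (measurable_fst.add_const s)).div (measurable_npdf.comp measurable_fst))

lemma measurable_reflected (s : ℝ) : Measurable fun x : ℝ × ℝ => reflected s x.1 x.2 :=
  Measurable.ite (measurableSet_accept s) (measurable_fst.add_const s) measurable_fst.neg

/-- Conditionally on `t` the proposal `t + s` is accepted with probability `min(1, r)`, where `r` is
the likelihood ratio; the uniform variable is integrated out. -/
lemma lintegral_reflected_unif (s t : ℝ) (F : ℝ → ENNReal) :
    ∫⁻ u, F (reflected s t u) ∂unif
      = ENNReal.ofReal (min (npdf t) (npdf (t + s)) / npdf t) * F (t + s)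
        + ENNReal.ofReal (1 - min (npdf t) (npdf (t + s)) / npdf t) * F (-t) := by
  set r := npdf (t + s) / npdf t with hr
  have hr0 : 0 < r := div_pos (npdf_pos _) (npdf_pos _)
  have hmin : min (npdf t) (npdf (t + s)) / npdf t = min 1 r := by
    rw [← min_div_div_right (npdf_pos t).le, div_self (npdf_pos t).ne']
  have h1 : (fun u => F (reflected s t u))
      = fun u => (Set.Iic r).indicator (fun _ => F (t + s)) u
        + (Set.Ioi r).indicator (fun _ => F (-t)) u := by
    ext u
    by_cases hu : u ≤ r
    · have hu' : ¬ r < u := not_lt.2 hu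
      simp [reflected, ← hr, hu, hu']
    · have hu' : r < u := not_le.1 hu
      simp [reflected, ← hr, hu, hu']
  have hA : unif (Set.Iic r) = ENNReal.ofReal (min 1 r) := by
    rw [unif, Measure.restrict_apply measurableSet_Iic]
    have : Set.Iic r ∩ Set.Icc (0 : ℝ) 1 = Set.Icc 0 (min 1 r) := by
      ext u; simp only [Set.mem_inter_iff, Set.mem_Iic, Set.mem_Icc, le_min_iff]; tauto
    rw [this, Real.volume_Icc, sub_zero]
  have hB : unif (Set.Ioi r) = ENNReal.ofReal (1 - min 1 r) := by
    rw [← Set.compl_Iic, prob_compl_eq_one_sub measurableSet_Iic, hA,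
      ENNReal.ofReal_sub _ (le_min zero_le_one hr0.le), ENNReal.ofReal_one]
  rw [h1, lintegral_add_left (measurable_const.indicator measurableSet_Iic),
    lintegral_indicator_const measurableSet_Iic, lintegral_indicator_const measurableSet_Ioi,
    hA, hB, hmin, mul_comm, mul_comm (F (-t))]

lemma lintegral_gaussian (F : ℝ → ENNReal) (hF : Measurable F) :
    ∫⁻ t, F t ∂(gaussianReal 0 1) = ∫⁻ t, ENNReal.ofReal (npdf t) * F t := by
  rw [gaussianReal_of_var_ne_zero 0 one_ne_zero,
    lintegral_withDensity_eq_lintegral_mul _ (measurable_gaussianPDF 0 1) hF]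
  rfl

/-- The second coordinate of the coupling is again standard normal. -/
theorem map_reflected (s : ℝ) :
    ((gaussianReal 0 1).prod unif).map (fun x => reflected s x.1 x.2) = gaussianReal 0 1 := by
  apply Measure.ext_of_lintegral
  intro F hF
  rw [lintegral_map hF (measurable_reflected s),
    lintegral_prod (fun x : ℝ × ℝ => F (reflected s x.1 x.2))
      (hF.comp (measurable_reflected s)).aemeasurable]
  simp_rw [lintegral_reflected_unif]
  set m : ℝ → ℝ := fun t => min (npdf t) (npdf (t + s)) with hm
  have hmm : Measurable m :=
    measurable_npdf.min (measurable_npdf.comp (measurable_id.add_const s))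
  have hm0 : ∀ t, 0 < m t := fun t => lt_min (npdf_pos _) (npdf_pos _)
  have hF1 : Measurable fun t => F (t + s) := hF.comp (measurable_id.add_const s)
  have hF2 : Measurable fun t => F (-t) := hF.comp measurable_neg
  rw [lintegral_gaussian, lintegral_gaussian F hF]
  · have h1 : ∀ t, ENNReal.ofReal (npdf t) * (ENNReal.ofReal (m t / npdf t) * F (t + s)
        + ENNReal.ofReal (1 - m t / npdf t) * F (-t))
        = ENNReal.ofReal (m t) * F (t + s) + ENNReal.ofReal (npdf t - m t) * F (-t) := by
      intro t
      have hp := npdf_pos t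
      rw [mul_add, ← mul_assoc, ← mul_assoc, ← ENNReal.ofReal_mul hp.le, ← ENNReal.ofReal_mul hp.le]
      congr 3
      · field_simp
      · field_simp
    change ∫⁻ t, ENNReal.ofReal (npdf t) * (ENNReal.ofReal (m t / npdf t) * F (t + s)
        + ENNReal.ofReal (1 - m t / npdf t) * F (-t)) = _
    simp_rw [h1]
    have hmF : Measurable fun t => ENNReal.ofReal (m t) * F (t + s) :=
      hmm.ennreal_ofReal.mul hF1
    rw [lintegral_add_left hmF]
    -- A translation by `s` turns the accepted mass into density `min(φ(t), φ(t - s))`, and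
    -- reflection turns the rejected mass into the complementary `φ(t) - min(φ(t), φ(t - s))`, by
    -- symmetry of `φ`.
    have h2 : ∫⁻ t, ENNReal.ofReal (m t) * F (t + s)
        = ∫⁻ t, ENNReal.ofReal (min (npdf t) (npdf (t - s))) * F t := by
      rw [← lintegral_add_right_eq_self
        (fun t => ENNReal.ofReal (min (npdf t) (npdf (t - s))) * F t) s]
      simp [hm, min_comm]
    have h3 : ∫⁻ t, ENNReal.ofReal (npdf t - m t) * F (-t)
        = ∫⁻ t, ENNReal.ofReal (npdf t - min (npdf t) (npdf (t - s))) * F t := by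
      rw [← lintegral_neg_eq_self
        (fun t => ENNReal.ofReal (npdf t - min (npdf t) (npdf (t - s))) * F t)]
      refine lintegral_congr fun t => ?_
      have : -t - s = -(t + s) := by ring
      simp only [hm, this, npdf_neg]
    rw [h2, h3, ← lintegral_add_left]
    · refine lintegral_congr fun t => ?_
      rw [← add_mul, ← ENNReal.ofReal_add (le_min (npdf_pos _).le (npdf_pos _).le)
        (sub_nonneg.2 (min_le_left _ _))]
      simp
    · exact ((measurable_npdf.min (measurable_npdf.comp
        (measurable_id.sub_const s))).ennreal_ofReal).mul hF
  · exact (((hmm.div measurable_npdf).ennreal_ofReal).mul hF1).add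
      (((measurable_const.sub (hmm.div measurable_npdf)).ennreal_ofReal).mul hF2)

lemma gaussianReal_Ioc_le {a b : ℝ} (hab : a ≤ b) :
    (gaussianReal 0 1).real (Set.Ioc a b) ≤ 2 / 5 * (b - a) := by
  have h : gaussianReal 0 1 (Set.Ioc a b) ≤ ENNReal.ofReal (2 / 5 * (b - a)) := by
    rw [gaussianReal_apply 0 one_ne_zero]
    calc ∫⁻ x in Set.Ioc a b, gaussianPDF 0 1 x
        ≤ ∫⁻ x in Set.Ioc a b, ENNReal.ofReal (2 / 5) :=
          lintegral_mono fun x => ENNReal.ofReal_le_ofReal (npdf_le x)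
      _ = _ := by
          rw [setLIntegral_const, Real.volume_Ioc, ← ENNReal.ofReal_mul (by norm_num)]
  exact ENNReal.toReal_le_of_le_ofReal (by linarith) h

lemma gaussianReal_Iic_zero : 1 / 2 ≤ (gaussianReal 0 1).real (Set.Iic 0) := by
  have h1 : (gaussianReal 0 1).map (fun x => -x) = gaussianReal 0 1 := by
    rw [gaussianReal_map_neg, neg_zero]
  have h2 : (gaussianReal 0 1).real (Set.Ici 0) = (gaussianReal 0 1).real (Set.Iic 0) := by
    conv_lhs => rw [← h1]
    rw [map_measureReal_apply measurable_neg measurableSet_Ici]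
    congr 1
    ext x; simp
  have h3 := measureReal_union_le (μ := gaussianReal 0 1) (Set.Iic (0 : ℝ)) (Set.Ici 0)
  rw [Set.Iic_union_Ici, probReal_univ, h2] at h3
  linarith

lemma gaussianReal_Iic_lower {y : ℝ} (hy : 0 ≤ y) :
    1 / 2 - 2 / 5 * y ≤ (gaussianReal 0 1).real (Set.Iic (-y)) := by
  have h1 := measureReal_union_le (μ := gaussianReal 0 1) (Set.Iic (-y)) (Set.Ioc (-y) 0)
  rw [Set.Iic_union_Ioc_eq_Iic (by linarith)] at h1
  have h2 := gaussianReal_Ioc_le (show -y ≤ 0 by linarith)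
  have h3 := gaussianReal_Iic_zero
  linarith

open scoped Classical in
/-- The size of `q` after a step of the contractive coupling, before the drift is added. -/
def residual (σ B t u : ℝ) : ℝ :=
  if u ≤ npdf (t + B / σ) / npdf t then 0 else |B + 2 * σ * t|

lemma measurable_residual (σ B : ℝ) : Measurable fun x : ℝ × ℝ => residual σ B x.1 x.2 := by
  refine Measurable.ite (measurableSet_accept (B / σ)) measurable_const ?_
  exact (by fun_prop : Continuous fun x : ℝ × ℝ => |B + 2 * σ * x.1|).measurable

/-- Rejection requires the density at `t + s` to be smaller than at `t`, so `t` lies to the right of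
`-s/2`. Hence on rejection `B + 2σt` is positive and the absolute value in `residual` is redundant.
-/
lemma ae_reject {s : ℝ} (hs : 0 ≤ s) : ∀ᵐ x ∂((gaussianReal 0 1).prod unif),
    ¬ x.2 ≤ npdf (x.1 + s) / npdf x.1 → 0 < 2 * x.1 + s := by
  have h := (Measure.quasiMeasurePreserving_snd (μ := gaussianReal 0 1) (ν := unif)).ae
    ae_unif_le_one
  filter_upwards [h] with x hx hx2
  have h1 := (not_le.1 hx2).trans_le hx
  rw [div_lt_one (npdf_pos _)] at h1
  exact (pos_iff_pos_of_mul_pos (npdf_lt h1)).1 (hs.lt_of_ne fun h0 => by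
    have := npdf_lt h1
    rw [← h0, zero_mul] at this
    exact this.false)

lemma integrable_id_gaussianReal : Integrable (fun x : ℝ => x) (gaussianReal 0 1) :=
  (memLp_id_gaussianReal 1).integrable le_rfl

/-- Almost surely the residual equals `B + σ(ξ - ξ')` with both scalar increments centred, which
gives the mean. The failure bound is a total variation estimate obtained without computing the
acceptance probability. -/
theorem reflectedVar_residual {σ B : ℝ} (hσ : 0 < σ) (hB : 0 ≤ B) :
    ReflectedVar ((gaussianReal 0 1).prod unif) σ B (fun x => residual σ B x.1 x.2) := by
  set μ := (gaussianReal 0 1).prod unif with hμ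
  set s := B / σ with hs
  have hs0 : 0 ≤ s := by positivity
  have hσs : σ * s = B := by rw [hs]; field_simp
  have hrej := ae_reject hs0
  rw [← hμ] at hrej
  have hae : (fun x : ℝ × ℝ => residual σ B x.1 x.2)
      =ᵐ[μ] fun x => B + σ * x.1 - σ * reflected s x.1 x.2 := by
    filter_upwards [hrej] with x hx
    simp only [residual, reflected, ← hs]
    split_ifs with h
    · rw [← hσs]; ring
    · have := mul_pos hσ (hx h)
      rw [abs_of_nonneg (by nlinarith)]
      ring
  have hfst : μ.map Prod.fst = gaussianReal 0 1 := by
    rw [hμ, ← Measure.fst, Measure.fst_prod]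
  have hi1 : Integrable (fun x : ℝ × ℝ => x.1) μ := by
    have h := integrable_id_gaussianReal
    rw [← hfst] at h
    exact h.comp_measurable measurable_fst
  have hi2 : Integrable (fun x : ℝ × ℝ => reflected s x.1 x.2) μ := by
    have h := integrable_id_gaussianReal
    rw [← map_reflected s] at h
    exact h.comp_measurable (measurable_reflected s)
  have he1 : ∫ x, x.1 ∂μ = 0 := by
    have h := integral_map (μ := μ) (φ := Prod.fst) measurable_fst.aemeasurable
      (f := fun x : ℝ => x) aestronglyMeasurable_id
    rw [hfst, integral_id_gaussianReal] at h
    exact h.symm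
  have he2 : ∫ x, reflected s x.1 x.2 ∂μ = 0 := by
    have h := integral_map (μ := μ) (φ := fun x => reflected s x.1 x.2)
      (measurable_reflected s).aemeasurable (f := fun x : ℝ => x) aestronglyMeasurable_id
    rw [map_reflected, integral_id_gaussianReal] at h
    exact h.symm
  have hi3 : Integrable (fun x : ℝ × ℝ => B + σ * x.1) μ :=
    (integrable_const B).add (hi1.const_mul σ)
  refine ⟨measurable_residual σ B, fun x => ?_, ?_, ?_, ?_, ?_⟩
  · unfold residual; split_ifs <;> positivity
  · exact (hi3.sub (hi2.const_mul σ)).congr hae.symm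
  · rw [integral_congr_ae hae, integral_sub hi3 (hi2.const_mul σ),
      integral_add (integrable_const B) (hi1.const_mul σ), integral_const_mul, integral_const_mul,
      he1, he2]
    simp
  · set b := s / 2 with hb
    have hb0 : 0 ≤ b := by positivity
    set S := {x : ℝ × ℝ | residual σ B x.1 x.2 ≠ 0} with hS
    have hSm : MeasurableSet S :=
      (measurableSet_eq_fun (measurable_residual σ B) measurable_const).compl
    -- Failure and `ξ' > s/2` exclude each other, and each forces `ξ > -s/2`. As `ξ'` is standard
    -- normal too, the failure probability is at most the Gaussian mass of `(-s/2, s/2]`.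
    set T := {x : ℝ × ℝ | b < reflected s x.1 x.2} with hT
    have hTm : MeasurableSet T := measurableSet_lt measurable_const (measurable_reflected s)
    have hsub : (S ∪ T : Set (ℝ × ℝ)) ≤ᵐ[μ] {x : ℝ × ℝ | -b < x.1} := by
      filter_upwards [hrej] with x hx hxST
      change -b < x.1
      rcases hxST with h | h
      · have h1 : ¬ x.2 ≤ npdf (x.1 + s) / npdf x.1 := by
          intro h2
          exact h (by simp only [residual, ← hs]; exact if_pos h2)
        linarith [hx h1]
      · have h' : b < reflected s x.1 x.2 := h
        unfold reflected at h'
        split_ifs at h' with h2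
        · linarith
        · linarith [hx h2]
    have hdisj : AEDisjoint μ S T := by
      have : ∀ᵐ x ∂μ, x ∉ S ∩ T := by
        filter_upwards [hrej] with x hx hxST
        have h1 : ¬ x.2 ≤ npdf (x.1 + s) / npdf x.1 := by
          intro h2
          exact hxST.1 (by simp only [residual, ← hs]; exact if_pos h2)
        have h' : b < reflected s x.1 x.2 := hxST.2
        rw [reflected, if_neg h1] at h'
        linarith [hx h1]
      exact measure_eq_zero_iff_ae_notMem.2 this
    have h1 : μ S + μ T ≤ μ {x : ℝ × ℝ | -b < x.1} := by
      rw [← measure_union₀ hTm.nullMeasurableSet hdisj]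
      exact measure_mono_ae hsub
    have h2 : μ T = gaussianReal 0 1 (Set.Ioi b) := by
      rw [← map_reflected s, Measure.map_apply (measurable_reflected s) measurableSet_Ioi]; rfl
    have h3 : μ {x : ℝ × ℝ | -b < x.1} = gaussianReal 0 1 (Set.Ioi (-b)) := by
      rw [← hfst, Measure.map_apply measurable_fst measurableSet_Ioi]; rfl
    have h4 : gaussianReal 0 1 (Set.Ioi (-b))
        ≤ gaussianReal 0 1 (Set.Ioc (-b) b) + gaussianReal 0 1 (Set.Ioi b) := by
      rw [← Set.Ioc_union_Ioi_eq_Ioi (by linarith : -b ≤ b)]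
      exact measure_union_le _ _
    have h5 : μ S ≤ gaussianReal 0 1 (Set.Ioc (-b) b) := by
      rw [h2, h3] at h1
      exact (ENNReal.add_le_add_iff_right (measure_ne_top _ _)).1 (h1.trans h4)
    have h6 : μ.real S ≤ (gaussianReal 0 1).real (Set.Ioc (-b) b) :=
      ENNReal.toReal_mono (measure_ne_top _ _) h5
    refine h6.trans ((gaussianReal_Ioc_le (by linarith)).trans_eq ?_)
    rw [hb, hs]; ring
  · intro x hx0 hxB
    have hy0 : 0 ≤ x / (2 * σ) := by positivity
    have h1 := gaussianReal_Iic_lower hy0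
    have h2 : (gaussianReal 0 1).real (Set.Iic (-(x / (2 * σ))))
        = μ.real {z : ℝ × ℝ | z.1 ≤ -(x / (2 * σ))} := by
      rw [← hfst, map_measureReal_apply measurable_fst measurableSet_Iic]; rfl
    -- If `ξ ≤ -x/(2σ)`, then acceptance gives `0 ≤ B - x` and rejection gives `B + 2σξ ≤ B - x`.
    have h3 : ({z : ℝ × ℝ | z.1 ≤ -(x / (2 * σ))} : Set (ℝ × ℝ))
        ≤ᵐ[μ] {z : ℝ × ℝ | residual σ B z.1 z.2 ≤ B - x} := by
      filter_upwards [hrej] with z hz hz1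
      change residual σ B z.1 z.2 ≤ B - x
      have hz2 : z.1 ≤ -(x / (2 * σ)) := hz1
      simp only [residual, ← hs]
      split_ifs with h
      · linarith
      · have h4 := mul_pos hσ (hz h)
        rw [abs_of_nonneg (by nlinarith)]
        have h5 := mul_le_mul_of_nonneg_left hz2 (by positivity : 0 ≤ 2 * σ)
        have h6 : 2 * σ * -(x / (2 * σ)) = -x := by field_simp
        linarith
    have h4 : μ.real {z : ℝ × ℝ | z.1 ≤ -(x / (2 * σ))}
        ≤ μ.real {z : ℝ × ℝ | residual σ B z.1 z.2 ≤ B - x} :=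
      ENNReal.toReal_mono (measure_ne_top _ _) (measure_mono_ae h3)
    have h5 : 2 / 5 * (x / (2 * σ)) = x / (5 * σ) := by field_simp
    linarith

end

section

/-! ### The coupled Gaussian increments in dimension `d` -/

section

variable {d : ℕ}

/-- Component along `e` and orthogonal remainder. -/
def splitAlong (e x : Pos d) : ℝ × Pos d := (inner ℝ e x, x - (inner ℝ e x : ℝ) • e)

lemma continuous_splitAlong (e : Pos d) : Continuous (splitAlong e) := by
  unfold splitAlong; fun_prop

lemma covariance_stdGaussian (x y : Pos d) :
    cov[fun ω => inner ℝ x ω, fun ω => inner ℝ y ω; stdGaussian (Pos d)] = inner ℝ x y := by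
  rw [← covarianceBilin_apply_eq_cov IsGaussian.memLp_two_id, covarianceBilin_stdGaussian]
  rfl

lemma map_inner_stdGaussian {e : Pos d} (he : ‖e‖ = 1) :
    (stdGaussian (Pos d)).map (fun x => (inner ℝ e x : ℝ)) = gaussianReal 0 1 := by
  have hG : HasGaussianLaw (fun x : Pos d => innerSL ℝ e x) (stdGaussian (Pos d)) :=
    (IsGaussian.hasGaussianLaw_id (μ := stdGaussian (Pos d))).map_fun (innerSL ℝ e)
  have h := hG.map_eq_gaussianReal
  have h1 : Var[fun x : Pos d => innerSL ℝ e x; stdGaussian (Pos d)] = 1 := by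
    have := variance_dual_stdGaussian (innerSL ℝ e)
    rw [this]; simp [he]
  rw [integral_strongDual_stdGaussian (innerSL ℝ e), h1] at h
  simpa using h

/-- The component along `e` and the orthogonal remainder are jointly Gaussian and uncorrelated,
hence independent. -/
lemma map_splitAlong {e : Pos d} (he : ‖e‖ = 1) :
    (stdGaussian (Pos d)).map (splitAlong e)
      = (gaussianReal 0 1).prod
        ((stdGaussian (Pos d)).map fun x => x - (inner ℝ e x : ℝ) • e) := by
  have hee : (inner ℝ e e : ℝ) = 1 := by rw [real_inner_self_eq_norm_sq, he]; norm_num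
  have hXY : HasGaussianLaw (fun x : Pos d => (innerSL ℝ e x, x - (innerSL ℝ e x) • e))
      (stdGaussian (Pos d)) :=
    (IsGaussian.hasGaussianLaw_id (μ := stdGaussian (Pos d))).map_fun
      ((innerSL ℝ e).prod (ContinuousLinearMap.id ℝ (Pos d) - (innerSL ℝ e).smulRight e))
  have hind : IndepFun (fun x : Pos d => innerSL ℝ e x) (fun x => x - (innerSL ℝ e x) • e)
      (stdGaussian (Pos d)) := by
    apply hXY.indepFun_of_covariance_inner
    intro x y
    have h1 : (fun ω : Pos d => (inner ℝ x (innerSL ℝ e ω) : ℝ))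
        = fun ω => inner ℝ (x • e) ω := by
      ext ω; simp [inner_smul_left, mul_comm]
    have h2 : (fun ω : Pos d => (inner ℝ y (ω - (innerSL ℝ e ω) • e) : ℝ))
        = fun ω => inner ℝ (y - (inner ℝ y e : ℝ) • e) ω := by
      ext ω; simp [inner_sub_right, inner_sub_left, inner_smul_left, inner_smul_right, mul_comm]
    rw [h1, h2, covariance_stdGaussian]
    simp [inner_sub_right, inner_smul_left, inner_smul_right, real_inner_comm, he]
    ring
  have h := (indepFun_iff_map_prod_eq_prod_map_map (by fun_prop) (by fun_prop)).1 hind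
  simp only [innerSL_apply_apply] at h
  rw [map_inner_stdGaussian he] at h
  exact h

/-- Replacing the component along `e` by its reflection coupling preserves the Gaussian law. -/
lemma map_reflected_along {e : Pos d} (he : ‖e‖ = 1) (s : ℝ) :
    ((stdGaussian (Pos d)).prod unif).map
      (fun x => reflected s (inner ℝ e x.1) x.2 • e + (x.1 - (inner ℝ e x.1 : ℝ) • e))
      = stdGaussian (Pos d) := by
  set ν := (stdGaussian (Pos d)).map fun x => x - (inner ℝ e x : ℝ) • e with hν
  have hνm : Measurable fun x : Pos d => x - (inner ℝ e x : ℝ) • e :=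
    (by fun_prop : Continuous fun x : Pos d => x - (inner ℝ e x : ℝ) • e).measurable
  have : IsProbabilityMeasure ν := Measure.isProbabilityMeasure_map hνm.aemeasurable
  have hs := map_splitAlong he
  rw [← hν] at hs
  have hsm : Measurable (splitAlong e) := (continuous_splitAlong e).measurable
  have hrec : Measurable fun z : ℝ × Pos d => z.1 • e + z.2 :=
    (by fun_prop : Continuous fun z : ℝ × Pos d => z.1 • e + z.2).measurable
  have hR : Measurable fun w : (ℝ × Pos d) × ℝ => reflected s w.1.1 w.2 • e + w.1.2 := by
    have h1 : Measurable fun w : (ℝ × Pos d) × ℝ => (reflected s w.1.1 w.2, w.1.2) :=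
      ((measurable_reflected s).comp
        ((measurable_fst.comp measurable_fst).prodMk measurable_snd)).prodMk
        (measurable_snd.comp measurable_fst)
    exact hrec.comp h1
  have hRs : Measurable fun x : Pos d × ℝ =>
      reflected s (inner ℝ e x.1) x.2 • e + (x.1 - (inner ℝ e x.1 : ℝ) • e) :=
    hR.comp ((hsm.comp measurable_fst).prodMk measurable_snd)
  apply Measure.ext_of_lintegral
  intro F hF
  rw [lintegral_map hF hRs, lintegral_prod (fun x : Pos d × ℝ =>
    F (reflected s (inner ℝ e x.1) x.2 • e + (x.1 - (inner ℝ e x.1 : ℝ) • e)))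
    (hF.comp hRs).aemeasurable]
  have hKm : Measurable fun z : ℝ × Pos d => ∫⁻ u, F (reflected s z.1 u • e + z.2) ∂unif :=
    (hF.comp hR).lintegral_prod_right'
  have h1 := lintegral_map (μ := stdGaussian (Pos d)) hKm hsm
  refine h1.symm.trans ?_
  -- Integrating over the scalar component first, with the orthogonal remainder frozen, reduces the
  -- claim to `map_reflected`.
  rw [hs, lintegral_prod_symm _ hKm.aemeasurable]
  have h2 : ∀ y : Pos d, ∫⁻ t, ∫⁻ u, F (reflected s t u • e + y) ∂unif ∂(gaussianReal 0 1)
      = ∫⁻ t, F (t • e + y) ∂(gaussianReal 0 1) := by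
    intro y
    have hFy : Measurable fun t : ℝ => F (t • e + y) :=
      hF.comp (by fun_prop : Continuous fun t : ℝ => t • e + y).measurable
    conv_rhs => rw [← map_reflected s, lintegral_map hFy (measurable_reflected s)]
    rw [lintegral_prod (fun x : ℝ × ℝ => F (reflected s x.1 x.2 • e + y))
      (hFy.comp (measurable_reflected s)).aemeasurable]
  simp_rw [h2]
  have hFr : Measurable fun z : ℝ × Pos d => F (z.1 • e + z.2) := hF.comp hrec
  rw [← lintegral_prod_symm (fun z : ℝ × Pos d => F (z.1 • e + z.2)) hFr.aemeasurable, ← hs,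
    lintegral_map hFr hsm]
  simp [splitAlong]

/-! ### The coupled increment as a one-dimensional coupling along `q` -/

variable {p : Params} {K : Matrix (Fin d) (Fin d) ℝ} {h : ℝ} {a b : Phase d}

/-- The vector `q = z + γ⁻¹ w`. -/
def qvec (p : Params) (a b : Phase d) : Pos d := (a.1 - b.1) + p.γ⁻¹ • (a.2 - b.2)

lemma coupledNoise_far (hfar : DK p K + eps p * rl p K a b ≤ rs p a b) (ξ : Pos d) (u : ℝ) :
    coupledNoise p K h a b ξ u = ξ := by
  simp only [coupledNoise, if_pos hfar]

lemma coupledNoise_zero (hq : qvec p a b = 0) (ξ : Pos d) (u : ℝ) :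
    coupledNoise p K h a b ξ u = ξ := by
  have hq' : (a.1 - b.1) + p.γ⁻¹ • (a.2 - b.2) = 0 := hq
  simp only [coupledNoise, hq']
  split_ifs <;> simp

/-- The direction of `q`. -/
def evec (p : Params) (a b : Phase d) : Pos d := ‖qvec p a b‖⁻¹ • qvec p a b

lemma norm_evec (hq : qvec p a b ≠ 0) : ‖evec p a b‖ = 1 := by
  rw [evec, norm_smul, norm_inv, norm_norm, inv_mul_cancel₀ (norm_ne_zero_iff.2 hq)]

lemma qvec_eq_smul (hq : qvec p a b ≠ 0) : qvec p a b = ‖qvec p a b‖ • evec p a b := by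
  rw [evec, smul_smul, mul_inv_cancel₀ (norm_ne_zero_iff.2 hq), one_smul]

/-- Both branches change `ξ` only along the direction of `q`, so in dimension `d` the coupling is
the scalar one with shift `β|q|`. -/
lemma coupledNoise_near (hnear : ¬ DK p K + eps p * rl p K a b ≤ rs p a b)
    (hq : qvec p a b ≠ 0) (ξ : Pos d) (u : ℝ) :
    coupledNoise p K h a b ξ u
      = reflected (1 / Real.sqrt (2 * p.γ⁻¹ * h) * ‖qvec p a b‖) (inner ℝ (evec p a b) ξ) u
          • evec p a b + (ξ - (inner ℝ (evec p a b) ξ : ℝ) • evec p a b) := by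
  have h1 : coupledNoise p K h a b ξ u
      = if u ≤ npdf (inner ℝ (evec p a b) ξ + 1 / Real.sqrt (2 * p.γ⁻¹ * h) * ‖qvec p a b‖)
          / npdf (inner ℝ (evec p a b) ξ)
        then ξ + (1 / Real.sqrt (2 * p.γ⁻¹ * h)) • qvec p a b
        else ξ - (2 * inner ℝ (evec p a b) ξ) • evec p a b := by
    simp only [coupledNoise, if_neg hnear]
    rfl
  rw [h1, reflected]
  split_ifs
  · nth_rw 1 [qvec_eq_smul hq]
    module
  · module

/-- The second increment is standard normal. -/
theorem map_coupledNoise (p : Params) (K : Matrix (Fin d) (Fin d) ℝ) (h : ℝ) (a b : Phase d) :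
    ((stdGaussian (Pos d)).prod unif).map (fun x => coupledNoise p K h a b x.1 x.2)
      = stdGaussian (Pos d) := by
  have hfst : ((stdGaussian (Pos d)).prod unif).map (fun x => x.1) = stdGaussian (Pos d) := by
    rw [← Measure.fst, Measure.fst_prod]
  by_cases hfar : DK p K + eps p * rl p K a b ≤ rs p a b
  · simp_rw [coupledNoise_far hfar]; exact hfst
  by_cases hq : qvec p a b = 0
  · simp_rw [coupledNoise_zero hq]; exact hfst
  · simp_rw [coupledNoise_near hfar hq]
    exact map_reflected_along (norm_evec hq) _

/-- After one contractive step, without the drift, the length of `q` is the residual. -/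
lemma norm_reflected_step (hnear : ¬ DK p K + eps p * rl p K a b ≤ rs p a b)
    (hq : qvec p a b ≠ 0) {σ : ℝ} (hσ : 0 < σ) (hσ2 : σ = Real.sqrt (2 * p.γ⁻¹ * h))
    (ξ : Pos d) (u : ℝ) :
    ‖qvec p a b + σ • (ξ - coupledNoise p K h a b ξ u)‖
      = residual σ ‖qvec p a b‖ (inner ℝ (evec p a b) ξ) u := by
  rw [coupledNoise_near hnear hq, ← hσ2, one_div_mul_eq_div, reflected, residual]
  have h1 := norm_evec hq
  split_ifs with h2
  · have : qvec p a b + σ • (ξ - (((inner ℝ (evec p a b) ξ : ℝ) + ‖qvec p a b‖ / σ) • evec p a b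
        + (ξ - (inner ℝ (evec p a b) ξ : ℝ) • evec p a b))) = 0 := by
      nth_rw 1 [qvec_eq_smul hq]
      have : σ * (‖qvec p a b‖ / σ) = ‖qvec p a b‖ := by field_simp
      nth_rw 1 [← this]
      module
    rw [this, norm_zero]
  · have : qvec p a b + σ • (ξ - ((-(inner ℝ (evec p a b) ξ : ℝ)) • evec p a b
        + (ξ - (inner ℝ (evec p a b) ξ : ℝ) • evec p a b)))
        = (‖qvec p a b‖ + 2 * σ * inner ℝ (evec p a b) ξ) • evec p a b := by
      nth_rw 1 [qvec_eq_smul hq]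
      module
    rw [this, norm_smul, h1, mul_one, Real.norm_eq_abs]

end

end

section

/-! ### The quadratic part of the potential -/

section

variable {d : ℕ} {p : Params} {K : Matrix (Fin d) (Fin d) ℝ} {U G : Pos d → ℝ}

/-- Spectral bounds for the map `x ↦ K x`. -/
structure Spectral (p : Params) (K : Matrix (Fin d) (Fin d) ℝ) : Prop where
  symm : ∀ x y : Pos d, (inner ℝ (act K x) y : ℝ) = inner ℝ x (act K y)
  lower : ∀ z : Pos d, p.κ * ‖z‖ ^ 2 ≤ inner ℝ z (act K z)
  upper : ∀ z : Pos d, inner ℝ z (act K z) ≤ p.LK * ‖z‖ ^ 2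
  norm_sq_le : ∀ z : Pos d, ‖act K z‖ ^ 2 ≤ p.LK * inner ℝ z (act K z)
  exists_min : ∃ e : Pos d, ‖e‖ = 1 ∧ inner ℝ e (act K e) = p.κ
  exists_max : ∃ e : Pos d, ‖e‖ = 1 ∧ inner ℝ e (act K e) = p.LK
  root : ∃ N : Pos d →L[ℝ] Pos d, ∀ z, (inner ℝ z (act K z) : ℝ) = ‖N z‖ ^ 2

lemma exists_unit_norm_eq {E F : Type*} [NormedAddCommGroup E] [NormedSpace ℝ E]
    [FiniteDimensional ℝ E] [Nontrivial E] [NormedAddCommGroup F] [NormedSpace ℝ F] (N : E →L[ℝ] F) :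
    ∃ e : E, ‖e‖ = 1 ∧ ‖N e‖ = ‖N‖ := by
  obtain ⟨x₀, hx₀⟩ := NormedSpace.sphere_nonempty (E := E) (x := 0) (r := 1) |>.2 zero_le_one
  have : ProperSpace E := FiniteDimensional.proper ℝ E
  obtain ⟨e, he, hmax⟩ := (isCompact_sphere (0 : E) 1).exists_isMaxOn ⟨x₀, hx₀⟩
    (N.continuous.norm.continuousOn)
  have he1 : ‖e‖ = 1 := by simpa using he
  refine ⟨e, he1, le_antisymm (by simpa [he1] using N.le_opNorm e) ?_⟩
  refine N.opNorm_le_bound (norm_nonneg _) fun x => ?_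
  rcases eq_or_ne x 0 with rfl | hx
  · simp
  have h1 : ‖x‖⁻¹ • x ∈ Metric.sphere (0 : E) 1 := by
    simp [norm_smul, inv_mul_cancel₀ (norm_ne_zero_iff.2 hx)]
  have h2 : ‖N (‖x‖⁻¹ • x)‖ ≤ ‖N e‖ := hmax h1
  rw [map_smul, norm_smul, norm_inv, norm_norm, inv_mul_le_iff₀ (norm_pos_iff.2 hx)] at h2
  linarith

-- A factorisation `K = NᵀN` turns `z · Kz` into `|Nz|²`, and `‖N‖² = L_K`. The upper bounds then
-- follow from the operator norm, and a unit vector attaining `‖N‖` attains `L_K`. The lower bound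
-- holds because the infimum of the Rayleigh quotient is an eigenvalue.
open scoped MatrixOrder in
theorem Splitting.spectral (hS : Splitting p U K G) : Spectral p K := by
  obtain ⟨B, hB⟩ := CStarAlgebra.nonneg_iff_eq_star_mul_self.1 hS.posDef.posSemidef.nonneg
  set N : Pos d →L[ℝ] Pos d := act B with hN
  have hact : act K = ContinuousLinearMap.adjoint N * N := by
    rw [hB, act, map_mul, map_star]; rfl
  have hinner : ∀ x y : Pos d, (inner ℝ x (act K y) : ℝ) = inner ℝ (N x) (N y) := by
    intro x y
    rw [hact, mul_apply_eq_comp, ContinuousLinearMap.adjoint_inner_right]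
  have hroot : ∀ z : Pos d, (inner ℝ z (act K z) : ℝ) = ‖N z‖ ^ 2 := by
    intro z; rw [hinner, real_inner_self_eq_norm_sq]
  have hsymm : ∀ x y : Pos d, (inner ℝ (act K x) y : ℝ) = inner ℝ x (act K y) := by
    intro x y; rw [real_inner_comm, hinner, hinner, real_inner_comm]
  have hnorm : ‖N‖ * ‖N‖ = p.LK := by
    rw [← hS.norm_eq, hact, ← ContinuousLinearMap.norm_adjoint_comp_self]; rfl
  have heig : ∀ {μ : ℝ} {v : Pos d}, v ≠ 0 → act K v = μ • v →
      Module.End.HasEigenvalue (Matrix.toLin' K) μ := by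
    intro μ v hv hvμ
    refine Module.End.hasEigenvalue_of_hasEigenvector (x := v.ofLp) ⟨?_, ?_⟩
    · rw [Module.End.mem_eigenspace_iff]
      have := congrArg WithLp.ofLp hvμ
      simpa [Matrix.ofLp_toEuclideanCLM] using this
    · intro h0
      exact hv (by ext i; exact congrFun h0 i)
  obtain ⟨v, hv⟩ := hS.smallest_eigenvalue.1.exists_hasEigenvector
  have hv0 : (WithLp.toLp 2 v : Pos d) ≠ 0 := fun h0 => hv.2 (by simpa using congrArg WithLp.ofLp h0)
  -- The assumed eigenvalue `κ` has an eigenvector, so the dimension cannot be `0`.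
  have : Nontrivial (Pos d) := ⟨⟨_, _, hv0⟩⟩
  have hvK : act K (WithLp.toLp 2 v : Pos d) = p.κ • (WithLp.toLp 2 v : Pos d) := by
    have h := hv.apply_eq_smul
    rw [Matrix.toLin'_apply] at h
    rw [act, Matrix.toEuclideanCLM_toLp, h]; rfl
  refine ⟨hsymm, ?_, ?_, ?_, ?_, ?_, ⟨N, hroot⟩⟩
  · have hsym : ((act K : Pos d →L[ℝ] Pos d) : Pos d →ₗ[ℝ] Pos d).IsSymmetric := hsymm
    have h := hsym.hasEigenvalue_iInf_of_finiteDimensional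
    obtain ⟨w, hw⟩ := h.exists_hasEigenvector
    have hκ := hS.smallest_eigenvalue.2 (heig hw.2 hw.apply_eq_smul)
    intro z
    rcases eq_or_ne z 0 with rfl | hz
    · simp
    have hbdd : BddBelow (Set.range fun x : {x : Pos d // x ≠ 0} =>
        RCLike.re (inner ℝ (((act K : Pos d →L[ℝ] Pos d) : Pos d →ₗ[ℝ] Pos d) x) (x : Pos d))
          / ‖(x : Pos d)‖ ^ 2) := by
      refine ⟨0, ?_⟩
      rintro _ ⟨x, rfl⟩
      have : (0 : ℝ) ≤ inner ℝ (act K x.1) x.1 := by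
        rw [hsymm, hroot]; positivity
      exact div_nonneg this (by positivity)
    have h2 := hκ.trans (ciInf_le hbdd ⟨z, hz⟩)
    have hz2 : 0 < ‖z‖ ^ 2 := by have := norm_pos_iff.2 hz; positivity
    have h3 := (le_div_iff₀ hz2).1 h2
    refine h3.trans_eq ?_
    exact hsymm z z
  · intro z
    rw [hroot, ← hnorm]
    have := N.le_opNorm z
    have h0 := norm_nonneg (N z)
    nlinarith
  · intro z
    rw [hroot, ← hnorm, hact, mul_apply_eq_comp]
    have h1 := (ContinuousLinearMap.adjoint N).le_opNorm (N z)
    rw [LinearIsometryEquiv.norm_map] at h1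
    have h0 := norm_nonneg (ContinuousLinearMap.adjoint N (N z))
    nlinarith
  · refine ⟨‖(WithLp.toLp 2 v : Pos d)‖⁻¹ • WithLp.toLp 2 v, ?_, ?_⟩
    · rw [norm_smul, norm_inv, norm_norm, inv_mul_cancel₀ (norm_ne_zero_iff.2 hv0)]
    · rw [map_smul, hvK, inner_smul_left, inner_smul_right, inner_smul_right,
        real_inner_self_eq_norm_sq]
      have := norm_ne_zero_iff.2 hv0
      simp only [conj_trivial]
      field_simp
  · obtain ⟨e, he, heN⟩ := exists_unit_norm_eq N
    exact ⟨e, he, by rw [hroot, heN, ← hnorm, sq]⟩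

/-- The gradient of `U` splits into `K x` and the gradient of `G`. -/
theorem Splitting.gradient_eq (hU : Differentiable ℝ U) (hS : Splitting p U K G) (x : Pos d) :
    ∇ U x = act K x + ∇ G x := by
  have hsymm := hS.spectral.symm
  have h1 : HasFDerivAt (fun y : Pos d => (1 / 2 : ℝ) * inner ℝ y (act K y))
      (innerSL ℝ (act K x)) x := by
    have h := ((hasFDerivAt_id x).inner ℝ (act K).hasFDerivAt).const_mul (1 / 2 : ℝ)
    refine h.congr_fderiv ?_
    ext y
    simp [fderivInnerCLM_apply, real_inner_comm]
    have hc : (inner ℝ x (act K y) : ℝ) = inner ℝ y (act K x) := by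
      rw [← hsymm x y, real_inner_comm]
    rw [hc]
    ring
  have h2 : HasGradientAt (fun y : Pos d => (1 / 2 : ℝ) * inner ℝ y (act K y)) (act K x) x := h1
  have hG : G = fun y => U y - 1 / 2 * inner ℝ y (act K y) := by
    ext y; rw [hS.split y]; ring
  have h3 : HasGradientAt G (∇ U x - act K x) x := by
    rw [hG, hasGradientAt_iff_hasFDerivAt, map_sub]
    exact (hU x).hasGradientAt.hasFDerivAt.sub h2.hasFDerivAt
  rw [h3.gradient]
  abel

/-- Inequalities between the scalar parameters. -/
structure ParamBounds (p : Params) : Prop where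
  γ_pos : 0 < p.γ
  κ_pos : 0 < p.κ
  κ_le_LK : p.κ ≤ p.LK
  L_pos : 0 < p.L
  LG_nonneg : 0 ≤ p.LG
  LG_le : 16 * p.LG ^ 2 ≤ p.γ ^ 2 * p.κ

theorem Splitting.paramBounds (hγ : 0 < p.γ) (hγG : 4 * p.LG / Real.sqrt p.κ ≤ p.γ)
    (hU : PotentialAssumption p U) (hS : Splitting p U K G) : ParamBounds p := by
  have hSp := hS.spectral
  have hκ := hU.κ_pos
  obtain ⟨e, he, heK⟩ := hSp.exists_min
  have hLG : 0 ≤ p.LG := by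
    have h := (norm_nonneg _).trans (hS.lipschitz e 0)
    simpa [he] using h
  refine ⟨hγ, hκ, ?_, ?_, hLG, ?_⟩
  · have := hSp.upper e
    rw [heK, he] at this
    linarith
  -- On a pair of points at distance `R + 1` strong convexity and the Lipschitz bound both apply, so
  -- `0 < κ ≤ L`.
  · set t := p.R + 1 with ht
    have ht0 : 0 < t := by have := hU.R_nonneg; linarith
    have hn : ‖t • e - 0‖ = t := by rw [sub_zero, norm_smul, he, mul_one, Real.norm_of_nonneg ht0.le]
    have h1 := hU.strongly_convex_outside (t • e) 0 (by rw [hn]; linarith)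
    have h2 := real_inner_le_norm (∇ U (t • e) - ∇ U 0) (t • e - 0)
    have h3 := hU.lipschitz (t • e) 0
    rw [hn] at h1 h2 h3
    have h4 := mul_le_mul_of_nonneg_right h3 ht0.le
    have h5 : p.κ * t ^ 2 ≤ p.L * t ^ 2 := by linarith
    exact hκ.trans_le (le_of_mul_le_mul_right h5 (by positivity))
  · have hs : 0 < Real.sqrt p.κ := Real.sqrt_pos.2 hκ
    rw [div_le_iff₀ hs] at hγG
    calc 16 * p.LG ^ 2 = (4 * p.LG) ^ 2 := by ring
      _ ≤ (p.γ * Real.sqrt p.κ) ^ 2 := by gcongr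
      _ = _ := by rw [mul_pow, Real.sq_sqrt hκ.le]

end

end

section

/-! ### The semimetrics `r_s` and `r_l` -/

section

variable {d : ℕ} {p : Params} {K : Matrix (Fin d) (Fin d) ℝ}

lemma tau_le (p : Params) : tau p ≤ 1 / 8 := min_le_left _ _

lemma tau_le' (p : Params) : 4 * tau p ≤ p.γ⁻¹ ^ 2 * p.κ := by
  have h : tau p ≤ p.γ⁻¹ ^ 2 * p.κ / 4 := min_le_right _ _
  linarith

lemma two_eps_le_one (p : Params) : 2 * eps p ≤ 1 := by
  have h : min 1 (min (2 * alpha p / (3 * Real.sqrt p.LK * p.γ⁻¹)) (alpha p)) ≤ 1 := min_le_left _ _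
  unfold eps; linarith

lemma two_eps_le_alpha (p : Params) : 2 * eps p ≤ alpha p := by
  have h : min 1 (min (2 * alpha p / (3 * Real.sqrt p.LK * p.γ⁻¹)) (alpha p)) ≤ alpha p :=
    (min_le_right _ _).trans (min_le_right _ _)
  unfold eps; linarith

namespace ParamBounds

variable (H : ParamBounds p)
include H

lemma LK_pos : 0 < p.LK := H.κ_pos.trans_le H.κ_le_LK

lemma inv_pos : 0 < p.γ⁻¹ := _root_.inv_pos.2 H.γ_pos

lemma alpha_pos : 0 < alpha p := by
  have := H.L_pos; have := H.inv_pos; unfold alpha; positivity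

lemma tau_pos : 0 < tau p := by
  have := H.κ_pos; have := H.inv_pos
  exact lt_min (by norm_num) (by positivity)

lemma eps_pos : 0 < eps p := by
  have := H.alpha_pos; have := H.inv_pos
  have := Real.sqrt_pos.2 H.LK_pos
  have h : 0 < min 1 (min (2 * alpha p / (3 * Real.sqrt p.LK * p.γ⁻¹)) (alpha p)) :=
    lt_min one_pos (lt_min (by positivity) H.alpha_pos)
  unfold eps; linarith

lemma eps_sq_LK : (2 * eps p) ^ 2 * (p.γ⁻¹ ^ 2 * p.LK) ≤ 4 / 9 * alpha p ^ 2 := by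
  have h : 2 * eps p ≤ 2 * alpha p / (3 * Real.sqrt p.LK * p.γ⁻¹) := by
    have : min 1 (min (2 * alpha p / (3 * Real.sqrt p.LK * p.γ⁻¹)) (alpha p))
        ≤ 2 * alpha p / (3 * Real.sqrt p.LK * p.γ⁻¹) := (min_le_right _ _).trans (min_le_left _ _)
    unfold eps; linarith
  have hs := Real.sqrt_pos.2 H.LK_pos
  have hγ := H.inv_pos
  have he := H.eps_pos
  rw [le_div_iff₀ (by positivity)] at h
  have h2 : (2 * eps p * (3 * Real.sqrt p.LK * p.γ⁻¹)) ^ 2 ≤ (2 * alpha p) ^ 2 := by gcongr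
  have h3 : Real.sqrt p.LK ^ 2 = p.LK := Real.sq_sqrt H.LK_pos.le
  have h4 : (2 * eps p * (3 * Real.sqrt p.LK * p.γ⁻¹)) ^ 2
      = 9 * ((2 * eps p) ^ 2 * (p.γ⁻¹ ^ 2 * Real.sqrt p.LK ^ 2)) := by ring
  rw [h4, h3] at h2
  linarith

lemma calR_nonneg : 0 ≤ calR p := by
  have := H.tau_pos; have := H.LG_nonneg; unfold calR; positivity

lemma calE_pos : 0 < calE p := by
  have := H.alpha_pos; have := H.inv_pos; have := Real.sqrt_pos.2 H.κ_pos
  exact lt_min (by positivity) (by norm_num)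

end ParamBounds

/-- The quadratic form `r_l²` in terms of `|z|`, `|q|`, `q · z` and `z · K z`. -/
lemma rl_sq_aux (p : Params) (z w : Pos d) (k : ℝ) :
    p.γ⁻¹ ^ 2 * k + 1 / 2 * ‖(1 - 2 * tau p) • z + p.γ⁻¹ • w‖ ^ 2 + 1 / 2 * p.γ⁻¹ ^ 2 * ‖w‖ ^ 2
      = p.γ⁻¹ ^ 2 * k + ‖z + p.γ⁻¹ • w‖ ^ 2 - (1 + 2 * tau p) * inner ℝ (z + p.γ⁻¹ • w) z
        + (1 / 2 + 2 * tau p ^ 2) * ‖z‖ ^ 2 := by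
  simp only [norm_add_sq_real, inner_add_left, real_inner_smul_left, real_inner_smul_right,
    norm_smul, real_inner_self_eq_norm_sq, real_inner_comm z w, mul_pow, Real.norm_eq_abs, sq_abs]
  ring

lemma rl_sq_nonneg (hS : Spectral p K) (H : ParamBounds p) (z w : Pos d) :
    0 ≤ p.γ⁻¹ ^ 2 * inner ℝ z (act K z) + 1 / 2 * ‖(1 - 2 * tau p) • z + p.γ⁻¹ • w‖ ^ 2
      + 1 / 2 * p.γ⁻¹ ^ 2 * ‖w‖ ^ 2 := by
  have h1 : 0 ≤ inner ℝ z (act K z) := by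
    have := H.κ_pos
    exact le_trans (by positivity) (hS.lower z)
  positivity

lemma rl_sq (hS : Spectral p K) (H : ParamBounds p) (a b : Phase d) :
    rl p K a b ^ 2 = p.γ⁻¹ ^ 2 * inner ℝ (a.1 - b.1) (act K (a.1 - b.1)) + ‖qvec p a b‖ ^ 2
      - (1 + 2 * tau p) * inner ℝ (qvec p a b) (a.1 - b.1)
      + (1 / 2 + 2 * tau p ^ 2) * ‖a.1 - b.1‖ ^ 2 := by
  rw [rl, Real.sq_sqrt (rl_sq_nonneg hS H _ _), rl_sq_aux p _ _ _]
  rfl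

lemma rl_nonneg (p : Params) (K : Matrix (Fin d) (Fin d) ℝ) (a b : Phase d) : 0 ≤ rl p K a b :=
  Real.sqrt_nonneg _

lemma rs_eq (p : Params) (a b : Phase d) :
    rs p a b = alpha p * ‖a.1 - b.1‖ + ‖qvec p a b‖ := rfl

lemma rs_nonneg (H : ParamBounds p) (a b : Phase d) : 0 ≤ rs p a b := by
  have := H.alpha_pos; unfold rs; positivity

/-- The three entries of the minimum in `ε` serve the three kinds of terms. After them the
coefficient of `α²A²` is at most `4/9 + 17/32 < 1`, and that of `αAB` is at most `5/4 < 2`. -/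
lemma two_eps_sq_bound (H : ParamBounds p) {A B C k : ℝ} (hA : 0 ≤ A) (hB : 0 ≤ B)
    (hC : |C| ≤ A * B) (hk : k ≤ p.LK * A ^ 2) :
    (2 * eps p) ^ 2 * (p.γ⁻¹ ^ 2 * k + B ^ 2 - (1 + 2 * tau p) * C
      + (1 / 2 + 2 * tau p ^ 2) * A ^ 2) ≤ (alpha p * A + B) ^ 2 := by
  have hα := H.alpha_pos
  have he := H.eps_pos
  have hτ := H.tau_pos
  have hτ8 := (tau_le p)
  have h1 : (2 * eps p) ^ 2 * (p.γ⁻¹ ^ 2 * k) ≤ 4 / 9 * alpha p ^ 2 * A ^ 2 := by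
    calc (2 * eps p) ^ 2 * (p.γ⁻¹ ^ 2 * k) ≤ (2 * eps p) ^ 2 * (p.γ⁻¹ ^ 2 * (p.LK * A ^ 2)) := by
          gcongr
      _ = (2 * eps p) ^ 2 * (p.γ⁻¹ ^ 2 * p.LK) * A ^ 2 := by ring
      _ ≤ _ := mul_le_mul_of_nonneg_right H.eps_sq_LK (sq_nonneg A)
  have h2 : (2 * eps p) ^ 2 ≤ 1 := by nlinarith [(two_eps_le_one p)]
  have h3 : (2 * eps p) ^ 2 ≤ alpha p := by nlinarith [(two_eps_le_one p), (two_eps_le_alpha p)]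
  have h4 : (2 * eps p) ^ 2 ≤ alpha p ^ 2 := by gcongr; exact (two_eps_le_alpha p)
  have hAB : 0 ≤ A * B := mul_nonneg hA hB
  have h5 : -((1 + 2 * tau p) * C) ≤ 5 / 4 * (A * B) := by
    have := (abs_le.1 hC).1
    nlinarith
  have h6 : (1 / 2 + 2 * tau p ^ 2) ≤ 17 / 32 := by nlinarith
  have h7 : (2 * eps p) ^ 2 * B ^ 2 ≤ 1 * B ^ 2 := by gcongr
  have h8 : (2 * eps p) ^ 2 * (5 / 4 * (A * B)) ≤ alpha p * (5 / 4 * (A * B)) := by gcongr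
  have h9 : (2 * eps p) ^ 2 * ((1 / 2 + 2 * tau p ^ 2) * A ^ 2) ≤ alpha p ^ 2 * (17 / 32 * A ^ 2) := by
    gcongr
  have h10 := mul_le_mul_of_nonneg_left h5 (sq_nonneg (2 * eps p))
  have h11 : 0 ≤ alpha p * (A * B) := by positivity
  have h12 : 0 ≤ alpha p ^ 2 * A ^ 2 := by positivity
  nlinarith

lemma abs_inner_qvec_le (p : Params) (a b : Phase d) :
    |inner ℝ (qvec p a b) (a.1 - b.1)| ≤ ‖a.1 - b.1‖ * ‖qvec p a b‖ := by
  rw [mul_comm]; exact abs_real_inner_le_norm _ _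

lemma two_eps_rl_le (hS : Spectral p K) (H : ParamBounds p) (a b : Phase d) :
    2 * (eps p * rl p K a b) ≤ rs p a b := by
  have h := two_eps_sq_bound H (norm_nonneg (a.1 - b.1)) (norm_nonneg (qvec p a b))
    (abs_inner_qvec_le p a b) (hS.upper (a.1 - b.1))
  rw [← rl_sq hS H a b, ← rs_eq, ← mul_pow] at h
  have := abs_le_of_sq_le_sq h (rs_nonneg H a b)
  linarith [le_abs_self (2 * eps p * rl p K a b)]

lemma half_rs_le_Del (hS : Spectral p K) (H : ParamBounds p) (a b : Phase d) :
    rs p a b / 2 ≤ Del p K a b := by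
  have := two_eps_rl_le hS H a b
  unfold Del; linarith

/-- With `X` the position part of the bound, `(X + B/2)² ≤ 2X² + B²/2`. The rest of `r_l²` contains
the square of `B - (1 + 2τ)A` up to `2τA²`, which `4τ ≤ γ⁻²κ` absorbs into the quadratic part. -/
lemma calE_rs_le (hS : Spectral p K) (H : ParamBounds p) (a b : Phase d) :
    calE p * rs p a b ≤ rl p K a b := by
  have hα := H.alpha_pos
  have hγ := H.inv_pos
  have hκ := Real.sqrt_pos.2 H.κ_pos
  have hτ := H.tau_pos
  have hτ8 := (tau_le p)
  have hτκ := (tau_le' p)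
  set A := ‖a.1 - b.1‖ with hA
  set B := ‖qvec p a b‖ with hB
  have hA0 : 0 ≤ A := norm_nonneg _
  have hB0 : 0 ≤ B := norm_nonneg _
  have h1 : calE p * rs p a b ≤ Real.sqrt p.κ * p.γ⁻¹ / Real.sqrt 8 * A + B / 2 := by
    have h2 : calE p * (alpha p * A)
        ≤ Real.sqrt p.κ * p.γ⁻¹ / (Real.sqrt 8 * alpha p) * (alpha p * A) := by
      gcongr; exact min_le_left _ _
    have h3 : calE p * B ≤ 1 / 2 * B := by
      gcongr; exact min_le_right _ _
    have h4 : Real.sqrt p.κ * p.γ⁻¹ / (Real.sqrt 8 * alpha p) * (alpha p * A)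
        = Real.sqrt p.κ * p.γ⁻¹ / Real.sqrt 8 * A := by
      field_simp
    rw [rs_eq, mul_add]
    linarith
  refine h1.trans ((le_abs_self _).trans (abs_le_of_sq_le_sq ?_ (rl_nonneg _ _ _ _)))
  rw [rl_sq hS H, ← hA, ← hB]
  set X := Real.sqrt p.κ * p.γ⁻¹ / Real.sqrt 8 * A with hX
  have hX2 : X ^ 2 = p.γ⁻¹ ^ 2 * p.κ * A ^ 2 / 8 := by
    rw [hX, mul_pow, div_pow, mul_pow, Real.sq_sqrt H.κ_pos.le, Real.sq_sqrt (by norm_num)]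
    ring
  have hk : p.γ⁻¹ ^ 2 * (p.κ * A ^ 2) ≤ p.γ⁻¹ ^ 2 * inner ℝ (a.1 - b.1) (act K (a.1 - b.1)) := by
    gcongr; exact hS.lower _
  have hC := (abs_le.1 (abs_inner_qvec_le p a b)).2
  rw [← hA, ← hB] at hC
  have hC' := mul_le_mul_of_nonneg_left hC (by linarith : 0 ≤ 1 + 2 * tau p)
  have h5 : 4 * tau p * A ^ 2 ≤ p.γ⁻¹ ^ 2 * p.κ * A ^ 2 := by gcongr
  nlinarith [sq_nonneg (X - B / 2), sq_nonneg (B - (1 + 2 * tau p) * A)]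

/-! ### Contraction of `r_l` under the synchronous coupling -/

/-- The terms of first order in the step size. -/
lemma quadratic_first_order {τ κ a c e k zG yG gG N : ℝ}
    (hτ : 0 < τ) (hτ8 : τ ≤ 1 / 8) (hτκ : 4 * τ ≤ κ)
    (ha : 0 ≤ a) (he : 0 ≤ e) (hk : κ * a ≤ k)
    (hgG : 16 * gG ≤ κ * a) (hyG : -(2 * yG) ≤ e / 2 + 2 * gG)
    (hzG : -zG ≤ τ * (κ * a + 1 / 2 * (a + 2 * c + e) + 1 / 2 * e))
    (hN : N = k + 1 / 2 * ((1 - 2 * τ) ^ 2 * a + 2 * (1 - 2 * τ) * c + e) + 1 / 2 * e) :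
    (1 - 2 * τ) ^ 2 * c - (1 - 2 * τ) * c - (1 - 2 * τ) * (k + zG) + (1 - 2 * τ) * e
      - 2 * e - 2 * yG + τ * N ≤ -(13 / 64 * k) - e / 2 := by
  have hκ0 : 0 < κ := by linarith
  have hk0 : 0 ≤ k := le_trans (by positivity) hk
  have hT : 0 ≤ 1 - 2 * τ := by linarith
  -- The form defining `𝒦` has `κ` in place of `K` and no `τ` inside, so it is compared with `r_l²`
  -- up to a term of order `τa`.
  have hQ : (1 - 2 * τ) * (κ * a + 1 / 2 * (a + 2 * c + e) + 1 / 2 * e)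
      ≤ N + τ * (1 - 2 * τ) * a := by
    have h1 : 0 ≤ τ * (κ * a) := by positivity
    have h2 : 0 ≤ τ * e := by positivity
    rw [hN]
    linarith
  have hzG' := mul_le_mul_of_nonneg_left hzG hT
  have hQ' := mul_le_mul_of_nonneg_left hQ hτ.le
  -- Without the non-convexity the quadratic part would decay at rate `2τ`. The bound `hzG` uses up
  -- one `τ` through `hQ`, and the rate `τ` remains.
  have h1 : (1 - 2 * τ) ^ 2 * c - (1 - 2 * τ) * c - (1 - 2 * τ) * (k + zG) + (1 - 2 * τ) * e
      - 2 * e - 2 * yG + 2 * τ * N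
      = τ * (1 - 2 * τ) ^ 2 * a - (1 - 4 * τ) * k - e - (1 - 2 * τ) * zG - 2 * yG := by
    rw [hN]; ring
  have h2 : τ * a ≤ k / 4 := by
    have := mul_le_mul_of_nonneg_right hτκ ha
    linarith
  have h3 : τ * (1 - 2 * τ) ^ 2 * a ≤ (1 - 2 * τ) ^ 2 * (k / 4) := by
    have := mul_le_mul_of_nonneg_left h2 (sq_nonneg (1 - 2 * τ))
    linarith
  have h4 : τ * (τ * (1 - 2 * τ) * a) ≤ k / 32 := by
    have h5 : τ * (1 - 2 * τ) ≤ 1 / 8 := by nlinarith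
    have := mul_le_mul h5 h2 (by positivity) (by norm_num)
    linarith
  have h6 : (1 - 2 * τ) ^ 2 * (k / 4) - (1 - 4 * τ) * k + k / 8 + k / 32 ≤ -(13 / 64 * k) := by
    have h7 : (1 - 2 * τ) ^ 2 / 4 - (1 - 4 * τ) + 1 / 8 + 1 / 32 + 13 / 64 ≤ 0 := by nlinarith
    have := mul_le_mul_of_nonneg_right h7 hk0
    linarith
  linarith

/-- The terms of second order in the step size. -/
lemma quadratic_second_order {s τ κ L a e k n yg gg gG kk : ℝ}
    (hs : 0 < s) (hs8 : s ≤ 1 / 8) (hτ : 0 < τ) (hτ8 : τ ≤ 1 / 8)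
    (he : 0 ≤ e) (hk : κ * a ≤ k) (hk0 : 0 ≤ k) (hn : n ≤ L * e) (hsL : s * L ≤ 1 / 32)
    (hgG : 16 * gG ≤ κ * a) (hkk : kk ≤ L * k)
    (hgg : gg ≤ 2 * kk + 2 * gG) (hyg : |yg| * (5 / 4) ≤ gg + 25 / 64 * e) :
    s * (n + 1 / 2 * (1 - 2 * τ) ^ 2 * e - (1 - 2 * τ) * (e + yg) + e + 2 * yg + gg)
      ≤ 10 / 64 * k + e / 4 := by
  have h1 : s * n ≤ e / 32 := by
    have h2 := mul_le_mul_of_nonneg_left hn hs.le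
    have h3 := mul_le_mul_of_nonneg_right hsL he
    linarith
  have h2 : s * gg ≤ 5 / 64 * k := by
    have h3 := mul_le_mul_of_nonneg_left hgg hs.le
    have h4 := mul_le_mul_of_nonneg_left hkk hs.le
    have h5 := mul_le_mul_of_nonneg_right hsL hk0
    have h6 : s * gG ≤ 1 / 128 * k := by
      have h7 : gG ≤ k / 16 := by linarith
      have h8 := mul_le_mul_of_nonneg_left h7 hs.le
      have h9 := mul_le_mul_of_nonneg_right hs8 hk0
      linarith
    linarith
  have h3 : (1 + 2 * τ) * yg ≤ gg + 25 / 64 * e := by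
    refine le_trans ?_ hyg
    calc (1 + 2 * τ) * yg ≤ (1 + 2 * τ) * |yg| := by gcongr; exact le_abs_self _
      _ ≤ 5 / 4 * |yg| := by gcongr; linarith
      _ = _ := by ring
  have h4 := mul_le_mul_of_nonneg_left h3 hs.le
  have h5 : 1 / 2 * (1 - 2 * τ) ^ 2 * e - (1 - 2 * τ) * e + e ≤ 17 / 32 * e := by
    have h7 : 1 / 2 * (1 - 2 * τ) ^ 2 - (1 - 2 * τ) + 1 - 17 / 32 ≤ 0 := by nlinarith
    have := mul_le_mul_of_nonneg_right h7 he
    linarith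
  have h6 := mul_le_mul_of_nonneg_left h5 hs.le
  have h7 := mul_le_mul_of_nonneg_right hs8 he
  linarith

/-- The dimensionless form of the contraction of `r_l²`. -/
lemma quadratic_contraction {s τ κ L a c e k m n zG yG yg gg gG kk : ℝ}
    (hs : 0 < s) (hs8 : s ≤ 1 / 8) (hτ : 0 < τ) (hτ8 : τ ≤ 1 / 8) (hτκ : 4 * τ ≤ κ)
    (ha : 0 ≤ a) (he : 0 ≤ e) (hk : κ * a ≤ k) (hn : n ≤ L * e) (hsL : s * L ≤ 1 / 32)
    (hgG : 16 * gG ≤ κ * a) (hyG : -(2 * yG) ≤ e / 2 + 2 * gG) (hkk : kk ≤ L * k)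
    (hgg : gg ≤ 2 * kk + 2 * gG) (hyg : |yg| * (5 / 4) ≤ gg + 25 / 64 * e)
    (hygm : yg = m + yG)
    (hzG : -zG ≤ τ * (κ * a + 1 / 2 * (a + 2 * c + e) + 1 / 2 * e)) :
    (k + 2 * s * m + s ^ 2 * n)
      + 1 / 2 * ((1 - 2 * τ) ^ 2 * (a + 2 * s * c + s ^ 2 * e)
        + 2 * (1 - 2 * τ) * ((1 - s) * c - s * (k + zG) + s * (1 - s) * e - s ^ 2 * yg)
        + ((1 - s) ^ 2 * e - 2 * s * (1 - s) * yg + s ^ 2 * gg))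
      + 1 / 2 * ((1 - s) ^ 2 * e - 2 * s * (1 - s) * yg + s ^ 2 * gg)
    ≤ (1 - τ * s) * (k + 1 / 2 * ((1 - 2 * τ) ^ 2 * a + 2 * (1 - 2 * τ) * c + e) + 1 / 2 * e) := by
  have hk0 : 0 ≤ k := le_trans (mul_nonneg (by linarith) ha) hk
  obtain ⟨N, hN⟩ : ∃ N, N = k + 1 / 2 * ((1 - 2 * τ) ^ 2 * a + 2 * (1 - 2 * τ) * c + e) + 1 / 2 * e :=
    ⟨_, rfl⟩
  have first := quadratic_first_order hτ hτ8 hτκ ha he hk hgG hyG hzG hN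
  have second := quadratic_second_order hs hs8 hτ hτ8 he hk hk0 hn hsL hgG hkk hgg hyg
  have h1 := mul_le_mul_of_nonneg_left first hs.le
  have h2 := mul_le_mul_of_nonneg_left second hs.le
  have h3 : 0 ≤ s * k := by positivity
  have h4 : 0 ≤ s * e := by positivity
  rw [← hN]
  -- Sorted by powers of `s`: the first order leaves `-13k/64 - e/2`, which covers the second order
  -- cost `10k/64 + e/4`.
  refine le_trans (b := N + s * ((1 - 2 * τ) ^ 2 * c - (1 - 2 * τ) * c - (1 - 2 * τ) * (k + zG)
    + (1 - 2 * τ) * e - 2 * e - 2 * yG) + s * (s * (n + 1 / 2 * (1 - 2 * τ) ^ 2 * e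
    - (1 - 2 * τ) * (e + yg) + e + 2 * yg + gg))) (le_of_eq ?_) ?_
  · rw [hN, hygm]; ring
  · linarith

end

end

/-! ### One Euler–Maruyama step: contraction of `r_l` and growth of `r_s` -/

section

section

variable {d : ℕ} {p : Params} {K : Matrix (Fin d) (Fin d) ℝ} {U G : Pos d → ℝ}

/-- The form `r_l²` in the variables `z` and `y = γ⁻¹ w`. -/
def quadForm (p : Params) (K : Matrix (Fin d) (Fin d) ℝ) (z y : Pos d) : ℝ :=
  p.γ⁻¹ ^ 2 * inner ℝ z (act K z) + 1 / 2 * ‖(1 - 2 * tau p) • z + y‖ ^ 2 + 1 / 2 * ‖y‖ ^ 2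

/-- The form that defines the set `𝒦`, in the variables `z` and `y = γ⁻¹ w`. -/
def setForm (p : Params) (z y : Pos d) : ℝ :=
  p.κ * p.γ⁻¹ ^ 2 * ‖z‖ ^ 2 + 1 / 2 * ‖z + y‖ ^ 2 + 1 / 2 * ‖y‖ ^ 2

lemma rl_eq_sqrt_quadForm (a b : Phase d) :
    rl p K a b = Real.sqrt (quadForm p K (a.1 - b.1) (p.γ⁻¹ • (a.2 - b.2))) := by
  rw [rl, quadForm, norm_smul p.γ⁻¹ (a.2 - b.2), mul_pow, Real.norm_eq_abs, sq_abs, mul_assoc (1 / 2)]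

/-- In the variables `z`, `y = γ⁻¹w` and step `s = γh` everything is dimensionless. The perturbation
`g` is small because `γ ≥ 4L_G/√κ`, and its non-convexity enters only through the hypothesis on `z ·
g`. -/
lemma quadForm_contraction (hS : Spectral p K) (H : ParamBounds p) {s : ℝ} (hs : 0 < s)
    (hs8 : s ≤ 1 / 8) (hsL : s * (p.γ⁻¹ ^ 2 * p.LK) ≤ 1 / 32) {z y g : Pos d}
    (hg : ‖g‖ ≤ p.LG * ‖z‖) (hzg : -(inner ℝ z g) ≤ p.γ ^ 2 * tau p * setForm p z y) :
    quadForm p K (z + s • y) ((1 - s) • y - s • (p.γ⁻¹ ^ 2 • (act K z + g)))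
      ≤ (1 - tau p * s) * quadForm p K z y := by
  have hγ := H.inv_pos
  have hγ1 : p.γ⁻¹ * p.γ = 1 := inv_mul_cancel₀ H.γ_pos.ne'
  set i := p.γ⁻¹ ^ 2 with hi
  have hi0 : 0 < i := by positivity
  set V := i • (act K z + g) with hV
  have hzV : (inner ℝ z V : ℝ) = i * inner ℝ z (act K z) + i * inner ℝ z g := by
    rw [hV, real_inner_smul_right, inner_add_right, mul_add]
  have hyV : (inner ℝ y V : ℝ) = i * inner ℝ y (act K z) + i * inner ℝ y g := by
    rw [hV, real_inner_smul_right, inner_add_right, mul_add]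
  have hsymm : (inner ℝ z (act K y) : ℝ) = inner ℝ y (act K z) := by
    rw [← hS.symm, real_inner_comm]
  have key := quadratic_contraction (s := s) (τ := tau p) (κ := i * p.κ) (L := i * p.LK)
    (a := ‖z‖ ^ 2) (c := inner ℝ z y) (e := ‖y‖ ^ 2) (k := i * inner ℝ z (act K z))
    (m := i * inner ℝ y (act K z)) (n := i * inner ℝ y (act K y)) (zG := i * inner ℝ z g)
    (yG := i * inner ℝ y g) (yg := inner ℝ y V) (gg := ‖V‖ ^ 2) (gG := ‖i • g‖ ^ 2)
    (kk := ‖i • act K z‖ ^ 2) hs hs8 H.tau_pos (tau_le p) (tau_le' p) (sq_nonneg _) (sq_nonneg _)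
    (by rw [mul_assoc]; exact mul_le_mul_of_nonneg_left (hS.lower z) hi0.le)
    (by rw [mul_assoc]; exact mul_le_mul_of_nonneg_left (hS.upper y) hi0.le)
    hsL
    (by
      rw [norm_smul, Real.norm_of_nonneg hi0.le]
      have h1 : ‖g‖ ^ 2 ≤ (p.LG * ‖z‖) ^ 2 := by gcongr
      have h2 : i * p.γ ^ 2 = 1 := by rw [hi, ← mul_pow, hγ1, one_pow]
      have h3 := mul_le_mul_of_nonneg_left H.LG_le (by positivity : 0 ≤ i * i * ‖z‖ ^ 2)
      have h4 : i * i * ‖z‖ ^ 2 * (p.γ ^ 2 * p.κ) = i * p.κ * ‖z‖ ^ 2 * (i * p.γ ^ 2) := by ring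
      rw [h4, h2] at h3
      have h5 := mul_le_mul_of_nonneg_left h1 (by positivity : 0 ≤ i * i)
      linarith)
    (by
      have h1 : i * (inner ℝ y g : ℝ) = inner ℝ y (i • g) := by rw [real_inner_smul_right]
      rw [h1]
      have h2 := abs_real_inner_le_norm y (i • g)
      have h3 := (abs_le.1 h2).1
      nlinarith [sq_nonneg (‖y‖ - 2 * ‖i • g‖)])
    (by
      rw [norm_smul, Real.norm_of_nonneg hi0.le, mul_pow]
      have h1 := mul_le_mul_of_nonneg_left (hS.norm_sq_le z) (by positivity : 0 ≤ i ^ 2)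
      linarith)
    (by
      rw [hV, smul_add]
      have h1 := norm_add_le (i • act K z) (i • g)
      have h2 : ‖i • act K z + i • g‖ ^ 2 ≤ (‖i • act K z‖ + ‖i • g‖) ^ 2 := by gcongr
      nlinarith [sq_nonneg (‖i • act K z‖ - ‖i • g‖)])
    (by
      have h2 := abs_real_inner_le_norm y V
      nlinarith [sq_nonneg (‖V‖ - 5 / 8 * ‖y‖)])
    hyV
    (by
      have h2 : i * p.γ ^ 2 = 1 := by rw [hi, ← mul_pow, hγ1, one_pow]
      have h1 := mul_le_mul_of_nonneg_left hzg hi0.le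
      have h3 : i * (p.γ ^ 2 * tau p * setForm p z y) = tau p * setForm p z y := by
        linear_combination (tau p * setForm p z y) * h2
      rw [h3, setForm, norm_add_sq_real, ← hi] at h1
      linarith)
  have e1 : quadForm p K z y = i * inner ℝ z (act K z)
      + 1 / 2 * ((1 - 2 * tau p) ^ 2 * ‖z‖ ^ 2 + 2 * (1 - 2 * tau p) * inner ℝ z y + ‖y‖ ^ 2)
      + 1 / 2 * ‖y‖ ^ 2 := by
    rw [quadForm, norm_add_sq_real, norm_smul, real_inner_smul_left, mul_pow, Real.norm_eq_abs,
      sq_abs]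
    ring
  have e2 : ‖z + s • y‖ ^ 2 = ‖z‖ ^ 2 + 2 * s * inner ℝ z y + s ^ 2 * ‖y‖ ^ 2 := by
    rw [norm_add_sq_real, norm_smul, real_inner_smul_right, mul_pow, Real.norm_eq_abs, sq_abs]
    ring
  have e3 : ‖(1 - s) • y - s • V‖ ^ 2
      = (1 - s) ^ 2 * ‖y‖ ^ 2 - 2 * s * (1 - s) * inner ℝ y V + s ^ 2 * ‖V‖ ^ 2 := by
    rw [norm_sub_sq_real, norm_smul, norm_smul, real_inner_smul_left, real_inner_smul_right,
      mul_pow, mul_pow, Real.norm_eq_abs, Real.norm_eq_abs, sq_abs, sq_abs]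
    ring
  have e4 : (inner ℝ (z + s • y) ((1 - s) • y - s • V) : ℝ)
      = (1 - s) * inner ℝ z y - s * inner ℝ z V + s * (1 - s) * ‖y‖ ^ 2 - s ^ 2 * inner ℝ y V := by
    simp only [inner_add_left, inner_sub_right, real_inner_smul_left, real_inner_smul_right,
      real_inner_self_eq_norm_sq]
    ring
  have e5 : (inner ℝ (z + s • y) (act K (z + s • y)) : ℝ)
      = inner ℝ z (act K z) + 2 * s * inner ℝ y (act K z) + s ^ 2 * inner ℝ y (act K y) := by
    simp only [map_add, map_smul, inner_add_left, inner_add_right, real_inner_smul_left,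
      real_inner_smul_right, hsymm]
    ring
  have e6 : quadForm p K (z + s • y) ((1 - s) • y - s • V)
      = i * inner ℝ (z + s • y) (act K (z + s • y))
      + 1 / 2 * ((1 - 2 * tau p) ^ 2 * ‖z + s • y‖ ^ 2
        + 2 * (1 - 2 * tau p) * inner ℝ (z + s • y) ((1 - s) • y - s • V)
        + ‖(1 - s) • y - s • V‖ ^ 2)
      + 1 / 2 * ‖(1 - s) • y - s • V‖ ^ 2 := by
    rw [quadForm, norm_add_sq_real, norm_smul, real_inner_smul_left, mul_pow, Real.norm_eq_abs,
      sq_abs]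
    ring
  rw [e6, e1, e2, e3, e4, e5, hzV]
  refine le_trans (le_of_eq ?_) key
  ring

/-- One synchronous Euler-Maruyama step contracts `r_l`. -/
theorem rl_emStep_le (hS : Spectral p K) (H : ParamBounds p) {h : ℝ} (hh : 0 < h)
    (h8 : p.γ * h ≤ 1 / 8) (hL : p.γ⁻¹ * h * p.LK ≤ 1 / 32) {a b : Phase d} {g : Pos d}
    (hgrad : ∇ U a.1 - ∇ U b.1 = act K (a.1 - b.1) + g)
    (hg : ‖g‖ ≤ p.LG * ‖a.1 - b.1‖)
    (hzg : -(inner ℝ (a.1 - b.1) g)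
      ≤ p.γ ^ 2 * tau p * setForm p (a.1 - b.1) (p.γ⁻¹ • (a.2 - b.2))) (ξ : Pos d) :
    rl p K (emStep p.γ h U a ξ) (emStep p.γ h U b ξ) ≤ (1 - tau p * p.γ * h / 2) * rl p K a b := by
  have hγ := H.γ_pos
  have hγ1 : p.γ⁻¹ * p.γ = 1 := inv_mul_cancel₀ H.γ_pos.ne'
  have hτ := H.tau_pos
  have hτ8 := tau_le p
  have h1 : 0 ≤ 1 - tau p * p.γ * h / 2 := by nlinarith [mul_pos hτ (mul_pos hγ hh)]
  have hz : (emStep p.γ h U a ξ).1 - (emStep p.γ h U b ξ).1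
      = (a.1 - b.1) + (p.γ * h) • (p.γ⁻¹ • (a.2 - b.2)) := by
    simp only [emStep]
    have : p.γ * h * p.γ⁻¹ = h := by field_simp
    rw [smul_smul, this]
    module
  have hw : p.γ⁻¹ • ((emStep p.γ h U a ξ).2 - (emStep p.γ h U b ξ).2)
      = (1 - p.γ * h) • (p.γ⁻¹ • (a.2 - b.2))
        - (p.γ * h) • (p.γ⁻¹ ^ 2 • (act K (a.1 - b.1) + g)) := by
    rw [← hgrad]
    simp only [emStep]
    have h2 : p.γ * h * p.γ⁻¹ ^ 2 = p.γ⁻¹ * h := by field_simp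
    have h3 : p.γ⁻¹ * (h * p.γ) = h := by field_simp
    have h4 : p.γ * h * p.γ⁻¹ = h := by field_simp
    rw [sub_smul (1 : ℝ), one_smul, smul_smul (p.γ * h), smul_smul (p.γ * h), h2, h4]
    have : p.γ⁻¹ • (a.2 - h • ∇ U a.1 - (h * p.γ) • a.2 + Real.sqrt (2 * p.γ * h) • ξ
        - (b.2 - h • ∇ U b.1 - (h * p.γ) • b.2 + Real.sqrt (2 * p.γ * h) • ξ))
        = p.γ⁻¹ • (a.2 - b.2) - (p.γ⁻¹ * (h * p.γ)) • (a.2 - b.2)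
          - (p.γ⁻¹ * h) • (∇ U a.1 - ∇ U b.1) := by module
    rw [this, h3]
  have hγh : 0 < p.γ * h := by positivity
  have key := quadForm_contraction hS H hγh h8 (by
      have : p.γ * h * (p.γ⁻¹ ^ 2 * p.LK) = p.γ⁻¹ * h * p.LK := by field_simp
      rwa [this]) hg hzg
  have hq0 : 0 ≤ quadForm p K (a.1 - b.1) (p.γ⁻¹ • (a.2 - b.2)) := by
    have h1 : 0 ≤ inner ℝ (a.1 - b.1) (act K (a.1 - b.1)) := by
      have := H.κ_pos
      exact le_trans (by positivity) (hS.lower _)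
    unfold quadForm; positivity
  rw [rl_eq_sqrt_quadForm, rl_eq_sqrt_quadForm, hz, hw]
  refine Real.sqrt_le_iff.2 ⟨by positivity, key.trans ?_⟩
  rw [mul_pow, Real.sq_sqrt hq0]
  refine mul_le_mul_of_nonneg_right ?_ hq0
  nlinarith [sq_nonneg (tau p * p.γ * h / 2)]

/-- The position part and the drift in one step of the coupling. -/
theorem rs_emStep_le (H : ParamBounds p) {h : ℝ} (hh : 0 < h) (h8 : p.γ * h ≤ 1 / 8)
    {a b : Phase d} (hU : ‖∇ U a.1 - ∇ U b.1‖ ≤ p.L * ‖a.1 - b.1‖) (ξ ξ' : Pos d) :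
    rs p (emStep p.γ h U a ξ) (emStep p.γ h U b ξ')
      ≤ alpha p * (1 - h * p.γ / 2) * ‖a.1 - b.1‖ + h * p.γ * alpha p * ‖qvec p a b‖
        + ‖qvec p a b + Real.sqrt (2 * p.γ⁻¹ * h) • (ξ - ξ')‖ := by
  have hγ := H.γ_pos
  have hα := H.alpha_pos
  set σ := Real.sqrt (2 * p.γ⁻¹ * h) with hσ
  have hroot : p.γ⁻¹ * Real.sqrt (2 * p.γ * h) = σ := by
    rw [hσ, show 2 * p.γ⁻¹ * h = p.γ⁻¹ ^ 2 * (2 * p.γ * h) by field_simp,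
      Real.sqrt_mul (sq_nonneg _), Real.sqrt_sq H.inv_pos.le]
  -- In the coordinates `(z, q)` the position difference is damped at rate `γ` towards `q`, and in
  -- `q` the friction cancels, leaving noise and a gradient of size `hγαA/2`. Half of the damping of
  -- `αA` pays for that gradient.
  have hz : (emStep p.γ h U a ξ).1 - (emStep p.γ h U b ξ').1
      = (1 - h * p.γ) • (a.1 - b.1) + (h * p.γ) • qvec p a b := by
    simp only [emStep, qvec]
    rw [smul_add, smul_smul]
    have : h * p.γ * p.γ⁻¹ = h := by field_simp
    rw [this]
    module
  have hq : qvec p (emStep p.γ h U a ξ) (emStep p.γ h U b ξ')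
      = (qvec p a b + σ • (ξ - ξ')) - (p.γ⁻¹ * h) • (∇ U a.1 - ∇ U b.1) := by
    rw [← hroot]
    simp only [emStep, qvec]
    have h3 : p.γ⁻¹ * (h * p.γ) = h := by field_simp
    have : p.γ⁻¹ • (a.2 - h • ∇ U a.1 - (h * p.γ) • a.2 + Real.sqrt (2 * p.γ * h) • ξ
        - (b.2 - h • ∇ U b.1 - (h * p.γ) • b.2 + Real.sqrt (2 * p.γ * h) • ξ'))
        = p.γ⁻¹ • (a.2 - b.2) - (p.γ⁻¹ * (h * p.γ)) • (a.2 - b.2)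
          - (p.γ⁻¹ * h) • (∇ U a.1 - ∇ U b.1)
          + (p.γ⁻¹ * Real.sqrt (2 * p.γ * h)) • (ξ - ξ') := by module
    rw [this, h3]
    module
  rw [rs_eq, hz, hq]
  have h1 : ‖(1 - h * p.γ) • (a.1 - b.1) + (h * p.γ) • qvec p a b‖
      ≤ (1 - h * p.γ) * ‖a.1 - b.1‖ + h * p.γ * ‖qvec p a b‖ := by
    refine (norm_add_le _ _).trans_eq ?_
    rw [norm_smul, norm_smul, Real.norm_of_nonneg (by nlinarith : 0 ≤ 1 - h * p.γ),
      Real.norm_of_nonneg (by positivity : 0 ≤ h * p.γ)]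
  have h2 : ‖(qvec p a b + σ • (ξ - ξ')) - (p.γ⁻¹ * h) • (∇ U a.1 - ∇ U b.1)‖
      ≤ ‖qvec p a b + σ • (ξ - ξ')‖ + h * p.γ * alpha p / 2 * ‖a.1 - b.1‖ := by
    refine (norm_sub_le _ _).trans ?_
    gcongr
    have hi := H.inv_pos
    rw [norm_smul, Real.norm_of_nonneg (by positivity : 0 ≤ p.γ⁻¹ * h)]
    calc p.γ⁻¹ * h * ‖∇ U a.1 - ∇ U b.1‖ ≤ p.γ⁻¹ * h * (p.L * ‖a.1 - b.1‖) := by gcongr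
      _ = _ := by rw [alpha]; field_simp
  have h3 := mul_le_mul_of_nonneg_left h1 hα.le
  linarith

end

end

section

/-! ### The constants `D_𝒦` and `R₁` -/

section

variable {d : ℕ} {p : Params} {K : Matrix (Fin d) (Fin d) ℝ} {U G : Pos d → ℝ}

lemma mem_setK {a b : Phase d} :
    a - b ∈ setK p d ↔ setForm p (a.1 - b.1) (p.γ⁻¹ • (a.2 - b.2)) ≤ calR p := Iff.rfl

lemma setForm_eq (p : Params) (a b : Phase d) :
    setForm p (a.1 - b.1) (p.γ⁻¹ • (a.2 - b.2)) = p.κ * p.γ⁻¹ ^ 2 * ‖a.1 - b.1‖ ^ 2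
      + ‖qvec p a b‖ ^ 2 - inner ℝ (qvec p a b) (a.1 - b.1) + 1 / 2 * ‖a.1 - b.1‖ ^ 2 := by
  have h1 : p.γ⁻¹ • (a.2 - b.2) = qvec p a b - (a.1 - b.1) := by simp [qvec]
  have h2 : (a.1 - b.1) + p.γ⁻¹ • (a.2 - b.2) = qvec p a b := rfl
  rw [setForm, h2, h1, norm_sub_sq_real (qvec p a b) (a.1 - b.1)]
  ring

/-- The smallest value of `r_l²` for given `|z| = A` and `|q| = B`. -/
def lowForm (p : Params) (A B : ℝ) : ℝ :=
  p.γ⁻¹ ^ 2 * (p.κ * A ^ 2) + B ^ 2 - (1 + 2 * tau p) * (A * B) + (1 / 2 + 2 * tau p ^ 2) * A ^ 2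

/-- The largest value of `r_l²` for given `|z| = A` and `|q| = B`. -/
def highForm (p : Params) (A B : ℝ) : ℝ :=
  p.γ⁻¹ ^ 2 * (p.LK * A ^ 2) + B ^ 2 + (1 + 2 * tau p) * (A * B) + (1 / 2 + 2 * tau p ^ 2) * A ^ 2

/-- The constant `D_𝒦` as a supremum over two real variables. -/
def scalarDK (p : Params) : ℝ :=
  sSup {t : ℝ | ∃ A B : ℝ, 0 ≤ A ∧ 0 ≤ B ∧
    p.κ * p.γ⁻¹ ^ 2 * A ^ 2 + B ^ 2 - A * B + 1 / 2 * A ^ 2 ≤ calR p ∧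
    t = alpha p * A + B - eps p * Real.sqrt (lowForm p A B)}

/-- The constant `R₁` as a supremum over two real variables. -/
def scalarRadius (p : Params) : ℝ :=
  sSup {t : ℝ | ∃ A B : ℝ, 0 ≤ A ∧ 0 ≤ B ∧
    alpha p * A + B - eps p * Real.sqrt (highForm p A B) ≤ scalarDK p ∧ t = alpha p * A + B}

lemma rl_eq_sqrt (hS : Spectral p K) (H : ParamBounds p) (a b : Phase d) :
    rl p K a b = Real.sqrt (p.γ⁻¹ ^ 2 * inner ℝ (a.1 - b.1) (act K (a.1 - b.1))
      + ‖qvec p a b‖ ^ 2 - (1 + 2 * tau p) * inner ℝ (qvec p a b) (a.1 - b.1)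
      + (1 / 2 + 2 * tau p ^ 2) * ‖a.1 - b.1‖ ^ 2) := by
  rw [← rl_sq hS H, Real.sqrt_sq (rl_nonneg _ _ _ _)]

lemma sqrt_lowForm_le (hS : Spectral p K) (H : ParamBounds p) (a b : Phase d) :
    Real.sqrt (lowForm p ‖a.1 - b.1‖ ‖qvec p a b‖) ≤ rl p K a b := by
  rw [rl_eq_sqrt hS H]
  apply Real.sqrt_le_sqrt
  have h1 := hS.lower (a.1 - b.1)
  have h2 := mul_le_mul_of_nonneg_left h1 (sq_nonneg p.γ⁻¹)
  have h3 := (abs_le.1 (abs_inner_qvec_le p a b)).2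
  have h4 := mul_le_mul_of_nonneg_left h3 (by linarith [H.tau_pos] : 0 ≤ 1 + 2 * tau p)
  unfold lowForm
  linarith

lemma le_sqrt_highForm (hS : Spectral p K) (H : ParamBounds p) (a b : Phase d) :
    rl p K a b ≤ Real.sqrt (highForm p ‖a.1 - b.1‖ ‖qvec p a b‖) := by
  rw [rl_eq_sqrt hS H]
  apply Real.sqrt_le_sqrt
  have h1 := hS.upper (a.1 - b.1)
  have h2 := mul_le_mul_of_nonneg_left h1 (sq_nonneg p.γ⁻¹)
  have h3 := (abs_le.1 (abs_inner_qvec_le p a b)).1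
  have h4 := mul_le_mul_of_nonneg_left h3 (by linarith [H.tau_pos] : 0 ≤ 1 + 2 * tau p)
  unfold highForm
  linarith

/-- A pair of states with prescribed `z` and `q`. -/
def stateOf (p : Params) (z q : Pos d) : Phase d := (z, p.γ • (q - z))

lemma qvec_stateOf (hγ : 0 < p.γ) (z q : Pos d) : qvec p (stateOf p z q) 0 = q := by
  simp only [qvec, stateOf, Prod.fst_zero, Prod.snd_zero, sub_zero, smul_smul,
    inv_mul_cancel₀ hγ.ne', one_smul]
  abel

/-- For given `|z|`, `|q|` the form `r_l²` is smallest when `z`, `q` point in the same direction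
along an eigenvector for `κ`. The same alignment minimises the form of `𝒦`, so the constraint is no
loss. -/
lemma DK_eq (hS : Spectral p K) (H : ParamBounds p) : DK p K = scalarDK p := by
  have he := H.eps_pos
  apply csSup_eq_csSup_of_forall_exists_le
  · rintro _ ⟨a, b, hab, rfl⟩
    refine ⟨_, ⟨‖a.1 - b.1‖, ‖qvec p a b‖, norm_nonneg _, norm_nonneg _, ?_, rfl⟩, ?_⟩
    · rw [mem_setK, setForm_eq] at hab
      have h3 := (abs_le.1 (abs_inner_qvec_le p a b)).2
      linarith
    · have := mul_le_mul_of_nonneg_left (sqrt_lowForm_le hS H a b) he.le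
      rw [Del, rs_eq]
      linarith
  · rintro _ ⟨A, B, hA, hB, hAB, rfl⟩
    obtain ⟨e, he1, heK⟩ := hS.exists_min
    have hz : ‖(stateOf p (A • e) (B • e)).1 - (0 : Phase d).1‖ = A := by
      simp [stateOf, norm_smul, he1, abs_of_nonneg hA]
    have hz1 : (stateOf p (A • e) (B • e)).1 - (0 : Phase d).1 = A • e := by simp [stateOf]
    have hq : ‖qvec p (stateOf p (A • e) (B • e)) 0‖ = B := by
      rw [qvec_stateOf H.γ_pos]; simp [norm_smul, he1, abs_of_nonneg hB]
    have hi : (inner ℝ (qvec p (stateOf p (A • e) (B • e)) 0)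
        ((stateOf p (A • e) (B • e)).1 - (0 : Phase d).1) : ℝ) = A * B := by
      rw [qvec_stateOf H.γ_pos, hz1, real_inner_smul_left, real_inner_smul_right,
        real_inner_self_eq_norm_sq, he1]
      ring
    refine ⟨_, ⟨stateOf p (A • e) (B • e), 0, ?_, rfl⟩, le_of_eq ?_⟩
    · rw [mem_setK, setForm_eq, hi, hz, hq]
      exact hAB
    · rw [Del, rs_eq, rl_eq_sqrt hS H, hi, hz, hq, hz1, map_smul, real_inner_smul_left,
        real_inner_smul_right, heK, lowForm]
      ring_nf

lemma radius_eq (hS : Spectral p K) (H : ParamBounds p) : radius p K = scalarRadius p := by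
  have he := H.eps_pos
  apply csSup_eq_csSup_of_forall_exists_le
  · rintro _ ⟨a, b, hab, rfl⟩
    refine ⟨_, ⟨‖a.1 - b.1‖, ‖qvec p a b‖, norm_nonneg _, norm_nonneg _, ?_, rfl⟩, le_rfl⟩
    rw [← DK_eq hS H]
    refine le_trans ?_ hab
    have := mul_le_mul_of_nonneg_left (le_sqrt_highForm hS H a b) he.le
    rw [Del, rs_eq]
    linarith
  · rintro _ ⟨A, B, hA, hB, hAB, rfl⟩
    -- Here `r_l` has to be as large as possible, since this weakens the constraint: `q` opposite to
    -- `z`, along a unit vector with `e · Ke = L_K`.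
    obtain ⟨e, he1, heK⟩ := hS.exists_max
    have hz1 : (stateOf p (A • e) (-B • e)).1 - (0 : Phase d).1 = A • e := by simp [stateOf]
    have hz : ‖(stateOf p (A • e) (-B • e)).1 - (0 : Phase d).1‖ = A := by
      rw [hz1]; simp [norm_smul, he1, abs_of_nonneg hA]
    have hq : ‖qvec p (stateOf p (A • e) (-B • e)) 0‖ = B := by
      rw [qvec_stateOf H.γ_pos]; simp [norm_smul, he1, abs_of_nonneg hB]
    have hi : (inner ℝ (qvec p (stateOf p (A • e) (-B • e)) 0)
        ((stateOf p (A • e) (-B • e)).1 - (0 : Phase d).1) : ℝ) = -(A * B) := by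
      rw [qvec_stateOf H.γ_pos, hz1, real_inner_smul_left, real_inner_smul_right,
        real_inner_self_eq_norm_sq, he1]
      ring
    refine ⟨_, ⟨stateOf p (A • e) (-B • e), 0, ?_, rfl⟩, le_of_eq ?_⟩
    · rw [DK_eq hS H]
      refine le_trans (le_of_eq ?_) hAB
      rw [Del, rs_eq, rl_eq_sqrt hS H, hi, hz, hq, hz1, map_smul, real_inner_smul_left,
        real_inner_smul_right, heK, highForm]
      ring_nf
    · rw [rs_eq, hz, hq]

lemma scalarRadius_nonneg (hα : 0 ≤ alpha p) : 0 ≤ scalarRadius p := by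
  apply Real.sSup_nonneg
  rintro _ ⟨A, B, hA, hB, -, rfl⟩
  positivity

lemma rs_self (p : Params) (a : Phase d) : rs p a a = 0 := by simp [rs]

lemma rl_self (p : Params) (K : Matrix (Fin d) (Fin d) ℝ) (a : Phase d) : rl p K a a = 0 := by
  simp [rl]

lemma bddAbove_DK (K : Matrix (Fin d) (Fin d) ℝ) (H : ParamBounds p) :
    BddAbove {t : ℝ | ∃ a b : Phase d, a - b ∈ setK p d ∧ t = Del p K a b} := by
  have hα := H.alpha_pos
  have he := H.eps_pos
  have hκ := H.κ_pos
  have hγ := H.inv_pos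
  refine ⟨alpha p * (1 + calR p / (p.κ * p.γ⁻¹ ^ 2)) + (1 + 2 * calR p), ?_⟩
  rintro _ ⟨a, b, hab, rfl⟩
  rw [mem_setK, setForm] at hab
  have h0 : (a.1 - b.1) + p.γ⁻¹ • (a.2 - b.2) = qvec p a b := rfl
  rw [h0] at hab
  have h1 : 0 ≤ p.κ * p.γ⁻¹ ^ 2 * ‖a.1 - b.1‖ ^ 2 := by positivity
  have h2 : 0 ≤ ‖p.γ⁻¹ • (a.2 - b.2)‖ ^ 2 := by positivity
  have h3 : ‖qvec p a b‖ ≤ 1 + 2 * calR p := by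
    nlinarith [sq_nonneg (‖qvec p a b‖ - 1 / 2), sq_nonneg ‖qvec p a b‖]
  have h4 : ‖a.1 - b.1‖ ^ 2 ≤ calR p / (p.κ * p.γ⁻¹ ^ 2) := by
    rw [le_div_iff₀ (by positivity)]
    nlinarith [sq_nonneg ‖qvec p a b‖]
  have h5 : ‖a.1 - b.1‖ ≤ 1 + calR p / (p.κ * p.γ⁻¹ ^ 2) := by
    nlinarith [sq_nonneg (‖a.1 - b.1‖ - 1 / 2)]
  have h6 := mul_le_mul_of_nonneg_left h5 hα.le
  have h7 := mul_nonneg he.le (rl_nonneg p K a b)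
  rw [Del, rs_eq]
  linarith

lemma Del_le_DK (H : ParamBounds p) {a b : Phase d} (hab : a - b ∈ setK p d) :
    Del p K a b ≤ DK p K :=
  le_csSup (bddAbove_DK K H) ⟨a, b, hab, rfl⟩

lemma DK_nonneg (K : Matrix (Fin d) (Fin d) ℝ) (H : ParamBounds p) : 0 ≤ DK p K := by
  have h : (0 : Phase d) - 0 ∈ setK p d := by
    rw [mem_setK, setForm]; simpa using H.calR_nonneg
  have := Del_le_DK (K := K) H h
  rwa [Del, rs_self, rl_self, mul_zero, sub_zero] at this

/-- Boundedness of the set follows from `r_s ≤ 2Δ`; without it the supremum would have the default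
value `0`. -/
lemma rs_le_radius (hS : Spectral p K) (H : ParamBounds p) {a b : Phase d}
    (hab : Del p K a b ≤ DK p K) : rs p a b ≤ radius p K := by
  refine le_csSup ⟨2 * DK p K, ?_⟩ ⟨a, b, hab, rfl⟩
  rintro _ ⟨a, b, hab, rfl⟩
  have := half_rs_le_Del hS H a b
  linarith

lemma quadForm_smul (p : Params) (K : Matrix (Fin d) (Fin d) ℝ) (t : ℝ) (z y : Pos d) :
    quadForm p K (t • z) (t • y) = t ^ 2 * quadForm p K z y := by
  have h : (1 - 2 * tau p) • t • z + t • y = t • ((1 - 2 * tau p) • z + y) := by module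
  rw [quadForm, quadForm, h, map_smul, real_inner_smul_left, real_inner_smul_right, norm_smul,
    norm_smul, mul_pow, mul_pow, Real.norm_eq_abs, sq_abs]
  ring

lemma setForm_smul (p : Params) (t : ℝ) (z y : Pos d) :
    setForm p (t • z) (t • y) = t ^ 2 * setForm p z y := by
  rw [setForm, setForm, ← smul_add, norm_smul, norm_smul, norm_smul, mul_pow, mul_pow, mul_pow,
    Real.norm_eq_abs, sq_abs]
  ring

lemma Del_smul (p : Params) (K : Matrix (Fin d) (Fin d) ℝ) {t : ℝ} (ht : 0 ≤ t) (a b : Phase d) :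
    Del p K (t • (a - b)) 0 = t * Del p K a b := by
  have h1 : (t • (a - b)).1 - (0 : Phase d).1 = t • (a.1 - b.1) := by simp
  have h2 : p.γ⁻¹ • ((t • (a - b)).2 - (0 : Phase d).2) = t • (p.γ⁻¹ • (a.2 - b.2)) := by
    simp only [Prod.smul_snd, Prod.snd_sub, Prod.snd_zero, sub_zero]
    exact smul_comm _ _ _
  have h3 : qvec p (t • (a - b)) 0 = t • qvec p a b := by
    rw [qvec, h1, h2, qvec, smul_add]
  rw [Del, Del, rs_eq, rs_eq, rl_eq_sqrt_quadForm, rl_eq_sqrt_quadForm, h3, h1, h2, quadForm_smul,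
    Real.sqrt_mul (sq_nonneg t), Real.sqrt_sq ht, norm_smul, norm_smul, Real.norm_of_nonneg ht]
  ring

/-- Outside of the region where `Δ < D_𝒦` the defining form of `𝒦` is at least `ℛ`. -/
lemma calR_le_setForm (hS : Spectral p K) (H : ParamBounds p) {a b : Phase d} (hab : a ≠ b)
    (hfar : DK p K ≤ Del p K a b) :
    calR p ≤ setForm p (a.1 - b.1) (p.γ⁻¹ • (a.2 - b.2)) := by
  by_contra! hlt
  have hκ := H.κ_pos
  have hγ := H.inv_pos
  have hα := H.alpha_pos
  set Q := setForm p (a.1 - b.1) (p.γ⁻¹ • (a.2 - b.2)) with hQ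
  have hrs : 0 < rs p a b := by
    rw [rs_eq]
    rcases (norm_nonneg (a.1 - b.1)).eq_or_lt with h | h
    · have hz : a.1 - b.1 = 0 := norm_eq_zero.1 h.symm
      have hw : a.2 - b.2 ≠ 0 := fun h2 => hab (Prod.ext (sub_eq_zero.1 hz) (sub_eq_zero.1 h2))
      have : 0 < ‖qvec p a b‖ := by
        rw [qvec, hz, zero_add, norm_pos_iff]
        exact smul_ne_zero hγ.ne' hw
      rw [← h]
      linarith
    · have := norm_nonneg (qvec p a b)
      have := mul_pos hα h
      linarith
  have hQ0 : 0 < Q := by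
    by_contra! hQ1
    have h0 : (a.1 - b.1) + p.γ⁻¹ • (a.2 - b.2) = qvec p a b := rfl
    rw [hQ, setForm, h0] at hQ1
    have h1 : 0 ≤ p.κ * p.γ⁻¹ ^ 2 * ‖a.1 - b.1‖ ^ 2 := by positivity
    have h2 : 0 ≤ ‖p.γ⁻¹ • (a.2 - b.2)‖ ^ 2 := by positivity
    have h3 : ‖qvec p a b‖ = 0 := by
      have : ‖qvec p a b‖ ^ 2 = 0 := le_antisymm (by linarith) (sq_nonneg _)
      exact pow_eq_zero_iff two_ne_zero |>.1 this
    have h4 : ‖a.1 - b.1‖ = 0 := by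
      have h5 : p.κ * p.γ⁻¹ ^ 2 * ‖a.1 - b.1‖ ^ 2 = 0 :=
        le_antisymm (by nlinarith [sq_nonneg ‖qvec p a b‖]) h1
      have h6 : p.κ * p.γ⁻¹ ^ 2 ≠ 0 := by positivity
      exact pow_eq_zero_iff two_ne_zero |>.1 ((mul_eq_zero.1 h5).resolve_left h6)
    rw [rs_eq, h3, h4] at hrs
    simp at hrs
  -- Scaling by `t > 1` brings the difference to the boundary of `𝒦`, where `Δ` becomes `tΔ ≤ D_𝒦 ≤
  -- Δ`. This contradicts `Δ ≥ r_s/2 > 0`.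
  set t := Real.sqrt (calR p / Q) with ht
  have ht1 : 1 < t := by
    rw [ht, Real.lt_sqrt zero_le_one, one_pow, one_lt_div hQ0]
    exact hlt
  have ht2 : t ^ 2 * Q = calR p := by
    rw [ht, Real.sq_sqrt (div_nonneg H.calR_nonneg hQ0.le), div_mul_cancel₀ _ hQ0.ne']
  have hmem : t • (a - b) - 0 ∈ setK p d := by
    have h1 : (t • (a - b)).1 - (0 : Phase d).1 = t • (a.1 - b.1) := by simp
    have h2 : p.γ⁻¹ • ((t • (a - b)).2 - (0 : Phase d).2) = t • (p.γ⁻¹ • (a.2 - b.2)) := by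
      simp only [Prod.smul_snd, Prod.snd_sub, Prod.snd_zero, sub_zero]
      exact smul_comm _ _ _
    rw [mem_setK, h1, h2, setForm_smul, ← hQ, ht2]
  have h1 := Del_le_DK (K := K) H hmem
  rw [Del_smul p K (by linarith)] at h1
  have h2 := half_rs_le_Del hS H a b
  nlinarith

/-! ### The distance `ρ` -/

lemma rs_symm (p : Params) (a b : Phase d) : rs p a b = rs p b a := by
  have h : qvec p a b = -qvec p b a := by simp only [qvec]; module
  rw [rs_eq, rs_eq, h, norm_neg, norm_sub_rev]

lemma rl_symm (p : Params) (K : Matrix (Fin d) (Fin d) ℝ) (a b : Phase d) :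
    rl p K a b = rl p K b a := by
  have h1 : a.1 - b.1 = (-1 : ℝ) • (b.1 - a.1) := by module
  have h2 : p.γ⁻¹ • (a.2 - b.2) = (-1 : ℝ) • (p.γ⁻¹ • (b.2 - a.2)) := by module
  rw [rl_eq_sqrt_quadForm, rl_eq_sqrt_quadForm, h1, h2, quadForm_smul]
  norm_num

lemma qvec_add (p : Params) (a b c : Phase d) : qvec p a c = qvec p a b + qvec p b c := by
  simp only [qvec]; module

lemma rs_triangle (H : ParamBounds p) (a b c : Phase d) : rs p a c ≤ rs p a b + rs p b c := by
  have h1 : ‖a.1 - c.1‖ ≤ ‖a.1 - b.1‖ + ‖b.1 - c.1‖ := norm_sub_le_norm_sub_add_norm_sub _ _ _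
  have h2 : ‖qvec p a c‖ ≤ ‖qvec p a b‖ + ‖qvec p b c‖ := by
    rw [qvec_add p a b c]; exact norm_add_le _ _
  have := mul_le_mul_of_nonneg_left h1 H.alpha_pos.le
  rw [rs_eq, rs_eq, rs_eq]
  linarith

/-- With `K = NᵀN`, `r_l` is the Euclidean norm of a linear image of the difference. -/
lemma rl_triangle (hS : Spectral p K) (a b c : Phase d) :
    rl p K a c ≤ rl p K a b + rl p K b c := by
  obtain ⟨N, hN⟩ := hS.root
  let T : Phase d → WithLp 2 (Pos d × WithLp 2 (Pos d × Pos d)) := fun v =>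
    WithLp.toLp 2 (p.γ⁻¹ • N v.1, WithLp.toLp 2
      (Real.sqrt (1 / 2) • ((1 - 2 * tau p) • v.1 + p.γ⁻¹ • v.2),
        Real.sqrt (1 / 2) • (p.γ⁻¹ • v.2)))
  have hT : ∀ a b : Phase d, rl p K a b = ‖T (a - b)‖ := by
    intro a b
    have hs : Real.sqrt (1 / 2) ^ 2 = 1 / 2 := Real.sq_sqrt (by norm_num)
    have h : quadForm p K (a.1 - b.1) (p.γ⁻¹ • (a.2 - b.2)) = ‖T (a - b)‖ ^ 2 := by
      rw [WithLp.prod_norm_sq_eq_of_L2, WithLp.prod_norm_sq_eq_of_L2]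
      change _ = ‖p.γ⁻¹ • N (a.1 - b.1)‖ ^ 2 +
        (‖Real.sqrt (1 / 2) • ((1 - 2 * tau p) • (a.1 - b.1) + p.γ⁻¹ • (a.2 - b.2))‖ ^ 2
          + ‖Real.sqrt (1 / 2) • (p.γ⁻¹ • (a.2 - b.2))‖ ^ 2)
      rw [norm_smul, norm_smul, norm_smul (Real.sqrt (1 / 2)), mul_pow, mul_pow, mul_pow,
        Real.norm_eq_abs, Real.norm_eq_abs, sq_abs, sq_abs, hs, quadForm, hN]
      ring
    rw [rl_eq_sqrt_quadForm, h, Real.sqrt_sq (norm_nonneg _)]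
  have hadd : T (a - c) = T (a - b) + T (b - c) := by
    have h : a - c = (a - b) + (b - c) := by abel
    have h1 : ∀ v w : Phase d, T (v + w) = T v + T w := by
      intro v w
      simp only [T, ← WithLp.toLp_add, Prod.mk_add_mk, Prod.fst_add, Prod.snd_add, map_add,
        smul_add]
      congr 4
      module
    rw [h, h1]
  rw [hT, hT, hT, hadd]
  exact norm_add_le _ _

lemma rho_eq (p : Params) (K : Matrix (Fin d) (Fin d) ℝ) (a b : Phase d) :
    rho p K a b = f p (radius p K) (min (rs p a b) (DK p K + eps p * rl p K a b)) := by
  have : min (Del p K a b) (DK p K) + eps p * rl p K a b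
      = min (rs p a b) (DK p K + eps p * rl p K a b) := by
    rw [← min_add_add_right, Del]
    ring_nf
  rw [rho, this]

/-- The argument of `f` in the distance `ρ`. -/
def rhoArg (p : Params) (K : Matrix (Fin d) (Fin d) ℝ) (a b : Phase d) : ℝ :=
  min (rs p a b) (DK p K + eps p * rl p K a b)

lemma admissible (hS : Spectral p K) (H : ParamBounds p) : Admissible p (radius p K) := by
  refine ⟨H.γ_pos, H.alpha_pos, ?_⟩
  rw [radius_eq hS H]
  exact scalarRadius_nonneg H.alpha_pos.le

lemma eps_rl_le_rhoArg (hS : Spectral p K) (H : ParamBounds p) (a b : Phase d) :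
    eps p * rl p K a b ≤ rhoArg p K a b := by
  have h0 := mul_nonneg H.eps_pos.le (rl_nonneg p K a b)
  have h1 := two_eps_rl_le hS H a b
  exact le_min (by linarith) (by linarith [DK_nonneg K H])

lemma rhoArg_nonneg (hS : Spectral p K) (H : ParamBounds p) (a b : Phase d) :
    0 ≤ rhoArg p K a b :=
  (mul_nonneg H.eps_pos.le (rl_nonneg p K a b)).trans (eps_rl_le_rhoArg hS H a b)

/-- A minimum of two distances need not satisfy the triangle inequality. Here the mixed cases work
because `ε r_l ≤ r_s` and `D_𝒦 ≥ 0`. -/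
lemma rhoArg_triangle (hS : Spectral p K) (H : ParamBounds p) (a b c : Phase d) :
    rhoArg p K a c ≤ rhoArg p K a b + rhoArg p K b c := by
  have hD := DK_nonneg K H
  have h1 := rs_triangle H a b c
  have h2 := mul_le_mul_of_nonneg_left (rl_triangle hS a b c) H.eps_pos.le
  have h3 := two_eps_rl_le hS H a b
  have h4 := two_eps_rl_le hS H b c
  have h5 := mul_nonneg H.eps_pos.le (rl_nonneg p K a b)
  have h6 := mul_nonneg H.eps_pos.le (rl_nonneg p K b c)
  unfold rhoArg
  rcases min_cases (rs p a b) (DK p K + eps p * rl p K a b) with ⟨h, _⟩ | ⟨h, _⟩ <;>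
  rcases min_cases (rs p b c) (DK p K + eps p * rl p K b c) with ⟨h', _⟩ | ⟨h', _⟩ <;>
  rw [h, h']
  · exact (min_le_left _ _).trans h1
  · exact (min_le_right _ _).trans (by linarith)
  · exact (min_le_right _ _).trans (by linarith)
  · exact (min_le_right _ _).trans (by linarith)

lemma quadForm_lower (hS : Spectral p K) (H : ParamBounds p) (a b : Phase d) :
    min p.κ (1 / 2) * euclDist a b ^ 2 ≤ p.γ ^ 2 * rl p K a b ^ 2 := by
  have hγ := H.γ_pos
  have hsq : rl p K a b ^ 2 = p.γ⁻¹ ^ 2 * inner ℝ (a.1 - b.1) (act K (a.1 - b.1))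
      + 1 / 2 * ‖(1 - 2 * tau p) • (a.1 - b.1) + p.γ⁻¹ • (a.2 - b.2)‖ ^ 2
      + 1 / 2 * p.γ⁻¹ ^ 2 * ‖a.2 - b.2‖ ^ 2 := by
    rw [rl, Real.sq_sqrt (rl_sq_nonneg hS H _ _)]
  rw [hsq, euclDist, Real.sq_sqrt (by positivity)]
  have h1 := hS.lower (a.1 - b.1)
  have h2 : min p.κ (1 / 2) * ‖a.1 - b.1‖ ^ 2 ≤ p.κ * ‖a.1 - b.1‖ ^ 2 := by
    gcongr; exact min_le_left _ _
  have h3 : min p.κ (1 / 2) * ‖a.2 - b.2‖ ^ 2 ≤ 1 / 2 * ‖a.2 - b.2‖ ^ 2 := by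
    gcongr; exact min_le_right _ _
  have h4 : p.γ ^ 2 * p.γ⁻¹ ^ 2 = 1 := by rw [← mul_pow, mul_inv_cancel₀ hγ.ne', one_pow]
  have h5 : 0 ≤ p.γ ^ 2 * ‖(1 - 2 * tau p) • (a.1 - b.1) + p.γ⁻¹ • (a.2 - b.2)‖ ^ 2 := by
    positivity
  have h6 : p.γ ^ 2 * (p.γ⁻¹ ^ 2 * inner ℝ (a.1 - b.1) (act K (a.1 - b.1))
      + 1 / 2 * ‖(1 - 2 * tau p) • (a.1 - b.1) + p.γ⁻¹ • (a.2 - b.2)‖ ^ 2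
      + 1 / 2 * p.γ⁻¹ ^ 2 * ‖a.2 - b.2‖ ^ 2)
      = inner ℝ (a.1 - b.1) (act K (a.1 - b.1))
        + 1 / 2 * (p.γ ^ 2 * ‖(1 - 2 * tau p) • (a.1 - b.1) + p.γ⁻¹ • (a.2 - b.2)‖ ^ 2)
        + 1 / 2 * ‖a.2 - b.2‖ ^ 2 := by
    linear_combination (inner ℝ (a.1 - b.1) (act K (a.1 - b.1)) + 1 / 2 * ‖a.2 - b.2‖ ^ 2) * h4
  rw [h6]
  linarith

lemma euclDist_nonneg (a b : Phase d) : 0 ≤ euclDist a b := Real.sqrt_nonneg _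

lemma sqrt_min_half (κ : ℝ) :
    Real.sqrt (min κ (1 / 2)) = min (Real.sqrt κ) (Real.sqrt (1 / 2)) :=
  Monotone.map_min fun _ _ h => Real.sqrt_le_sqrt h

lemma euclDist_le_rl (hS : Spectral p K) (H : ParamBounds p) (a b : Phase d) :
    min (Real.sqrt p.κ) (Real.sqrt (1 / 2)) * euclDist a b ≤ p.γ * rl p K a b := by
  have h := Real.sqrt_le_sqrt (quadForm_lower hS H a b)
  rwa [← mul_pow, Real.sqrt_sq (mul_nonneg H.γ_pos.le (rl_nonneg _ _ _ _)),
    Real.sqrt_mul' _ (sq_nonneg _), Real.sqrt_sq (euclDist_nonneg _ _), sqrt_min_half] at h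

lemma isMetric_rho (hS : Spectral p K) (H : ParamBounds p) : IsMetric (rho p K) := by
  have hA := admissible hS H
  have h0 : ∀ a b, rho p K a b = f p (radius p K) (rhoArg p K a b) := rho_eq p K
  have hs := hA.slopePos hA.R_nonneg
  refine ⟨fun a b => ?_, fun a b => ⟨fun h => ?_, fun h => ?_⟩, fun a b => ?_, fun a b c => ?_⟩
  · rw [h0]; exact hA.f_nonneg (rhoArg_nonneg hS H a b)
  · rw [h0] at h
    have h1 := hA.le_f (rhoArg_nonneg hS H a b)
    have h2 := mul_le_mul_of_nonneg_left (eps_rl_le_rhoArg hS H a b) hs.le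
    have h3 : rl p K a b ≤ 0 := by
      by_contra! h4
      have := mul_pos hs (mul_pos H.eps_pos h4)
      linarith
    have h4 := euclDist_le_rl hS H a b
    have h5 : 0 < min (Real.sqrt p.κ) (Real.sqrt (1 / 2)) :=
      lt_min (Real.sqrt_pos.2 H.κ_pos) (by positivity)
    have h6 : p.γ * rl p K a b ≤ 0 := mul_nonpos_of_nonneg_of_nonpos H.γ_pos.le h3
    have h7 : euclDist a b ≤ 0 := by
      by_contra! h8
      have := mul_pos h5 h8
      linarith
    have h8 : ‖a.1 - b.1‖ ^ 2 + ‖a.2 - b.2‖ ^ 2 ≤ 0 := Real.sqrt_eq_zero'.1 (le_antisymm h7 (euclDist_nonneg a b))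
    have h9 : ‖a.1 - b.1‖ = 0 := by
      have : ‖a.1 - b.1‖ ^ 2 = 0 := le_antisymm (by nlinarith [sq_nonneg ‖a.2 - b.2‖]) (sq_nonneg _)
      exact pow_eq_zero_iff two_ne_zero |>.1 this
    have h10 : ‖a.2 - b.2‖ = 0 := by
      have : ‖a.2 - b.2‖ ^ 2 = 0 := le_antisymm (by nlinarith [sq_nonneg ‖a.1 - b.1‖]) (sq_nonneg _)
      exact pow_eq_zero_iff two_ne_zero |>.1 this
    exact Prod.ext (sub_eq_zero.1 (norm_eq_zero.1 h9)) (sub_eq_zero.1 (norm_eq_zero.1 h10))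
  · rw [h, h0, rhoArg, rs_self, rl_self, mul_zero, add_zero, min_eq_left (DK_nonneg K H), f_zero]
  · rw [h0, h0, rhoArg, rhoArg, rs_symm, rl_symm]
  · rw [h0, h0, h0]
    exact (hA.f_mono (rhoArg_nonneg hS H a c) (rhoArg_triangle hS H a b c)).trans
      (hA.f_subadditive (rhoArg_nonneg hS H a b) (rhoArg_nonneg hS H b c))

lemma euclDist_le_rho (hS : Spectral p K) (H : ParamBounds p) (a b : Phase d) :
    euclDist a b ≤ constN p (radius p K) * rho p K a b := by
  have hA := admissible hS H
  have hs := hA.slopePos hA.R_nonneg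
  have he := H.eps_pos
  have h1 := hA.le_f (rhoArg_nonneg hS H a b)
  have h2 := mul_le_mul_of_nonneg_left (eps_rl_le_rhoArg hS H a b) hs.le
  have h3 := euclDist_le_rl hS H a b
  have h5 : 0 < min (Real.sqrt p.κ) (Real.sqrt (1 / 2)) :=
    lt_min (Real.sqrt_pos.2 H.κ_pos) (by positivity)
  have h0 : rho p K a b = f p (radius p K) (rhoArg p K a b) := rho_eq p K a b
  rw [constN, fPrime_eq_slope, h0]
  set s := slope p (radius p K) (radius p K) with hsdef
  set m := min (Real.sqrt p.κ) (Real.sqrt (1 / 2)) with hm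
  have hγ := H.γ_pos
  calc euclDist a b ≤ s⁻¹ * (p.γ / (eps p * m)) * (s * (eps p * rl p K a b)) := by
        have : s⁻¹ * (p.γ / (eps p * m)) * (s * (eps p * rl p K a b)) = p.γ * rl p K a b / m := by
          field_simp
        rw [this, le_div_iff₀ h5, mul_comm]
        exact h3
    _ ≤ _ := by
        gcongr
        exact h2.trans h1

lemma rho_le_euclDist (hS : Spectral p K) (H : ParamBounds p) (a b : Phase d) :
    constN p (radius p K) * rho p K a b ≤ constM p (radius p K) * euclDist a b := by
  have hA := admissible hS H
  have hs := hA.slopePos hA.R_nonneg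
  have he := H.eps_pos
  have hγ := H.γ_pos
  have hα := H.alpha_pos
  have h5 : 0 < min (Real.sqrt p.κ) (Real.sqrt (1 / 2)) :=
    lt_min (Real.sqrt_pos.2 H.κ_pos) (by positivity)
  have h0 : rho p K a b = f p (radius p K) (rhoArg p K a b) := rho_eq p K a b
  have h1 : rho p K a b ≤ rs p a b := by
    rw [h0]; exact (hA.f_le (rhoArg_nonneg hS H a b)).trans (min_le_left _ _)
  have h2 : p.γ * rs p a b ≤ p.γ * (1 + alpha p) * ‖a.1 - b.1‖ + ‖a.2 - b.2‖ := by
    have h3 : ‖qvec p a b‖ ≤ ‖a.1 - b.1‖ + p.γ⁻¹ * ‖a.2 - b.2‖ := by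
      refine (norm_add_le _ _).trans_eq ?_
      rw [norm_smul, Real.norm_of_nonneg H.inv_pos.le]
    have h4 := mul_le_mul_of_nonneg_left h3 hγ.le
    have h6 : p.γ * (‖a.1 - b.1‖ + p.γ⁻¹ * ‖a.2 - b.2‖) = p.γ * ‖a.1 - b.1‖ + ‖a.2 - b.2‖ := by
      field_simp
    rw [rs_eq]
    linarith
  set Mx := max (p.γ * (1 + alpha p)) 1 with hMx
  have hMx0 : 0 < Mx := lt_of_lt_of_le one_pos (le_max_right _ _)
  have h3 : ‖a.1 - b.1‖ + ‖a.2 - b.2‖ ≤ Real.sqrt 2 * euclDist a b := by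
    rw [euclDist, ← Real.sqrt_mul (by norm_num)]
    apply Real.le_sqrt_of_sq_le
    nlinarith [sq_nonneg (‖a.1 - b.1‖ - ‖a.2 - b.2‖)]
  have h4 : p.γ * rs p a b ≤ Mx * (Real.sqrt 2 * euclDist a b) := by
    have h6 := mul_le_mul_of_nonneg_right (le_max_left (p.γ * (1 + alpha p)) 1)
      (norm_nonneg (a.1 - b.1))
    have h7 := mul_le_mul_of_nonneg_right (le_max_right (p.γ * (1 + alpha p)) 1)
      (norm_nonneg (a.2 - b.2))
    have h8 := mul_le_mul_of_nonneg_left h3 hMx0.le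
    linarith
  have hmin : min (Real.sqrt (2 * p.κ)) 1
      = Real.sqrt 2 * min (Real.sqrt p.κ) (Real.sqrt (1 / 2)) := by
    rw [mul_min_of_nonneg _ _ (Real.sqrt_nonneg 2), ← Real.sqrt_mul (by norm_num),
      ← Real.sqrt_mul (by norm_num)]
    norm_num
  rw [constN, constM, fPrime_eq_slope, hmin]
  set s := slope p (radius p K) (radius p K) with hsdef
  set m := min (Real.sqrt p.κ) (Real.sqrt (1 / 2)) with hm
  have h22 : Real.sqrt 2 * Real.sqrt 2 = 2 := Real.mul_self_sqrt (by norm_num)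
  have hs2 : 0 < Real.sqrt 2 := by positivity
  calc s⁻¹ * (p.γ / (eps p * m)) * rho p K a b ≤ s⁻¹ * (p.γ / (eps p * m)) * rs p a b := by gcongr
    _ = s⁻¹ * ((p.γ * rs p a b) / (eps p * m)) := by ring
    _ ≤ s⁻¹ * ((Mx * (Real.sqrt 2 * euclDist a b)) / (eps p * m)) := by gcongr
    _ = s⁻¹ * (2 * Mx / (eps p * (Real.sqrt 2 * m))) * euclDist a b := by
        have : 2 * Mx = Mx * Real.sqrt 2 * Real.sqrt 2 := by rw [mul_assoc, h22, mul_comm]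
        rw [this]; field_simp

lemma rate_le_rateBase (p : Params) (R₁ : ℝ) : rate p R₁ ≤ rateBase p R₁ := by
  unfold rate; split_ifs
  · exact le_rfl
  · exact min_le_left _ _

lemma rate_pos (H : ParamBounds p) {R₁ : ℝ} (hR : 0 ≤ R₁) : 0 < rate p R₁ := by
  have hA : Admissible p R₁ := ⟨H.γ_pos, H.alpha_pos, hR⟩
  have hs : 0 < fPrime p R₁ := by rw [fPrime_eq_slope]; exact hA.slopePos hR
  have h1 := H.γ_pos
  have h2 := H.alpha_pos
  have h3 := H.eps_pos
  have h4 := H.calE_pos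
  have h5 := H.inv_pos
  have h6 := H.κ_pos
  have hb : 0 < rateBase p R₁ :=
    lt_min (by positivity) (lt_min (by positivity) (lt_min (by positivity) (by positivity)))
  unfold rate
  split_ifs with h
  · exact hb
  · have := chat_pos H.γ_pos (hR.lt_of_ne (Ne.symm h))
    exact lt_min hb (lt_min (by positivity) (by positivity))

end

end

section

/-! ### One step of the coupled chains -/

section

variable {d : ℕ} {p : Params} {K : Matrix (Fin d) (Fin d) ℝ} {U G : Pos d → ℝ} {R₁ h : ℝ}

lemma StepCondition.damping (H : ParamBounds p) (hc : StepCondition p R₁ h) : p.γ * h ≤ 1 / 8 := by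
  have h1 := hc.2.2.1
  have hL := H.L_pos
  have hγ := H.γ_pos
  have h2 := mul_le_mul_of_nonneg_left h1 (by positivity : 0 ≤ p.γ ^ 2 / p.L)
  have e1 : p.γ ^ 2 / p.L * (p.L * p.γ⁻¹ * h) = p.γ * h := by field_simp
  have e2 : p.γ ^ 2 / p.L * (p.L * p.γ⁻¹ ^ 2 / 8) = 1 / 8 := by field_simp
  rwa [e1, e2] at h2

lemma StepCondition.stiffness (H : ParamBounds p) (hc : StepCondition p R₁ h) :
    p.γ⁻¹ * h * p.LK ≤ 1 / 32 := by
  have h1 := hc.2.2.2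
  have hL := H.L_pos
  have hγ := H.γ_pos
  have hK := H.LK_pos
  have h2 := mul_le_mul_of_nonneg_left h1 (by positivity : 0 ≤ p.LK / p.L)
  have e1 : p.LK / p.L * (p.L * p.γ⁻¹ * h) = p.γ⁻¹ * h * p.LK := by field_simp
  have e2 : p.LK / p.L * (p.L / (32 * p.LK)) = 1 / 32 := by field_simp
  rwa [e1, e2] at h2

lemma gamma_sq_mul_alpha (H : ParamBounds p) : p.γ ^ 2 * alpha p = 2 * p.L := by
  have hγ := H.γ_pos
  unfold alpha; field_simp

lemma StepCondition.drift (H : ParamBounds p) (hc : StepCondition p R₁ h) :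
    9600 * (alpha p + 1) * (h * p.γ * alpha p) ≤ 1 := by
  have h1 := hc.2.1
  have hα := H.alpha_pos
  have hγ := H.γ_pos
  have e1 : 2 * p.L * p.γ⁻¹ ^ 2 = alpha p := rfl
  have e2 : h * p.γ * alpha p = 2 * (p.L * p.γ⁻¹ * h) := by unfold alpha; field_simp
  rw [e1, le_div_iff₀ (by positivity)] at h1
  rw [e2]
  linarith

lemma StepCondition.radius_small (H : ParamBounds p) (hh : 0 < h) (hR : 0 ≤ R₁)
    (hc : StepCondition p R₁ h) :
    alpha p * p.γ ^ 2 * R₁ * Real.sqrt (2 * p.γ⁻¹ * h) ≤ 1 := by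
  rcases hR.eq_or_lt with rfl | hR
  · simp
  have h1 := hc.1 hR.ne'
  have hL := H.L_pos
  have hγ := H.inv_pos
  rw [le_div_iff₀ (by positivity)] at h1
  rw [mul_comm (alpha p), gamma_sq_mul_alpha H]
  have h2 : (2 * p.L * R₁ * Real.sqrt (2 * p.γ⁻¹ * h)) ^ 2 ≤ 1 ^ 2 := by
    rw [mul_pow, Real.sq_sqrt (by positivity)]
    linarith
  exact le_of_sq_le_sq h2 zero_le_one

lemma rate_le_damping (p : Params) (R₁ : ℝ) : rate p R₁ ≤ slope p R₁ R₁ * (p.γ / 8) := by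
  rw [← fPrime_eq_slope]
  exact (rate_le_rateBase p R₁).trans
    ((min_le_right _ _).trans ((min_le_right _ _).trans (min_le_left _ _)))

lemma rate_le_alpha (p : Params) (R₁ : ℝ) : rate p R₁ ≤ slope p R₁ R₁ * (p.γ * alpha p / 2) := by
  rw [← fPrime_eq_slope]
  exact (rate_le_rateBase p R₁).trans
    ((min_le_right _ _).trans ((min_le_right _ _).trans (min_le_right _ _)))

/-- The two entries of the minimum in `τ` correspond to the first two terms of `c`. -/
lemma rate_le_tau (H : ParamBounds p) (R₁ : ℝ) :
    rate p R₁ ≤ slope p R₁ R₁ * (eps p * (tau p * p.γ / 2)) * calE p := by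
  have hγ := H.γ_pos
  rw [← fPrime_eq_slope]
  refine (rate_le_rateBase p R₁).trans ?_
  unfold tau
  rcases min_cases (1 / 8 : ℝ) (p.γ⁻¹ ^ 2 * p.κ / 4) with ⟨h, _⟩ | ⟨h, _⟩
  · rw [h]
    refine ((min_le_right _ _).trans (min_le_left _ _)).trans_eq ?_
    ring
  · rw [h]
    refine (min_le_left _ _).trans_eq ?_
    field_simp
    ring

lemma rate_mul_le_one (H : ParamBounds p) (hR : 0 ≤ R₁) (hh : 0 < h) (hc : StepCondition p R₁ h) :
    rate p R₁ * h ≤ 1 := by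
  have hA : Admissible p R₁ := ⟨H.γ_pos, H.alpha_pos, hR⟩
  have h1 := mul_le_mul_of_nonneg_right (rate_le_damping p R₁) hh.le
  have h2 := hA.slope_le_one hR
  have h3 := hc.damping H
  have h4 := mul_le_mul_of_nonneg_right h2 (mul_nonneg H.γ_pos.le hh.le)
  linarith

lemma stepData (hS : Spectral p K) (H : ParamBounds p) (hh : 0 < h)
    (hc : StepCondition p (radius p K) h) {a b : Phase d} (hnear : Del p K a b ≤ DK p K) :
    StepData p (radius p K) (Real.sqrt (2 * p.γ⁻¹ * h)) h ‖a.1 - b.1‖ ‖qvec p a b‖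
      (rate p (radius p K)) := by
  have hA := admissible hS H
  have hγ := H.γ_pos
  exact
    { adm := hA
      σ_pos := Real.sqrt_pos.2 (mul_pos (mul_pos two_pos H.inv_pos) hh)
      h_pos := hh
      σ_sq := by
        rw [Real.sq_sqrt (mul_pos (mul_pos two_pos H.inv_pos) hh).le]
        field_simp
      drift_small := hc.drift H
      radius_small := hc.radius_small H hh hA.R_nonneg
      damping_small := hc.damping H
      A_nonneg := norm_nonneg _
      B_nonneg := norm_nonneg _
      le_radius := rs_le_radius hS H hnear
      c_nonneg := (rate_pos H hA.R_nonneg).le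
      c_le₁ := rate_le_damping _ _
      c_le₂ := rate_le_alpha _ _ }

/-- One step of the two copies, driven by `x = (ξ, u)`. -/
def pairStep (p : Params) (K : Matrix (Fin d) (Fin d) ℝ) (U : Pos d → ℝ) (h : ℝ)
    (s : Phase d × Phase d) (x : Pos d × ℝ) : Phase d × Phase d :=
  (emStep p.γ h U s.1 x.1, emStep p.γ h U s.2 (coupledNoise p K h s.1 s.2 x.1 x.2))

/-- The contraction is pathwise: the decrease of `ε r_l` passes through `f` with slope at least
`f'(R₁)`, and it is compared with `f ≤ r_s ≤ r_l/ℰ`. -/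
lemma rho_pairStep_far (hU : PotentialAssumption p U) (hS : Splitting p U K G)
    (H : ParamBounds p) (hh : 0 < h) (hc : StepCondition p (radius p K) h) {a b : Phase d}
    (hfar : DK p K + eps p * rl p K a b ≤ rs p a b) (x : Pos d × ℝ) :
    rho p K (pairStep p K U h (a, b) x).1 (pairStep p K U h (a, b) x).2
      ≤ (1 - rate p (radius p K) * h) * rho p K a b := by
  have hSp := hS.spectral
  have hA := admissible hSp H
  have hg : ‖∇ G a.1 - ∇ G b.1‖ ≤ p.LG * ‖a.1 - b.1‖ := hS.lipschitz _ _
  have hτ := H.tau_pos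
  have hγ := H.γ_pos
  have hsf : 0 ≤ setForm p (a.1 - b.1) (p.γ⁻¹ • (a.2 - b.2)) := by
    have := H.κ_pos; unfold setForm; positivity
  have hzg : -(inner ℝ (a.1 - b.1) (∇ G a.1 - ∇ G b.1))
      ≤ p.γ ^ 2 * tau p * setForm p (a.1 - b.1) (p.γ⁻¹ • (a.2 - b.2)) := by
    by_cases hab : a = b
    · have h1 : (inner ℝ (a.1 - b.1) (∇ G a.1 - ∇ G b.1) : ℝ) = 0 := by
        rw [hab, sub_self, inner_zero_left]
      rw [h1, neg_zero]
      exact mul_nonneg (by positivity) hsf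
    rcases lt_or_ge p.R ‖a.1 - b.1‖ with hR | hR
    · have h1 := hS.convex_outside _ _ hR
      rw [real_inner_comm]
      have := mul_nonneg (by positivity : 0 ≤ p.γ ^ 2 * tau p) hsf
      linarith
    -- Within radius `R` the defect is at most `L_G R² = γ²τℛ`; this identity is the reason for the
    -- choice of `ℛ`.
    · have h1 := (abs_le.1 (abs_real_inner_le_norm (a.1 - b.1) (∇ G a.1 - ∇ G b.1))).1
      have h2 := mul_le_mul_of_nonneg_left hg (norm_nonneg (a.1 - b.1))
      have h3 : ‖a.1 - b.1‖ ^ 2 ≤ p.R ^ 2 := pow_le_pow_left₀ (norm_nonneg _) hR 2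
      have h4 := mul_le_mul_of_nonneg_left h3 H.LG_nonneg
      have h5 : p.γ ^ 2 * tau p * calR p = p.LG * p.R ^ 2 := by unfold calR; field_simp
      have h6 := mul_le_mul_of_nonneg_left
        (calR_le_setForm hSp H hab (by unfold Del; linarith)) (by positivity : 0 ≤ p.γ ^ 2 * tau p)
      linarith
  have hgrad : ∇ U a.1 - ∇ U b.1 = act K (a.1 - b.1) + (∇ G a.1 - ∇ G b.1) := by
    rw [hS.gradient_eq hU.differentiable, hS.gradient_eq hU.differentiable, map_sub]
    abel
  have hrl := rl_emStep_le hSp H hh (hc.damping H) (hc.stiffness H) hgrad hg hzg x.1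
  set R₁ := radius p K with hR₁
  set r := rl p K a b with hr
  set D := DK p K with hD
  have hD0 : 0 ≤ D := DK_nonneg K H
  have hr0 : 0 ≤ r := rl_nonneg p K a b
  have hε := H.eps_pos
  have hs := hA.slopePos hA.R_nonneg
  set η := tau p * p.γ * h / 2 with hη
  have hη0 : 0 ≤ η := by positivity
  have hη1 : η ≤ 1 := by
    have h1 := tau_le p
    have h2 := hc.damping H
    have h3 : tau p * (p.γ * h) ≤ 1 / 8 * (1 / 8) := by gcongr
    rw [hη]; linarith
  have e1 : rho p K (pairStep p K U h (a, b) x).1 (pairStep p K U h (a, b) x).2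
      ≤ f p R₁ (D + eps p * ((1 - η) * r)) := by
    rw [rho_eq]
    simp only [pairStep, coupledNoise_far hfar]
    have h0 : 0 ≤ min (rs p (emStep p.γ h U a x.1) (emStep p.γ h U b x.1))
        (D + eps p * rl p K (emStep p.γ h U a x.1) (emStep p.γ h U b x.1)) :=
      rhoArg_nonneg hSp H _ _
    refine hA.f_mono h0 ((min_le_right _ _).trans ?_)
    gcongr
  have e2 : rho p K a b = f p R₁ (D + eps p * r) := by rw [rho_eq, min_eq_right hfar]
  have hx0 : 0 ≤ D + eps p * ((1 - η) * r) :=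
    add_nonneg hD0 (mul_nonneg hε.le (mul_nonneg (sub_nonneg.2 hη1) hr0))
  have hxy : D + eps p * ((1 - η) * r) ≤ D + eps p * r := by
    have := mul_nonneg hε.le (mul_nonneg hη0 hr0)
    linarith
  have e3 := hA.f_sub_ge hx0 hxy
  have e4 : f p R₁ (D + eps p * r) ≤ rs p a b := (hA.f_le (hx0.trans hxy)).trans hfar
  have e5 := mul_le_mul_of_nonneg_left e4 (mul_nonneg (rate_pos H hA.R_nonneg).le hh.le)
  have e6 := mul_le_mul_of_nonneg_right (rate_le_tau H R₁)
    (mul_nonneg hh.le (rs_nonneg H a b))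
  have e7 := mul_le_mul_of_nonneg_left (calE_rs_le hSp H a b)
    (by positivity : 0 ≤ slope p R₁ R₁ * (eps p * η))
  rw [e2]
  rw [hη] at e1 e3 e7
  linarith

end

end

section

/-! ### Measurability of the coupling and the one-step contraction -/

section

variable {d : ℕ} {p : Params} {K : Matrix (Fin d) (Fin d) ℝ} {U G : Pos d → ℝ} {h : ℝ}

lemma PotentialAssumption.measurable_gradient (hU : PotentialAssumption p U) :
    Measurable (∇ U) := by
  have h1 : LipschitzWith p.L.toNNReal (∇ U) := by
    apply LipschitzWith.of_dist_le_mul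
    intro x y
    rw [dist_eq_norm, dist_eq_norm]
    exact (hU.lipschitz x y).trans
      (mul_le_mul_of_nonneg_right (Real.le_coe_toNNReal _) (norm_nonneg _))
  exact h1.continuous.measurable

lemma continuous_rs (p : Params) : Continuous fun s : Phase d × Phase d => rs p s.1 s.2 := by
  unfold rs; fun_prop

lemma continuous_rl (p : Params) (K : Matrix (Fin d) (Fin d) ℝ) :
    Continuous fun s : Phase d × Phase d => rl p K s.1 s.2 := by
  unfold rl; fun_prop

lemma measurable_rho (p : Params) (K : Matrix (Fin d) (Fin d) ℝ) :
    Measurable fun s : Phase d × Phase d => rho p K s.1 s.2 := by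
  simp only [rho, Del]
  have h1 := continuous_rs (d := d) p
  have h2 := continuous_rl p K
  have h3 := continuous_f p (radius p K)
  exact (h3.comp (((h1.sub (continuous_const.mul h2)).min continuous_const).add
    (continuous_const.mul h2))).measurable

lemma measurable_emStep (hU : PotentialAssumption p U) (γ h : ℝ) :
    Measurable fun x : Phase d × Pos d => emStep γ h U x.1 x.2 := by
  have h1 := hU.measurable_gradient
  unfold emStep
  fun_prop

lemma measurable_coupledNoise (p : Params) (K : Matrix (Fin d) (Fin d) ℝ) (h : ℝ) :
    Measurable fun x : (Phase d × Phase d) × (Pos d × ℝ) =>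
      coupledNoise p K h x.1.1 x.1.2 x.2.1 x.2.2 := by
  have h1 := (continuous_rs (d := d) p).measurable
  have h2 := (continuous_rl p K).measurable
  have hg := measurable_gaussianPDFReal 0 1
  have hq : Measurable fun x : (Phase d × Phase d) × (Pos d × ℝ) =>
      (x.1.1.1 - x.1.2.1) + p.γ⁻¹ • (x.1.1.2 - x.1.2.2) := by fun_prop
  have he : Measurable fun x : (Phase d × Phase d) × (Pos d × ℝ) =>
      ‖(x.1.1.1 - x.1.2.1) + p.γ⁻¹ • (x.1.1.2 - x.1.2.2)‖⁻¹ •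
        ((x.1.1.1 - x.1.2.1) + p.γ⁻¹ • (x.1.1.2 - x.1.2.2)) := hq.norm.inv.smul hq
  have hi : Measurable fun x : (Phase d × Phase d) × (Pos d × ℝ) =>
      (inner ℝ (‖(x.1.1.1 - x.1.2.1) + p.γ⁻¹ • (x.1.1.2 - x.1.2.2)‖⁻¹ •
        ((x.1.1.1 - x.1.2.1) + p.γ⁻¹ • (x.1.1.2 - x.1.2.2))) x.2.1 : ℝ) :=
    he.inner (measurable_fst.comp measurable_snd)
  have hξ : Measurable fun x : (Phase d × Phase d) × (Pos d × ℝ) => x.2.1 := by fun_prop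
  have hu : Measurable fun x : (Phase d × Phase d) × (Pos d × ℝ) => x.2.2 := by fun_prop
  unfold coupledNoise
  refine Measurable.ite ?_ hξ (Measurable.ite ?_ ?_ ?_)
  · exact measurableSet_le ((measurable_const.add (measurable_const.mul (h2.comp measurable_fst))))
      (h1.comp measurable_fst)
  · exact measurableSet_le hu ((hg.comp (hi.add (measurable_const.mul hq.norm))).div (hg.comp hi))
  · exact hξ.add (hq.fun_const_smul _)
  · exact hξ.sub ((measurable_const.mul hi).smul he)

lemma measurable_pairStep (hU : PotentialAssumption p U) (K : Matrix (Fin d) (Fin d) ℝ) (h : ℝ) :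
    Measurable fun x : (Phase d × Phase d) × (Pos d × ℝ) => pairStep p K U h x.1 x.2 := by
  have h1 := measurable_emStep hU p.γ h
  have h2 := measurable_coupledNoise p K h
  unfold pairStep
  exact (h1.comp (by fun_prop :
    Measurable fun x : (Phase d × Phase d) × (Pos d × ℝ) => (x.1.1, x.2.1))).prodMk
    (h1.comp ((by fun_prop :
      Measurable fun x : (Phase d × Phase d) × (Pos d × ℝ) => x.1.2).prodMk h2))

/-- The law of the driving noise of one step. -/
def noiseLaw (d : ℕ) : Measure (Pos d × ℝ) := (stdGaussian (Pos d)).prod unif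

instance : IsProbabilityMeasure (noiseLaw d) := by unfold noiseLaw; infer_instance

lemma reflectedVar_zero {Ω : Type*} [MeasurableSpace Ω] (P : Measure Ω) [IsProbabilityMeasure P]
    (σ : ℝ) : ReflectedVar P σ 0 fun _ : Ω => (0 : ℝ) where
  meas := measurable_const
  nonneg _ := le_rfl
  integrable := integrable_const _
  mean := by simp
  fail := by simp
  low x hx hx0 := by
    have : x = 0 := le_antisymm hx0 hx
    simp [this]
    norm_num

lemma ReflectedVar.of_map {Ω Ω' : Type*} [MeasurableSpace Ω] [MeasurableSpace Ω'] {P : Measure Ω}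
    {σ B : ℝ} {Y : Ω' → ℝ} {T : Ω → Ω'} (hY : ReflectedVar (P.map T) σ B Y) (hT : Measurable T) :
    ReflectedVar P σ B fun ω => Y (T ω) where
  meas := hY.meas.comp hT
  nonneg ω := hY.nonneg _
  integrable := hY.integrable.comp_measurable hT
  mean := by
    rw [← hY.mean, integral_map hT.aemeasurable hY.meas.aestronglyMeasurable]
  fail := by
    have h := hY.fail
    have hm : MeasurableSet {ω | Y ω ≠ 0} := hY.meas (measurableSet_singleton 0).compl
    rwa [map_measureReal_apply hT hm] at h
  low x hx hxB := by
    have h := hY.low x hx hxB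
    rwa [map_measureReal_apply hT (measurableSet_le hY.meas measurable_const)] at h

lemma map_inner_noiseLaw {e : Pos d} (he : ‖e‖ = 1) :
    (noiseLaw d).map (fun x => ((inner ℝ e x.1 : ℝ), x.2)) = (gaussianReal 0 1).prod unif := by
  have h1 : Measurable fun x : Pos d => (inner ℝ e x : ℝ) := by fun_prop
  have h2 := Measure.map_prod_map (stdGaussian (Pos d)) unif h1 measurable_id
  rw [map_inner_stdGaussian he, Measure.map_id] at h2
  exact h2.symm

lemma rho_pairStep_near_le (hU : PotentialAssumption p U) (hS : Spectral p K)
    (H : ParamBounds p) (hh : 0 < h) (hc : StepCondition p (radius p K) h) (a b : Phase d)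
    (x : Pos d × ℝ) :
    rho p K (pairStep p K U h (a, b) x).1 (pairStep p K U h (a, b) x).2
      ≤ f p (radius p K) (alpha p * (1 - h * p.γ / 2) * ‖a.1 - b.1‖
        + h * p.γ * alpha p * ‖qvec p a b‖
        + ‖qvec p a b + Real.sqrt (2 * p.γ⁻¹ * h) • (x.1 - coupledNoise p K h a b x.1 x.2)‖) := by
  rw [rho_eq]
  refine (admissible hS H).f_mono (rhoArg_nonneg hS H _ _) ((min_le_left _ _).trans ?_)
  exact rs_emStep_le H hh (hc.damping H) (hU.lipschitz _ _) _ _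

/-- The length `Y` of `q` after the noise depends on `ξ` only through its component along `q`, so
the scalar estimate applies; for `q = 0` it vanishes identically. -/
lemma integrable_rho_pairStep_near (hU : PotentialAssumption p U) (hS : Spectral p K)
    (H : ParamBounds p) (hh : 0 < h) (hc : StepCondition p (radius p K) h) {a b : Phase d}
    (hnear : ¬ DK p K + eps p * rl p K a b ≤ rs p a b) :
    Integrable (fun x => rho p K (pairStep p K U h (a, b) x).1 (pairStep p K U h (a, b) x).2)
        (noiseLaw d) ∧
      ∫ x, rho p K (pairStep p K U h (a, b) x).1 (pairStep p K U h (a, b) x).2 ∂(noiseLaw d)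
        ≤ (1 - rate p (radius p K) * h) * rho p K a b := by
  have hA := admissible hS H
  have hDel : Del p K a b ≤ DK p K := by unfold Del; linarith [not_le.1 hnear]
  have D := stepData hS H hh hc hDel
  set σ := Real.sqrt (2 * p.γ⁻¹ * h) with hσ
  set A := ‖a.1 - b.1‖ with hAdef
  set B := ‖qvec p a b‖ with hB
  set Y : Pos d × ℝ → ℝ := fun x => ‖qvec p a b + σ • (x.1 - coupledNoise p K h a b x.1 x.2)‖ with hY
  have hYr : ReflectedVar (noiseLaw d) σ B Y := by
    by_cases hq : qvec p a b = 0
    · have h1 : Y = fun _ => 0 := by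
        ext x
        rw [hY]
        simp only [coupledNoise_zero hq, hq, sub_self, smul_zero, add_zero, norm_zero]
      rw [h1, hB, hq, norm_zero]
      exact reflectedVar_zero _ _
    · have h1 : Y = fun x => residual σ B (inner ℝ (evec p a b) x.1) x.2 := by
        ext x
        exact norm_reflected_step hnear hq D.σ_pos hσ x.1 x.2
      rw [h1]
      have h2 := reflectedVar_residual D.σ_pos D.B_nonneg
      have h3 : Measurable fun x : Pos d × ℝ => ((inner ℝ (evec p a b) x.1 : ℝ), x.2) := by fun_prop
      rw [← map_inner_noiseLaw (norm_evec hq)] at h2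
      exact h2.of_map h3
  have hint : Integrable (fun x => f p (radius p K)
      (alpha p * (1 - h * p.γ / 2) * A + h * p.γ * alpha p * B + Y x)) (noiseLaw d) := by
    refine hA.integrable_f_comp (measurable_const.add hYr.meas) (fun x => ?_)
      ((integrable_const _).add hYr.integrable)
    have h1 := D.damping_small
    have h2 := hYr.nonneg x
    have h3 : 0 ≤ alpha p * (1 - h * p.γ / 2) * A :=
      mul_nonneg (mul_nonneg hA.α_pos.le (by linarith)) D.A_nonneg
    have h4 : 0 ≤ h * p.γ * alpha p * B :=
      mul_nonneg (mul_nonneg (mul_nonneg hh.le hA.γ_pos.le) hA.α_pos.le) D.B_nonneg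
    linarith
  have hle := rho_pairStep_near_le (U := U) hU hS H hh hc a b
  have hmeas : Measurable fun x : Pos d × ℝ =>
      rho p K (pairStep p K U h (a, b) x).1 (pairStep p K U h (a, b) x).2 :=
    (measurable_rho p K).comp ((measurable_pairStep hU K h).comp measurable_prodMk_left)
  have hint' : Integrable (fun x => rho p K (pairStep p K U h (a, b) x).1
      (pairStep p K U h (a, b) x).2) (noiseLaw d) := by
    refine hint.mono' hmeas.aestronglyMeasurable (Filter.Eventually.of_forall fun x => ?_)
    rw [Real.norm_of_nonneg ((isMetric_rho hS H).nonneg _ _)]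
    exact hle x
  refine ⟨hint', (integral_mono hint' hint hle).trans ?_⟩
  refine (D.contraction hYr).trans_eq ?_
  rw [rho_eq, min_eq_left (not_le.1 hnear).le]
  rfl

/-- One step of the coupled chains contracts the distance `ρ` on average. -/
theorem lintegral_rho_pairStep_le (hU : PotentialAssumption p U) (hS : Splitting p U K G)
    (H : ParamBounds p) (hh : 0 < h) (hc : StepCondition p (radius p K) h) (s : Phase d × Phase d) :
    ∫⁻ x, ENNReal.ofReal (rho p K (pairStep p K U h s x).1 (pairStep p K U h s x).2) ∂(noiseLaw d)
      ≤ ENNReal.ofReal (1 - rate p (radius p K) * h) * ENNReal.ofReal (rho p K s.1 s.2) := by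
  obtain ⟨a, b⟩ := s
  have hA := admissible hS.spectral H
  have hr := rate_mul_le_one H hA.R_nonneg hh hc
  have hm := isMetric_rho hS.spectral H
  rw [← ENNReal.ofReal_mul (by linarith)]
  by_cases hfar : DK p K + eps p * rl p K a b ≤ rs p a b
  · refine (lintegral_mono fun x =>
      ENNReal.ofReal_le_ofReal (rho_pairStep_far hU hS H hh hc hfar x)).trans_eq ?_
    rw [lintegral_const, measure_univ, mul_one]
  · obtain ⟨h1, h2⟩ := integrable_rho_pairStep_near hU hS.spectral H hh hc hfar
    rw [← ofReal_integral_eq_lintegral_ofReal h1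
      (Filter.Eventually.of_forall fun x => hm.nonneg _ _)]
    exact ENNReal.ofReal_le_ofReal h2

end

end

section

/-! ### Independence from the past -/

section

variable {Ω E F W : Type*} [MeasurableSpace Ω] [MeasurableSpace E] [MeasurableSpace F]
  [MeasurableSpace W] {P : Measure Ω} [IsProbabilityMeasure P]

/-- If the law of `g w N` does not depend on `w`, then `g X N` has this law and is independent of
`X`, for `X` independent of `N`. -/
lemma indepFun_and_map_of_forall_map_eq {X : Ω → W} {N : Ω → E} (hX : Measurable X)
    (hN : Measurable N) (hXN : IndepFun X N P) {g : W → E → F}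
    (hg : Measurable (Function.uncurry g)) {ν : Measure F} [SFinite ν]
    (hν : ∀ w, (P.map N).map (g w) = ν) :
    IndepFun X (fun ω => g (X ω) (N ω)) P ∧ P.map (fun ω => g (X ω) (N ω)) = ν := by
  have : IsProbabilityMeasure (P.map X) := Measure.isProbabilityMeasure_map hX.aemeasurable
  have : IsProbabilityMeasure (P.map N) := Measure.isProbabilityMeasure_map hN.aemeasurable
  have h1 := (indepFun_iff_map_prod_eq_prod_map_map hX.aemeasurable hN.aemeasurable).1 hXN
  -- The map `(w, n) ↦ (w, g w n)` sends the product law to a product law, as each section has image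
  -- `ν`.
  have h2 : MeasurePreserving (fun x : W × E => (x.1, g x.1 x.2)) ((P.map X).prod (P.map N))
      ((P.map X).prod ν) :=
    (MeasurePreserving.id (P.map X)).skew_product hg (Filter.Eventually.of_forall hν)
  have hgm : Measurable fun ω => g (X ω) (N ω) := hg.comp (hX.prodMk hN)
  have h3 : P.map (fun ω => (X ω, g (X ω) (N ω))) = (P.map X).prod ν := by
    rw [← h2.map_eq, ← h1, Measure.map_map h2.measurable (hX.prodMk hN)]
    rfl
  have h4 : P.map (fun ω => g (X ω) (N ω)) = ν := by
    have h5 := congrArg (Measure.map Prod.snd) h3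
    rw [Measure.map_map measurable_snd (hX.prodMk hgm), Measure.map_snd_prod, measure_univ,
      one_smul] at h5
    exact h5
  refine ⟨?_, h4⟩
  rw [indepFun_iff_map_prod_eq_prod_map_map hX.aemeasurable hgm.aemeasurable, h3, h4]

/-- A sequence is independent if each member is independent of the tuple of its predecessors. -/
lemma iIndepFun_of_indepFun_past {X : ℕ → Ω → F}
    (h : ∀ n, IndepFun (fun ω (i : Finset.range n) => X i ω) (X n) P) : iIndepFun X P := by
  rw [iIndepFun_iff_measure_inter_preimage_eq_mul]
  intro S
  induction S using Finset.induction_on_max with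
  | empty => intro sets _; simp
  | insert n S hn ih =>
    intro sets hsets
    have hnS : n ∉ S := fun hmem => lt_irrefl n (hn n hmem)
    rw [Finset.prod_insert hnS, ← ih fun i hi => hsets i (Finset.mem_insert_of_mem hi),
      Finset.set_biInter_insert, mul_comm, Set.inter_comm]
    have h1 : (⋂ i ∈ S, X i ⁻¹' sets i)
        = (fun ω (i : Finset.range n) => X i ω) ⁻¹'
          {x | ∀ i : Finset.range n, (i : ℕ) ∈ S → x i ∈ sets i} := by
      ext ω
      simp only [Set.mem_iInter, Set.mem_preimage, Set.mem_ofPred_eq]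
      exact ⟨fun H i hi => H i hi, fun H i hi => H ⟨i, Finset.mem_range.2 (hn i hi)⟩ hi⟩
    have h2 : MeasurableSet {x : Finset.range n → F | ∀ i : Finset.range n, (i : ℕ) ∈ S → x i ∈ sets i} := by
      have : {x : Finset.range n → F | ∀ i : Finset.range n, (i : ℕ) ∈ S → x i ∈ sets i}
          = ⋂ i : Finset.range n, ⋂ _ : (i : ℕ) ∈ S, (fun x => x i) ⁻¹' sets i := by
        ext x; simp
      rw [this]
      exact MeasurableSet.iInter fun i => MeasurableSet.iInter fun hi =>
        measurable_pi_apply i (hsets i (Finset.mem_insert_of_mem hi))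
    rw [h1]
    exact (h n).measure_inter_preimage_eq_mul _ _ h2 (hsets n (Finset.mem_insert_self _ _))

open scoped Classical in
/-- The sequence `N` up to time `k`, and a constant afterwards. -/
def pastOf (e : E) (N : ℕ → Ω → E) (k : ℕ) (ω : Ω) (j : ℕ) : E := if j ≤ k then N j ω else e

omit [MeasurableSpace Ω] [MeasurableSpace E] in
lemma pastOf_of_le (e : E) (N : ℕ → Ω → E) {j k : ℕ} (hjk : j ≤ k) (ω : Ω) :
    pastOf e N k ω j = N j ω := if_pos hjk

lemma measurable_pastOf (e : E) {N : ℕ → Ω → E} (hN : ∀ k, Measurable (N k)) (k : ℕ) :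
    Measurable (pastOf e N k) := by
  refine measurable_pi_lambda _ fun j => ?_
  unfold pastOf
  split_ifs
  · exact hN j
  · exact measurable_const

omit [IsProbabilityMeasure P] in
lemma indepFun_pastOf (e : E) {N : ℕ → Ω → E} (hN : ∀ k, Measurable (N k)) (hi : iIndepFun N P)
    (k : ℕ) : IndepFun (pastOf e N k) (N (k + 1)) P := by
  have h1 := hi.indepFun_finset (Finset.range (k + 1)) {k + 1} (by simp) hN
  let F₁ : (Finset.range (k + 1) → E) → ℕ → E := fun x j =>
    if hj : j ∈ Finset.range (k + 1) then x ⟨j, hj⟩ else e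
  have hF₁ : Measurable F₁ := by
    refine measurable_pi_lambda _ fun j => ?_
    by_cases hj : j ∈ Finset.range (k + 1)
    · simp only [F₁, dif_pos hj]; exact measurable_pi_apply _
    · simp only [F₁, dif_neg hj]; exact measurable_const
  have h2 := h1.comp hF₁
    (measurable_pi_apply (⟨k + 1, Finset.mem_singleton_self _⟩ : ({k + 1} : Finset ℕ)))
  have h3 : pastOf e N k = F₁ ∘ fun ω (i : Finset.range (k + 1)) => N i ω := by
    ext ω j
    by_cases hj : j ≤ k
    · have hj' : j ∈ Finset.range (k + 1) := Finset.mem_range.2 (Nat.lt_succ_of_le hj)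
      simp only [pastOf, if_pos hj, Function.comp, F₁, dif_pos hj']
    · have hj' : j ∉ Finset.range (k + 1) := by rw [Finset.mem_range]; omega
      simp only [pastOf, if_neg hj, Function.comp, F₁, dif_neg hj']
  rw [h3]
  exact h2

end

/-! ### The coupled chains -/

section

variable {d : ℕ} {p : Params} {K : Matrix (Fin d) (Fin d) ℝ} {U G : Pos d → ℝ} {h : ℝ}
  {a b : Phase d} {Ω : Type*} [MeasurableSpace Ω] {P : Measure Ω} [IsProbabilityMeasure P]
  {ξ : ℕ → Ω → Pos d} {u : ℕ → Ω → ℝ}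

/-- The coupled chains as a function of the sequence of inputs. -/
def chainOf (p : Params) (K : Matrix (Fin d) (Fin d) ℝ) (U : Pos d → ℝ) (h : ℝ) (a b : Phase d)
    (k : ℕ) (s : ℕ → Pos d × ℝ) : Phase d × Phase d :=
  chain p K U h a b (fun j => (s j).1) (fun j => (s j).2) k

lemma chainOf_succ (p : Params) (K : Matrix (Fin d) (Fin d) ℝ) (U : Pos d → ℝ) (h : ℝ)
    (a b : Phase d) (k : ℕ) (s : ℕ → Pos d × ℝ) :
    chainOf p K U h a b (k + 1) s = pairStep p K U h (chainOf p K U h a b k s) (s (k + 1)) := rfl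

lemma chainOf_congr {k : ℕ} {s t : ℕ → Pos d × ℝ} (hst : ∀ j ≤ k, s j = t j) :
    chainOf p K U h a b k s = chainOf p K U h a b k t := by
  induction k with
  | zero => rfl
  | succ k ih => rw [chainOf_succ, chainOf_succ, ih fun j hj => hst j (by omega), hst _ le_rfl]

lemma measurable_chainOf (hU : PotentialAssumption p U) (K : Matrix (Fin d) (Fin d) ℝ) (h : ℝ)
    (a b : Phase d) (k : ℕ) : Measurable (chainOf p K U h a b k) := by
  induction k with
  | zero => exact measurable_const
  | succ k ih => exact (measurable_pairStep hU K h).comp (ih.prodMk (measurable_pi_apply (k + 1)))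

lemma measurable_coupledNoise_comp {α : Type*} [MeasurableSpace α] (p : Params)
    (K : Matrix (Fin d) (Fin d) ℝ) (h : ℝ) {S : α → Phase d × Phase d} {N : α → Pos d × ℝ}
    (hS : Measurable S) (hN : Measurable N) :
    Measurable fun x => coupledNoise p K h (S x).1 (S x).2 (N x).1 (N x).2 := by
  have h1 := measurable_coupledNoise p K h
  have h2 := hS.prodMk hN
  generalize coupledNoise p K h = F at *
  exact h1.comp h2

/-- The second increment as a function of the sequence of inputs. -/
def secondNoiseOf (p : Params) (K : Matrix (Fin d) (Fin d) ℝ) (U : Pos d → ℝ) (h : ℝ)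
    (a b : Phase d) (k : ℕ) (s : ℕ → Pos d × ℝ) : Pos d :=
  coupledNoise p K h (chainOf p K U h a b k s).1 (chainOf p K U h a b k s).2
    (s (k + 1)).1 (s (k + 1)).2

lemma secondNoiseOf_congr {k : ℕ} {s t : ℕ → Pos d × ℝ} (hst : ∀ j ≤ k + 1, s j = t j) :
    secondNoiseOf p K U h a b k s = secondNoiseOf p K U h a b k t := by
  rw [secondNoiseOf, secondNoiseOf, chainOf_congr fun j hj => hst j (by omega), hst _ le_rfl]

lemma measurable_secondNoiseOf (hU : PotentialAssumption p U) (K : Matrix (Fin d) (Fin d) ℝ)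
    (h : ℝ) (a b : Phase d) (k : ℕ) : Measurable (secondNoiseOf p K U h a b k) :=
  measurable_coupledNoise_comp p K h (measurable_chainOf hU K h a b k)
    (measurable_pi_apply (k + 1))

/-- The pair of inputs at time `k`. -/
def inputs (ξ : ℕ → Ω → Pos d) (u : ℕ → Ω → ℝ) (k : ℕ) (ω : Ω) : Pos d × ℝ := (ξ k ω, u k ω)

/-- The inputs up to time `k`. -/
def pastInputs (ξ : ℕ → Ω → Pos d) (u : ℕ → Ω → ℝ) (k : ℕ) (ω : Ω) : ℕ → Pos d × ℝ :=
  pastOf 0 (inputs ξ u) k ω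

omit [MeasurableSpace Ω] in
lemma chainOf_pastInputs (k : ℕ) (ω : Ω) :
    chainOf p K U h a b k (pastInputs ξ u k ω)
      = chainOf p K U h a b k (fun j => inputs ξ u j ω) :=
  chainOf_congr fun _ hj => pastOf_of_le _ _ hj ω

namespace IsDrivingNoise

variable (hN : IsDrivingNoise P ξ u)

include hN

omit [IsProbabilityMeasure P] in
lemma measurable_inputs (k : ℕ) : Measurable (inputs ξ u k) :=
  (hN.measurable_ξ k).prodMk (hN.measurable_u k)

lemma map_inputs (k : ℕ) : P.map (inputs ξ u k) = noiseLaw d := by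
  have h1 := (indepFun_iff_map_prod_eq_prod_map_map (hN.measurable_ξ k).aemeasurable
    (hN.measurable_u k).aemeasurable).1 (hN.indep_pair k)
  rw [hN.law_ξ, hN.law_u] at h1
  exact h1

omit [IsProbabilityMeasure P] in
lemma measurable_pastInputs (k : ℕ) : Measurable (pastInputs ξ u k) :=
  measurable_pastOf 0 hN.measurable_inputs k

omit [IsProbabilityMeasure P] in
lemma indepFun_pastInputs (k : ℕ) : IndepFun (pastInputs ξ u k) (inputs ξ u (k + 1)) P :=
  indepFun_pastOf 0 hN.measurable_inputs hN.indep k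

/-- The states at time `k` are functions of the inputs up to `k`, and for any frozen states
`map_coupledNoise` gives the same law. -/
lemma secondNoise_spec (hU : PotentialAssumption p U) (K : Matrix (Fin d) (Fin d) ℝ) (h : ℝ)
    (a b : Phase d) (k : ℕ) :
    IndepFun (pastInputs ξ u k)
        (fun ω => secondNoiseOf p K U h a b k fun j => inputs ξ u j ω) P ∧
      P.map (fun ω => secondNoiseOf p K U h a b k fun j => inputs ξ u j ω)
        = stdGaussian (Pos d) := by
  have h1 := indepFun_and_map_of_forall_map_eq (hN.measurable_pastInputs k)
    (hN.measurable_inputs (k + 1)) (hN.indepFun_pastInputs k)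
    (g := fun s x => coupledNoise p K h (chainOf p K U h a b k s).1
      (chainOf p K U h a b k s).2 x.1 x.2) (ν := stdGaussian (Pos d))
    (measurable_coupledNoise_comp p K h ((measurable_chainOf hU K h a b k).comp measurable_fst)
      measurable_snd)
    (fun s => by rw [hN.map_inputs]; exact map_coupledNoise p K h _ _)
  simp only [chainOf_pastInputs] at h1
  exact h1

lemma iIndepFun_secondNoise (hU : PotentialAssumption p U) (K : Matrix (Fin d) (Fin d) ℝ) (h : ℝ)
    (a b : Phase d) :
    iIndepFun (fun k ω => secondNoiseOf p K U h a b k fun j => inputs ξ u j ω) P := by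
  apply iIndepFun_of_indepFun_past
  intro n
  have h1 := (hN.secondNoise_spec hU K h a b n).1
  have h2 : Measurable fun (s : ℕ → Pos d × ℝ) (i : Finset.range n) =>
      secondNoiseOf p K U h a b i s :=
    measurable_pi_lambda _ fun i => measurable_secondNoiseOf hU K h a b i
  have h3 := h1.comp h2 measurable_id
  have h4 : (fun ω (i : Finset.range n) => secondNoiseOf p K U h a b i fun j => inputs ξ u j ω)
      = (fun (s : ℕ → Pos d × ℝ) (i : Finset.range n) => secondNoiseOf p K U h a b i s)
        ∘ pastInputs ξ u n := by
    ext1 ω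
    ext1 i
    -- The increment with index `i < n` uses inputs up to `i + 1 ≤ n` only, hence the past at time
    -- `n`.
    refine secondNoiseOf_congr fun j hj => (pastOf_of_le _ _ ?_ ω).symm
    have := Finset.mem_range.1 i.2
    omega
  rw [h4]
  exact h3

/-- The new input is independent of the current state, so the one-step bound is integrated against
the law of the state. Working with lower integrals needs no prior integrability; finiteness is a
consequence. -/
lemma lintegral_rho_chainOf_le (hU : PotentialAssumption p U) (hS : Splitting p U K G)
    (H : ParamBounds p) (hh : 0 < h) (hc : StepCondition p (radius p K) h) (a b : Phase d)
    (k : ℕ) :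
    ∫⁻ ω, ENNReal.ofReal (rho p K (chainOf p K U h a b k fun j => inputs ξ u j ω).1
        (chainOf p K U h a b k fun j => inputs ξ u j ω).2) ∂P
      ≤ ENNReal.ofReal (1 - rate p (radius p K) * h) ^ k * ENNReal.ofReal (rho p K a b) := by
  induction k with
  | zero => simp [chainOf, chain]
  | succ k ih =>
    set S : Ω → Phase d × Phase d := fun ω => chainOf p K U h a b k (pastInputs ξ u k ω) with hSd
    have hSm : Measurable S := (measurable_chainOf hU K h a b k).comp (hN.measurable_pastInputs k)
    have hind : IndepFun S (inputs ξ u (k + 1)) P :=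
      (hN.indepFun_pastInputs k).comp (measurable_chainOf hU K h a b k) measurable_id
    have hlaw := (indepFun_iff_map_prod_eq_prod_map_map hSm.aemeasurable
      (hN.measurable_inputs (k + 1)).aemeasurable).1 hind
    rw [hN.map_inputs] at hlaw
    set Φ : (Phase d × Phase d) × (Pos d × ℝ) → ENNReal := fun x =>
      ENNReal.ofReal (rho p K (pairStep p K U h x.1 x.2).1 (pairStep p K U h x.1 x.2).2) with hΦ
    have hΦm : Measurable Φ :=
      ((measurable_rho p K).comp (measurable_pairStep hU K h)).ennreal_ofReal
    have hρm : Measurable fun s : Phase d × Phase d => ENNReal.ofReal (rho p K s.1 s.2) :=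
      (measurable_rho p K).ennreal_ofReal
    have : IsProbabilityMeasure (P.map S) := Measure.isProbabilityMeasure_map hSm.aemeasurable
    simp only [chainOf_succ, ← chainOf_pastInputs (ξ := ξ) (u := u) k]
    have h1 : ∫⁻ ω, Φ (S ω, inputs ξ u (k + 1) ω) ∂P
        = ∫⁻ s, ∫⁻ x, Φ (s, x) ∂(noiseLaw d) ∂(P.map S) := by
      rw [← lintegral_prod _ hΦm.aemeasurable, ← hlaw,
        lintegral_map hΦm (hSm.prodMk (hN.measurable_inputs (k + 1)))]
    refine h1.trans_le ?_
    calc ∫⁻ s, ∫⁻ x, Φ (s, x) ∂(noiseLaw d) ∂(P.map S)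
        ≤ ∫⁻ s, ENNReal.ofReal (1 - rate p (radius p K) * h) * ENNReal.ofReal (rho p K s.1 s.2)
          ∂(P.map S) := lintegral_mono fun s => lintegral_rho_pairStep_le hU hS H hh hc s
      _ = ENNReal.ofReal (1 - rate p (radius p K) * h)
          * ∫⁻ ω, ENNReal.ofReal (rho p K (S ω).1 (S ω).2) ∂P := by
        rw [lintegral_const_mul _ hρm, lintegral_map hρm hSm]
      _ ≤ ENNReal.ofReal (1 - rate p (radius p K) * h)
          * (ENNReal.ofReal (1 - rate p (radius p K) * h) ^ k * ENNReal.ofReal (rho p K a b)) := by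
        simp only [hSd, chainOf_pastInputs]
        exact mul_le_mul_right ih _
      _ = _ := by rw [pow_succ']; ring

/-- The distance of the coupled chains is integrable and contracts on average. -/
theorem integral_rho_chainOf_le (hU : PotentialAssumption p U) (hS : Splitting p U K G)
    (H : ParamBounds p) (hh : 0 < h) (hc : StepCondition p (radius p K) h) (a b : Phase d)
    (k : ℕ) :
    Integrable (fun ω => rho p K (chainOf p K U h a b k fun j => inputs ξ u j ω).1
        (chainOf p K U h a b k fun j => inputs ξ u j ω).2) P ∧
      ∫ ω, rho p K (chainOf p K U h a b k fun j => inputs ξ u j ω).1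
        (chainOf p K U h a b k fun j => inputs ξ u j ω).2 ∂P
        ≤ (1 - rate p (radius p K) * h) ^ k * rho p K a b := by
  have hle := hN.lintegral_rho_chainOf_le hU hS H hh hc a b k
  have hm := isMetric_rho hS.spectral H
  have hr := rate_mul_le_one H (admissible hS.spectral H).R_nonneg hh hc
  have hr0 : 0 ≤ 1 - rate p (radius p K) * h := by linarith
  rw [← ENNReal.ofReal_pow hr0, ← ENNReal.ofReal_mul (pow_nonneg hr0 k)] at hle
  have hmeas : Measurable fun ω => rho p K (chainOf p K U h a b k fun j => inputs ξ u j ω).1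
      (chainOf p K U h a b k fun j => inputs ξ u j ω).2 :=
    (measurable_rho p K).comp ((measurable_chainOf hU K h a b k).comp
      (measurable_pi_lambda _ fun j => hN.measurable_inputs j))
  have h0 : 0 ≤ᵐ[P] fun ω => rho p K (chainOf p K U h a b k fun j => inputs ξ u j ω).1
      (chainOf p K U h a b k fun j => inputs ξ u j ω).2 :=
    Filter.Eventually.of_forall fun ω => hm.nonneg _ _
  refine ⟨(lintegral_ofReal_ne_top_iff_integrable hmeas.aestronglyMeasurable h0).1
    (hle.trans_lt ENNReal.ofReal_lt_top).ne, ?_⟩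
  rw [integral_eq_lintegral_of_nonneg_ae h0 hmeas.aestronglyMeasurable]
  exact ENNReal.toReal_le_of_le_ofReal (mul_nonneg (pow_nonneg hr0 k) (hm.nonneg a b)) hle

end IsDrivingNoise

end

end

end KineticLangevin

end

/-! ### The main theorem -/

open KineticLangevin
theorem mainTheorem1 (p : Params) (hγ : 0 < p.γ) (hγG : 4 * p.LG / Real.sqrt p.κ ≤ p.γ) :
    ∃ R₁ : ℝ, 0 ≤ R₁ ∧
      ∀ (d : ℕ) (U : Pos d → ℝ) (K : Matrix (Fin d) (Fin d) ℝ) (G : Pos d → ℝ),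
        PotentialAssumption p U → Splitting p U K G →
        -- the constant `R₁`, hence also `f`, `ĉ` and `c`, does not depend on `d`
        radius p K = R₁ ∧
        0 < rate p R₁ ∧
        -- `ρ` is a distance on `ℝ^{2d}`, equivalent to the Euclidean one
        IsMetric (rho p K) ∧
        (∀ a b : Phase d, euclDist a b ≤ constN p R₁ * rho p K a b ∧
          constN p R₁ * rho p K a b ≤ constM p R₁ * euclDist a b) ∧
        -- contraction for the coupled Euler-Maruyama chains
        ∀ h : ℝ, 0 < h → StepCondition p R₁ h →
          ∀ {Ω : Type*} [MeasurableSpace Ω] (P : Measure Ω) [IsProbabilityMeasure P]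
            (ξ : ℕ → Ω → Pos d) (u : ℕ → Ω → ℝ), IsDrivingNoise P ξ u →
          ∀ a b : Phase d,
            -- the second copy is driven by independent standard normal increments, too
            (∀ k, P.map (fun ω => secondNoise p K U h a b (fun j => ξ j ω) (fun j => u j ω) k)
              = stdGaussian (Pos d)) ∧
            iIndepFun
              (fun k ω => secondNoise p K U h a b (fun j => ξ j ω) (fun j => u j ω) k) P ∧
            ∀ k : ℕ,
              Integrable (fun ω => rho p K
                (chain p K U h a b (fun j => ξ j ω) (fun j => u j ω) k).1
                (chain p K U h a b (fun j => ξ j ω) (fun j => u j ω) k).2) P ∧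
              ∫ ω, rho p K
                (chain p K U h a b (fun j => ξ j ω) (fun j => u j ω) k).1
                (chain p K U h a b (fun j => ξ j ω) (fun j => u j ω) k).2 ∂P
              ≤ (1 - rate p R₁ * h) ^ k * rho p K a b := by
  -- The radius is chosen before the potential is given, when `α ≥ 0` is not yet known; the maximum
  -- with `0` makes it nonnegative regardless.
  refine ⟨max 0 (scalarRadius p), le_max_left _ _, fun d U K G hU hS => ?_⟩
  have H := hS.paramBounds hγ hγG hU
  have hSp := hS.spectral
  have hR : radius p K = max 0 (scalarRadius p) := by
    rw [radius_eq hSp H, max_eq_right (scalarRadius_nonneg H.alpha_pos.le)]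
  rw [← hR]
  refine ⟨rfl, rate_pos H (admissible hSp H).R_nonneg, isMetric_rho hSp H,
    fun a b => ⟨euclDist_le_rho hSp H a b, rho_le_euclDist hSp H a b⟩, ?_⟩
  intro h hh hc Ω _ P _ ξ u hN a b
  exact ⟨fun k => (hN.secondNoise_spec hU K h a b k).2, hN.iIndepFun_secondNoise hU K h a b,
    hN.integral_rho_chainOf_le hU hS H hh hc a b⟩
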